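/- **Theorem 3.5.** Let $M$ be a closed (compact, without boundary) smooth manifold with a bivector field $w$, $w^{ij}=-w^{ji}$, that is either Poisson (the bracket $\{f,g\}=w(df,dg)$ satisfies the Jacobi identity) or the inverse of a symplectic form $\omega$ on $M$ ($w^{ij}\omega_{jk}=\delta^i_k$; every symplectic form has such an inverse). Write $w\vdash\alpha=\tfrac12 w^{ij}\,e_i\vdash e_j\vdash\alpha$, where $(X\vdash\alpha)(V_2,\dots)=\alpha(X,V_2,\dots)$; let $\delta\alpha=w\vdash d\alpha-d(w\vdash\alpha)$ be the Koszul codifferential and $d_h=d-h\delta$ on $\Omega(M)[h,h^{-1}]$, where $h$ has degree $2$. Let $$\alpha\wedge_h\beta=\sum_{n\ge0}\frac{h^n}{n!}\,w^{i_1j_1}\cdots w^{i_nj_n}\,(\alpha\dashv e_{i_1}\dashv\cdots\dashv e_{i_n})\wedge(e_{j_n}\vdash\cdots\vdash e_{j_1}\vdash\beta),$$ extended $\mathbb R[h,h^{-1}]$-bilinearly, where $(\alpha\dashv X)(V_1,\dots,V_{k-1})=\alpha(V_1,\dots,V_{k-1},X)$. Then: 1. $d_h^2=0$, and the spectral sequence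 $\tilde E$ of the double complex $\tilde C^{p,q}=h^p\,\Omega^{q-p}(M)$ ($p,q\in\mathbb Z$) with differentials $d$ and $-h\delta$, filtered by $p$, so that $d_0=d$ and $\tilde E_1^{p,q}=h^pH^{q-p}_{dR}(M)$, degenerates at $\tilde E_1$: all differentials $d_r:\tilde E_r^{p,q}\to\tilde E_r^{p+r,q-r+1}$ with $r\ge1$ vanish. 2. The Laurent quantum de Rham cohomology $Q_{h,h^{-1}}H^*_{dR}(M)=\operatorname{Ker}d_h/\operatorname{Im}d_h$, with the product induced by $\wedge_h$, is a Laurent deformation quantization of the ring $H^*_{dR}(M)$: it is a unital associative graded $\mathbb R[h,h^{-1}]$-algebra, and there is an isomorphism of graded $\mathbb R[h,h^{-1}]$-modules $H^*_{dR}(M)\otimes\mathbb R[h,h^{-1}]\cong Q_{h,h^{-1}}H^*_{dR}(M)$ under which the product of $a,b\in H^*_{dR}(M)$ has the form $a\cdot b+\sum_{j\ne0}f_j(a,b)\,h^j$, with $a\cdot b$ the usual product. 3. Every closed form $\alpha\in\Omega^k(M)$ extends to a $d_h$-closed form $\alpha_h=\alpha+\sum_{j\ge1}h^j\alpha_j$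 of total degree $k$, $\alpha_j\in\Omega^{k-2j}(M)$. -/

import Mathlib

noncomputable section
namespace QDR

open LaurentPolynomial
open scoped TensorProduct

/-- Vector fields on a manifold `M`, for `A = C^∞(M)`: the module of derivations of the real algebra
`C^∞(M)`, with the commutator as Lie bracket. -/
abbrev VectorField (A : Type*) [CommRing A] [Algebra ℝ A] : Type _ := Derivation ℝ A A

/-- `Ω^k(M)` for `A = C^∞(M)`: differential `k`-forms, as alternating `C^∞(M)`-multilinear functions of
`k` vector fields with values in `C^∞(M)` (by tensoriality these are the smooth sections of
`Λ^k T^*M`). -/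
abbrev Form (A : Type*) [CommRing A] [Algebra ℝ A] (k : ℕ) : Type _ :=
  VectorField A [⋀^Fin k]→ₗ[A] A

variable {A : Type*} [CommRing A] [Algebra ℝ A]

lemma update_update_bracket {k : ℕ} (X : VectorField A) (v : Fin k → VectorField A)
    (i j : Fin k) (y : VectorField A) (h : j ≠ i) :
    Function.update (Function.update v i y) j ⁅X, Function.update v i y j⁆ =
      Function.update (Function.update v j ⁅X, v j⁆) i y := by
  rw [Function.update_of_ne h, Function.update_comm h]

/-- The form `X ↦ ((V₁, …, V_k) ↦ X (α (V₁, …, V_k)) - ½ ∑ⱼ α (V₁, …, [X, Vⱼ], …, V_k))`, linear in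
`X` and alternating in the `Vⱼ` over the reals. -/
def koszulTerm {k : ℕ} (α : Form A k) :
    VectorField A →ₗ[ℝ] VectorField A [⋀^Fin k]→ₗ[ℝ] A where
  toFun X :=
    { toFun := fun v => X (α v) - (2⁻¹ : ℝ) • ∑ j, α (Function.update v j ⁅X, v j⁆)
      map_update_add' := by
        intro inst v i x y
        obtain rfl : inst = instDecidableEqFin k := Subsingleton.elim _ _
        have key : ∀ j, α (Function.update (Function.update v i (x + y)) j
              ⁅X, Function.update v i (x + y) j⁆) =
            α (Function.update (Function.update v i x) j ⁅X, Function.update v i x j⁆) +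
            α (Function.update (Function.update v i y) j ⁅X, Function.update v i y j⁆) := by
          intro j
          by_cases h : j = i
          · subst h; simp
          · simp only [update_update_bracket X v i j _ h, α.map_update_add]
        simp only [key, α.map_update_add, map_add, Finset.sum_add_distrib, smul_add]
        abel
      map_update_smul' := by
        intro inst v i c x
        obtain rfl : inst = instDecidableEqFin k := Subsingleton.elim _ _
        have hs : ∀ (u : Fin k → VectorField A) (z : VectorField A),
            α (Function.update u i (c • z)) = c • α (Function.update u i z) := by
          intro u z
          rw [← algebraMap_smul A c z, α.map_update_smul, algebraMap_smul]
        have key : ∀ j, α (Function.update (Function.update v i (c • x)) j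
              ⁅X, Function.update v i (c • x) j⁆) =
            c • α (Function.update (Function.update v i x) j ⁅X, Function.update v i x j⁆) := by
          intro j
          by_cases h : j = i
          · subst h; simp [hs]
          · simp only [update_update_bracket X v i j _ h, hs]
        simp only [key, hs, ← Finset.smul_sum, Derivation.map_smul, smul_sub]
        rw [smul_comm c]
      map_eq_zero_of_eq' := by
        intro v i j hv hij
        have h0 : ∑ l, α (Function.update v l ⁅X, v l⁆) =
            α (Function.update v i ⁅X, v i⁆) + α (Function.update v j ⁅X, v j⁆) := by
          refine Fintype.sum_eq_add i j hij fun l hl => ?_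
          refine α.map_eq_zero_of_eq _ (i := i) (j := j) ?_ hij
          rw [Function.update_of_ne hl.1.symm, Function.update_of_ne hl.2.symm, hv]
        have h1 : Function.update v j ⁅X, v j⁆ =
            Function.update v i ⁅X, v i⁆ ∘ Equiv.swap i j := by
          funext l
          by_cases hi : l = i
          · subst hi; simp [hij, hij.symm, hv]
          · by_cases hj : l = j
            · subst hj; simp [hv]
            · simp [Equiv.swap_apply_of_ne_of_ne hi hj, hi, hj]
        simp only [h0, h1, α.map_swap _ hij, α.map_eq_zero_of_eq v hv hij]
        simp }
  map_add' X Y := by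
    ext v
    simp only [AlternatingMap.coe_mk, MultilinearMap.coe_mk, AlternatingMap.add_apply, add_lie,
      α.map_update_add, Finset.sum_add_distrib, smul_add, Derivation.add_apply]
    abel
  map_smul' c X := by
    ext v
    have hs : ∀ (i : Fin k) (u : Fin k → VectorField A) (z : VectorField A),
        α (Function.update u i (c • z)) = c • α (Function.update u i z) := by
      intro i u z
      rw [← algebraMap_smul A c z, α.map_update_smul, algebraMap_smul]
    simp only [AlternatingMap.coe_mk, MultilinearMap.coe_mk, AlternatingMap.smul_apply, smul_lie,
      hs, ← Finset.smul_sum, Derivation.smul_apply, smul_sub, RingHom.id_apply]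
    rw [smul_comm c]

lemma koszulTerm_apply {k : ℕ} (α : Form A k) (X : VectorField A) (v : Fin k → VectorField A) :
    koszulTerm α X v = X (α v) - (2⁻¹ : ℝ) • ∑ j, α (Function.update v j ⁅X, v j⁆) := rfl

lemma smul_bracket (f : A) (X Y : VectorField A) : ⁅f • X, Y⁆ = f • ⁅X, Y⁆ - Y f • X := by
  ext g; simp [Derivation.commutator_apply, mul_sub]; ring

lemma bracket_smul (f : A) (X Y : VectorField A) : ⁅X, f • Y⁆ = f • ⁅X, Y⁆ + X f • Y := by
  ext g; simp [Derivation.commutator_apply]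

lemma koszul_smul {k : ℕ} (α : Form A k) (f : A) (x : VectorField A) (u : Fin k → VectorField A) :
    AlternatingMap.alternatizeUncurryFin (koszulTerm α) (Matrix.vecCons (f • x) u) =
      f • AlternatingMap.alternatizeUncurryFin (koszulTerm α) (Matrix.vecCons x u) := by
  have hterm : ∀ i : Fin k,
      koszulTerm α (u i) (i.succ.removeNth (Matrix.vecCons (f • x) u)) =
      f • koszulTerm α (u i) (i.succ.removeNth (Matrix.vecCons x u)) +
        (2⁻¹ : ℝ) • (u i f • α (i.succ.removeNth (Matrix.vecCons x u))) := by
    intro i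
    cases k with
    | zero => exact i.elim0
    | succ k =>
      have hr : ∀ z : VectorField A, i.succ.removeNth (Matrix.vecCons z u) =
          Matrix.vecCons z (i.removeNth u) := by
        intro z; funext j; refine Fin.cases ?_ (fun j => ?_) j <;> simp [Fin.removeNth]
      have h0 : ∀ z z' : VectorField A, ∀ w : Fin k → VectorField A,
          Function.update (Matrix.vecCons z w) 0 z' = Matrix.vecCons z' w := by
        intro z z' w; exact Fin.update_cons_zero _ _ _
      have h1 : ∀ z z' : VectorField A, ∀ w : Fin k → VectorField A, ∀ j : Fin k,
          Function.update (Matrix.vecCons z w) j.succ z' =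
            Matrix.vecCons z (Function.update w j z') := by
        intro z z' w j; exact (Fin.cons_update _ _ _ _).symm
      simp only [hr, koszulTerm_apply, Fin.sum_univ_succ, h0, h1, Matrix.cons_val_zero,
        Matrix.cons_val_succ, bracket_smul, α.map_vecCons_smul, α.map_vecCons_add,
        Derivation.leibniz, smul_eq_mul, ← Finset.mul_sum]
      simp only [Algebra.smul_def]
      have : algebraMap ℝ A 2⁻¹ * 2 = 1 := by
        rw [← map_ofNat (algebraMap ℝ A) 2, ← map_mul]; norm_num
      linear_combination (- (u i f) * α (Matrix.vecCons x (i.removeNth u))) * this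
  have hmove : ∀ j : Fin k, α (Function.update u j x) =
      (-1 : ℤ) ^ (j : ℕ) • α (j.succ.removeNth (Matrix.vecCons x u)) := by
    intro j
    cases k with
    | zero => exact j.elim0
    | succ k =>
      have hr : j.succ.removeNth (Matrix.vecCons x u) =
          Matrix.vecCons x (j.removeNth u) := by
        funext l; refine Fin.cases ?_ (fun j => ?_) l <;> simp [Fin.removeNth]
      rw [hr, ← Fin.insertNth_removeNth, AlternatingMap.map_insertNth]
  have hfirst : koszulTerm α (f • x) u = f • koszulTerm α x u +
      (2⁻¹ : ℝ) • ∑ j : Fin k, (-1 : ℤ) ^ (j : ℕ) •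
        (u j f • α (j.succ.removeNth (Matrix.vecCons x u))) := by
    simp only [koszulTerm_apply, smul_bracket, α.map_update_sub, α.map_update_smul, hmove,
      Finset.sum_sub_distrib, Derivation.smul_apply, smul_sub, ← Finset.smul_sum]
    rw [smul_comm f, sub_sub_eq_add_sub, add_sub_right_comm]
    simp only [smul_comm (_ : A) ((-1 : ℤ) ^ _)]
  have ht : ∀ z : VectorField A, Fin.tail (Matrix.vecCons z u) = u := fun z => rfl
  simp only [AlternatingMap.alternatizeUncurryFin_apply, Fin.sum_univ_succ, Matrix.cons_val_zero,
    Matrix.cons_val_succ, hterm, Fin.removeNth_zero, ht, hfirst, Fin.val_zero, pow_zero, one_smul,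
    Fin.val_succ, pow_succ, smul_add, Finset.sum_add_distrib, Finset.smul_sum, mul_neg, mul_one,
    neg_smul, Finset.sum_neg_distrib, smul_neg, smul_comm f ((-1 : ℤ) ^ _),
    smul_comm (2⁻¹ : ℝ) ((-1 : ℤ) ^ _)]
  abel

/-- The exterior derivative `Ω^k(M) → Ω^{k+1}(M)`, by Koszul's formula
`dα (X₀, …, X_k) = ∑ᵢ (-1)^i Xᵢ (α (…, X̂ᵢ, …)) + ∑_{i<j} (-1)^{i+j} α ([Xᵢ, Xⱼ], …, X̂ᵢ, …, X̂ⱼ, …)`.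
In the second sum `[Xᵢ, Xⱼ]` is moved to the place of the other field of the pair, so that every
pair is counted twice, once from `i` and once from `j`; this is why `koszulTerm` has the factor `½`. -/
def extDerivForm {k : ℕ} (α : Form A k) : Form A (k + 1) :=
  { AlternatingMap.alternatizeUncurryFin (koszulTerm α) with
    map_update_add' := fun v i x y =>
      (AlternatingMap.alternatizeUncurryFin (koszulTerm α)).map_update_add' v i x y
    map_update_smul' := by
      intro inst v i f x
      obtain rfl : inst = instDecidableEqFin (k + 1) := Subsingleton.elim _ _
      have key : ∀ z, AlternatingMap.alternatizeUncurryFin (koszulTerm α)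
          (Function.update v i z) = (-1 : ℤ) ^ (i : ℕ) •
          AlternatingMap.alternatizeUncurryFin (koszulTerm α)
            (Matrix.vecCons z (i.removeNth v)) := by
        intro z
        rw [← Fin.insertNth_removeNth, AlternatingMap.map_insertNth]
      change AlternatingMap.alternatizeUncurryFin (koszulTerm α) _ =
        f • AlternatingMap.alternatizeUncurryFin (koszulTerm α) _
      rw [key, key, koszul_smul, smul_comm] }


/-- `Ω(M) = ⨁_k Ω^k(M)`. -/
abbrev Forms (A : Type*) [CommRing A] [Algebra ℝ A] : Type _ := DirectSum ℕ fun k => Form A k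

instance instAddCommGroupForms : AddCommGroup (Forms A) := DirectSum.instAddCommGroup

instance instIsScalarTowerForm (k : ℕ) : IsScalarTower ℝ A (Form A k) :=
  ⟨fun c f α => by ext v; simp only [AlternatingMap.smul_apply, smul_assoc]⟩

/-- The inclusion `Ω^k(M) → Ω(M)`. -/
def ofForm {k : ℕ} (α : Form A k) : Forms A := DirectSum.lof A ℕ (fun k => Form A k) k α

lemma extDerivForm_apply {k : ℕ} (α : Form A k) (v : Fin (k + 1) → VectorField A) :
    extDerivForm α v = ∑ i : Fin (k + 1), (-1 : ℤ) ^ (i : ℕ) •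
      (v i (α (i.removeNth v)) -
        (2⁻¹ : ℝ) • ∑ j, α (Function.update (i.removeNth v) j ⁅v i, i.removeNth v j⁆)) :=
  AlternatingMap.alternatizeUncurryFin_apply _ _

/-- The exterior differential `d : Ω(M) → Ω(M)`. -/
def exteriorD : Forms A →ₗ[ℝ] Forms A :=
  DirectSum.toModule ℝ ℕ (Forms A) fun k =>
    DirectSum.lof ℝ ℕ (fun k => Form A k) (k + 1) ∘ₗ
      { toFun := fun α : Form A k => extDerivForm α
        map_add' := fun α β => by
          ext v
          simp only [extDerivForm_apply, AlternatingMap.add_apply, map_add, Finset.sum_add_distrib,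
            smul_add, smul_sub, Finset.sum_sub_distrib]
          abel
        map_smul' := fun c α => by
          ext v
          simp only [extDerivForm_apply, AlternatingMap.smul_apply, Derivation.map_smul,
            ← Finset.smul_sum, RingHom.id_apply]
          rw [Finset.smul_sum]
          refine Finset.sum_congr rfl fun i _ => ?_
          rw [smul_comm (2⁻¹ : ℝ) c, ← smul_sub, smul_comm c] }

/-- Contraction from the left, `(X ⊢ α)(V₂, …, V_k) = α (X, V₂, …, V_k)`. -/
def leftContraction : VectorField A →ₗ[A] Module.End A (Forms A) :=
  (DirectSum.toModule A ℕ (VectorField A →ₗ[A] Forms A) fun k =>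
    match k with
    | 0 => 0
    | k + 1 => AlternatingMap.curryLeftLinearMap.compr₂
        (DirectSum.lof A ℕ (fun k => Form A k) k)).flip

/-- Contraction from the right, `(α ⊣ X)(V₁, …, V_{k-1}) = α (V₁, …, V_{k-1}, X)`, that is
`(-1)^{k-1} X ⊢ α` for `α ∈ Ω^k(M)`. -/
def rightContraction : VectorField A →ₗ[A] Module.End A (Forms A) :=
  (DirectSum.toModule A ℕ (VectorField A →ₗ[A] Forms A) fun k =>
    match k with
    | 0 => 0
    | k + 1 => (-1 : A) ^ k • AlternatingMap.curryLeftLinearMap.compr₂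
        (DirectSum.lof A ℕ (fun k => Form A k) k)).flip

/-- The exterior product `Ω^k(M) × Ω^l(M) → Ω^{k+l}(M)`, as a signed sum over shuffles, so that
`(α ∧ β)(X, Y) = α(X) β(Y) - α(Y) β(X)` for one-forms. -/
def wedgeForm (k l : ℕ) : Form A k →ₗ[A] Form A l →ₗ[A] Form A (k + l) :=
  TensorProduct.curry
    ((AlternatingMap.domDomCongrₗ A (finSumFinEquiv (m := k) (n := l))).toLinearMap ∘ₗ
      LinearMap.compAlternatingMapₗ A (LinearMap.mul' A A) ∘ₗ
      AlternatingMap.domCoprod')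

/-- The exterior product on `Ω(M)`. -/
def wedge : Forms A →ₗ[A] Forms A →ₗ[A] Forms A :=
  DirectSum.toModule A ℕ _ fun k =>
    (DirectSum.toModule A ℕ (Form A k →ₗ[A] Forms A) fun l =>
      ((wedgeForm k l).compr₂ (DirectSum.lof A ℕ (fun k => Form A k) (k + l))).flip).flip


/-- Bivector fields `w = w^{ij} e_i ⊗ e_j`, `w^{ij} = -w^{ji}`, as skew-symmetric tensors. -/
def Bivector (A : Type*) [CommRing A] [Algebra ℝ A] : Type _ :=
  {w : VectorField A ⊗[A] VectorField A // TensorProduct.comm A _ _ w = -w}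

/-- The contraction `w ⊢ α = ½ w^{ij} e_i ⊢ e_j ⊢ α = ∑_{i<j} w^{ij} e_i ⊢ e_j ⊢ α`. -/
def contract (w : Bivector A) : Module.End A (Forms A) :=
  algebraMap ℝ A 2⁻¹ • TensorProduct.lift
    ((LinearMap.mul A (Module.End A (Forms A))).compl₁₂ leftContraction leftContraction) w.1

/-- Koszul's codifferential `δα = w ⊢ dα - d (w ⊢ α)`. -/
def codiff (w : Bivector A) : Forms A →ₗ[ℝ] Forms A :=
  (contract w).restrictScalars ℝ ∘ₗ exteriorD - exteriorD ∘ₗ (contract w).restrictScalars ℝ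

/-- `X ↦ X f`. -/
def evalAt (f : A) : VectorField A →ₗ[A] A where
  toFun X := X f
  map_add' _ _ := rfl
  map_smul' _ _ := rfl

/-- `{f, g} = w(df, dg) = w^{ij} (e_i f) (e_j g)`. -/
def poissonBracket (w : Bivector A) (f g : A) : A :=
  TensorProduct.lift ((LinearMap.mul A A).compl₁₂ (evalAt f) (evalAt g)) w.1

/-- `w` is a Poisson bivector field: `{·, ·}` satisfies the Jacobi identity (it is skew-symmetric and a
biderivation because `w` is a bivector field). -/
def IsPoisson (w : Bivector A) : Prop :=
  ∀ f g h : A, poissonBracket w f (poissonBracket w g h) +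
    poissonBracket w g (poissonBracket w h f) + poissonBracket w h (poissonBracket w f g) = 0

/-- A symplectic form: a closed two-form `σ` for which `X ↦ σ(X, ·)` is an isomorphism of vector fields
onto one-forms. -/
def IsSymplectic (σ : Form A 2) : Prop :=
  extDerivForm σ = 0 ∧ Function.Bijective fun X : VectorField A => σ.curryLeft X

/-- `w ↦ w^{ij} σ(e_j, Z) e_i`. -/
def raise (σ : Form A 2) (Z : VectorField A) :
    VectorField A ⊗[A] VectorField A →ₗ[A] VectorField A :=
  TensorProduct.lift (LinearMap.mk₂ A (fun X Y => σ ![Y, Z] • X)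
    (fun _ _ _ => smul_add _ _ _) (fun _ _ _ => smul_comm _ _ _)
    (fun X Y Y' => by rw [AlternatingMap.map_vecCons_add, add_smul])
    (fun c X Y => by rw [AlternatingMap.map_vecCons_smul, smul_assoc]))

/-- The matrix `w^{ij}` is the inverse of `σ_{ij} = σ(e_i, e_j)`: `w^{ij} σ_{jk} = δ^i_k`. -/
def IsInverse (σ : Form A 2) (w : Bivector A) : Prop :=
  ∀ Z : VectorField A, raise σ Z w.1 = Z

/-- `V[h, h⁻¹] = ℝ[h, h⁻¹] ⊗ V`; the element `h^p` is `T p`. -/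
abbrev Laurent (V : Type*) [AddCommGroup V] [Module ℝ V] : Type _ := ℝ[T;T⁻¹] ⊗[ℝ] V

/-- `d_h = d - h δ` on `Ω(M)[h, h⁻¹]`. -/
def dh (w : Bivector A) : Laurent (Forms A) →ₗ[ℝ[T;T⁻¹]] Laurent (Forms A) :=
  exteriorD.baseChange ℝ[T;T⁻¹] - (T 1 : ℝ[T;T⁻¹]) • (codiff w).baseChange ℝ[T;T⁻¹]

/-- `L_w (α ⊗ β) = w^{ij} (α ⊣ e_i) ⊗ (e_j ⊢ β)`. -/
def contractBoth (w : Bivector A) : Module.End A (Forms A ⊗[A] Forms A) :=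
  TensorProduct.lift
    ((TensorProduct.mapBilinear (RingHom.id A) (Forms A) (Forms A) (Forms A) (Forms A)).compl₁₂
      rightContraction leftContraction) w.1

/-- `α ∧_h β = ∑_n h^n / n! • m (L_w^n (α ⊗ β))` for `α ∈ Ω^k(M)`, `m` the exterior product. The terms
with `n > k` vanish, since `L_w` lowers the degree of the first factor by one. -/
def quantumWedgeForm (w : Bivector A) (k : ℕ) :
    Form A k →ₗ[ℝ] Forms A →ₗ[ℝ] Laurent (Forms A) :=
  LinearMap.mk₂ ℝ (fun α β => ∑ n ∈ Finset.range (k + 1), ((n.factorial : ℝ)⁻¹) •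
      ((T n : ℝ[T;T⁻¹]) ⊗ₜ[ℝ]
        TensorProduct.lift wedge ((contractBoth w ^ n) (ofForm α ⊗ₜ[A] β))))
    (fun α α' β => by simp [ofForm, TensorProduct.add_tmul, TensorProduct.tmul_add, Finset.sum_add_distrib])
    (fun c α β => by
      have h : ofForm (c • α) = algebraMap ℝ A c • ofForm α := by
        rw [ofForm, ← algebraMap_smul A c α, map_smul]; rfl
      simp only [h, ← TensorProduct.smul_tmul', map_smul]
      simp only [algebraMap_smul, TensorProduct.tmul_smul, Finset.smul_sum]
      exact Finset.sum_congr rfl fun n _ => smul_comm _ _ _)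
    (fun α β β' => by simp [TensorProduct.tmul_add, Finset.sum_add_distrib])
    (fun c α β => by
      rw [← algebraMap_smul A c β]
      simp only [TensorProduct.tmul_smul, map_smul]
      simp only [algebraMap_smul, TensorProduct.tmul_smul, Finset.smul_sum]
      exact Finset.sum_congr rfl fun n _ => smul_comm _ _ _)

/-- The quantum exterior product `Ω(M) × Ω(M) → Ω(M)[h, h⁻¹]`. -/
def quantumWedgeForms (w : Bivector A) : Forms A →ₗ[ℝ] Forms A →ₗ[ℝ] Laurent (Forms A) :=
  DirectSum.toModule ℝ ℕ _ (quantumWedgeForm w)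

/-- The quantum exterior product, extended to be bilinear over `ℝ[h, h⁻¹]`. -/
def quantumWedge (w : Bivector A) :
    Laurent (Forms A) →ₗ[ℝ[T;T⁻¹]] Laurent (Forms A) →ₗ[ℝ[T;T⁻¹]] Laurent (Forms A) :=
  LinearMap.liftBaseChange ℝ[T;T⁻¹]
    (((LinearMap.liftBaseChangeEquiv ℝ[T;T⁻¹]).toLinearMap.restrictScalars ℝ) ∘ₗ
      quantumWedgeForms w)


section Algebra

variable {R : Type*} [CommRing R] {V : Type*} [AddCommGroup V] [Module R V]

/-- `Ker D / Im D` (used for `D ∘ D = 0`, when `Im D ⊆ Ker D`). -/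
abbrev Cohomology (D : V →ₗ[R] V) : Type _ :=
  LinearMap.ker D ⧸ (LinearMap.range D).comap (LinearMap.ker D).subtype

/-- The class of `x ∈ Ker D`. -/
def cls (D : V →ₗ[R] V) (x : V) (hx : D x = 0) : Cohomology D :=
  Submodule.Quotient.mk ⟨x, hx⟩

/-- `m` is the product induced on `Ker D / Im D` by `μ`: the product of two cocycles is a cocycle, and
`[a] · [b] = [μ a b]`. -/
def IsInducedProduct (D : V →ₗ[R] V) (μ : V →ₗ[R] V →ₗ[R] V)
    (m : Cohomology D →ₗ[R] Cohomology D →ₗ[R] Cohomology D) : Prop :=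
  ∀ (a b : V) (ha : D a = 0) (hb : D b = 0),
    ∃ hab : D (μ a b) = 0, m (cls D a ha) (cls D b hb) = cls D (μ a b) hab

/-- The classes that have a representative in `G n`. -/
def cohomologyPiece [Algebra ℝ R] [Module ℝ V] [IsScalarTower ℝ R V] (D : V →ₗ[R] V)
    (G : ℤ → Submodule ℝ V) (n : ℤ) : Submodule ℝ (Cohomology D) where
  carrier := {c | ∃ (x : V) (hx : D x = 0), x ∈ G n ∧ cls D x hx = c}
  zero_mem' := ⟨0, map_zero D, zero_mem _, rfl⟩
  add_mem' := by
    rintro _ _ ⟨x, hx, hxG, rfl⟩ ⟨y, hy, hyG, rfl⟩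
    exact ⟨x + y, by rw [map_add, hx, hy, add_zero], add_mem hxG hyG, rfl⟩
  smul_mem' := by
    rintro c _ ⟨x, hx, hxG, rfl⟩
    refine ⟨c • x, ?_, Submodule.smul_mem _ c hxG, ?_⟩
    · rw [← algebraMap_smul R c x, map_smul, hx, smul_zero]
    · rfl

end Algebra

section Graded

variable {V : Type*} [AddCommGroup V] [Module ℝ V]

/-- `h^p V^k`, for a graded space with pieces `V^k = G k`. -/
def laurentPiece (G : ℤ → Submodule ℝ V) (p k : ℤ) : Submodule ℝ (Laurent V) :=
  (G k).map (TensorProduct.mk ℝ ℝ[T;T⁻¹] V (T p))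

/-- The piece `⨁_p h^p V^{n-2p}` of degree `n` of `V[h, h⁻¹]`, where `h` has degree 2. -/
def laurentDegree (G : ℤ → Submodule ℝ V) (n : ℤ) : Submodule ℝ (Laurent V) :=
  ⨆ p : ℤ, laurentPiece G p (n - 2 * p)

/-- The coefficient of `h^0`. -/
def constCoeff : Laurent V →ₗ[ℝ] V :=
  TensorProduct.lift (LinearMap.mk₂ ℝ (fun (P : ℝ[T;T⁻¹]) (a : V) => P.coeff 0 • a)
    (fun _ _ _ => add_smul _ _ _) (fun _ _ _ => smul_assoc _ _ _)
    (fun _ _ _ => smul_add _ _ _) (fun _ _ _ => smul_comm _ _ _))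

/-- The graded `ℝ[h, h⁻¹]`-algebra `(Q, mQ)` is a Laurent deformation of the graded algebra `(H, mH)`:
it is a unital associative algebra whose product is compatible with the grading, and there is an
isomorphism `Φ : H[h, h⁻¹] ≃ Q` of `ℝ[h, h⁻¹]`-modules that identifies the gradings (`h` of degree 2)
and under which `a · b` becomes `mH a b + ∑_{j ≠ 0} f_j(a, b) h^j` for `a, b ∈ H`. -/
structure IsLaurentDeformation {H Q : Type*} [AddCommGroup H] [Module ℝ H]
    [AddCommGroup Q] [Module ℝ[T;T⁻¹] Q] [Module ℝ Q]
    (GH : ℤ → Submodule ℝ H) (mH : H →ₗ[ℝ] H →ₗ[ℝ] H)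
    (GQ : ℤ → Submodule ℝ Q) (mQ : Q →ₗ[ℝ[T;T⁻¹]] Q →ₗ[ℝ[T;T⁻¹]] Q) : Prop where
  mul_assoc : ∀ x y z, mQ (mQ x y) z = mQ x (mQ y z)
  exists_one : ∃ e ∈ GQ 0, ∀ x, mQ e x = x ∧ mQ x e = x
  mul_mem : ∀ m n x y, x ∈ GQ m → y ∈ GQ n → mQ x y ∈ GQ (m + n)
  exists_equiv : ∃ Φ : Laurent H ≃ₗ[ℝ[T;T⁻¹]] Q,
    (∀ n, Φ '' (laurentDegree GH n : Set (Laurent H)) = GQ n) ∧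
    ∀ a b : H, constCoeff (Φ.symm (mQ (Φ (1 ⊗ₜ a)) (Φ (1 ⊗ₜ b)))) = mH a b

end Graded

section SpectralSequence

variable {V : Type*} [AddCommGroup V] [Module ℝ V] (C : ℤ → ℤ → Submodule ℝ V) (D : V →ₗ[ℝ] V)

/-- The filtration `F^p C^n = ⨁_{i ≥ p} C^{i, n-i}` of the total degree `n` part. -/
def filtration (p n : ℤ) : Submodule ℝ V := ⨆ i : ℤ, ⨆ _ : p ≤ i, C i (n - i)

/-- `Z_r^p = {x ∈ F^p C^n | D x ∈ F^{p+r} C^{n+1}}`. -/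
def pageCycles (r p n : ℤ) : Submodule ℝ V :=
  filtration C p n ⊓ (filtration C (p + r) (n + 1)).comap D

/-- `Z_{r-1}^{p+1} + D Z_{r-1}^{p-r+1}`, in total degree `n`. -/
def pageNull (r p n : ℤ) : Submodule ℝ V :=
  pageCycles C D (r - 1) (p + 1) n ⊔ (pageCycles C D (r - 1) (p - r + 1) (n - 1)).map D

/-- The term `E_r^{p,q} = Z_r^p / (Z_{r-1}^{p+1} + D Z_{r-1}^{p-r+1})`, in total degree `n = p + q`, of
the spectral sequence of the double complex. -/
abbrev Page (r p q : ℤ) : Type _ :=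
  pageCycles C D r p (p + q) ⧸ (pageNull C D r p (p + q)).comap (pageCycles C D r p (p + q)).subtype

variable {D}

/-- The differential `d_r : E_r^{p,q} → E_r^{p+r,q-r+1}`, induced by `D`. -/
def pageDiff (hD : ∀ x, D (D x) = 0) (r p q : ℤ) :
    Page C D r p q →ₗ[ℝ] Page C D r (p + r) (q - r + 1) :=
  Submodule.mapQ _ _
    (D.restrict (p := pageCycles C D r p (p + q))
      (q := pageCycles C D r (p + r) (p + r + (q - r + 1))) (by
        rintro x ⟨-, hx⟩
        refine ⟨?_, ?_⟩
        · have : p + r + (q - r + 1) = p + q + 1 := by ring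
          rw [this]; exact hx
        · change D (D x) ∈ filtration C _ _
          rw [hD]; exact zero_mem _))
    (by
      rintro ⟨x, hx'⟩ hx
      change D x ∈ pageNull C D r (p + r) (p + r + (q - r + 1))
      obtain ⟨y, hy, z, ⟨t, -, rfl⟩, rfl⟩ := Submodule.mem_sup.1 hx
      rw [map_add, hD, add_zero]
      refine Submodule.mem_sup_right ⟨y, ?_, rfl⟩
      have h1 : p + r - r + 1 = p + 1 := by ring
      have h2 : p + r + (q - r + 1) - 1 = p + q := by ring
      rw [h1, h2]; exact hy)

/-- All differentials `d_r` with `r ≥ 1` vanish. -/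
def DegeneratesAtE1 (hD : ∀ x, D (D x) = 0) : Prop :=
  ∀ r : ℤ, 1 ≤ r → ∀ p q : ℤ, pageDiff C hD r p q = 0

end SpectralSequence

/-- `Ω^k(M)` as a subspace of `Ω(M)`, for an integer `k` (zero for `k < 0`). -/
def formDegree (A : Type*) [CommRing A] [Algebra ℝ A] (k : ℤ) : Submodule ℝ (Forms A) :=
  ⨆ n : ℕ, ⨆ _ : (n : ℤ) = k, LinearMap.range (DirectSum.lof ℝ ℕ (fun k => Form A k) n)

/-- `C^{p,q} = h^p Ω^{q-p}(M)`. -/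
def doubleComplex (A : Type*) [CommRing A] [Algebra ℝ A] (p q : ℤ) : Submodule ℝ (Laurent (Forms A)) :=
  laurentPiece (formDegree A) p (q - p)

/-- The exterior product on `Ω(M)` as a bilinear map over the reals. -/
def wedgeReal : Forms A →ₗ[ℝ] Forms A →ₗ[ℝ] Forms A :=
  LinearMap.mk₂ ℝ (fun α β => wedge α β) (by simp) (by
      intro c α β
      rw [← algebraMap_smul A c α, map_smul, LinearMap.smul_apply, algebraMap_smul])
    (by simp) (by
      intro c α β
      rw [← algebraMap_smul A c β, map_smul, algebraMap_smul])


/-- De Rham cohomology. -/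
abbrev DeRhamCohomology (A : Type*) [CommRing A] [Algebra ℝ A] : Type _ :=
  Cohomology (exteriorD : Forms A →ₗ[ℝ] Forms A)

/-- Laurent quantum de Rham cohomology `Ker d_h / Im d_h` on `Ω(M)[h, h⁻¹]`. -/
abbrev QuantumDeRhamCohomology (w : Bivector A) : Type _ := Cohomology (dh w)

/-- `d_h ∘ d_h = 0`, and the spectral sequence of the double complex `C^{p,q} = h^p Ω^{q-p}(M)` with
differentials `d` and `-h δ` (filtered by `p`, so that `d_0 = d`) degenerates at its first page. -/
def SpectralSequenceDegenerates (w : Bivector A) : Prop :=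
  ∃ hD : ∀ x, ((dh w).restrictScalars ℝ) ((dh w).restrictScalars ℝ x) = 0,
    DegeneratesAtE1 (doubleComplex A) hD

/-- The exterior product and the quantum exterior product induce products on de Rham cohomology and on
Laurent quantum de Rham cohomology, and the latter is a Laurent deformation of the former. -/
def IsDeformation (w : Bivector A) : Prop :=
  ∃ (mH : DeRhamCohomology A →ₗ[ℝ] DeRhamCohomology A →ₗ[ℝ] DeRhamCohomology A)
    (mQ : QuantumDeRhamCohomology w →ₗ[ℝ[T;T⁻¹]] QuantumDeRhamCohomology w →ₗ[ℝ[T;T⁻¹]] QuantumDeRhamCohomology w),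
    IsInducedProduct exteriorD wedgeReal mH ∧ IsInducedProduct (dh w) (quantumWedge w) mQ ∧
    IsLaurentDeformation (cohomologyPiece exteriorD (formDegree A)) mH
      (cohomologyPiece (dh w) (laurentDegree (formDegree A))) mQ

/-- Every closed `α ∈ Ω^k(M)` extends to a `d_h`-closed `α_h = α + ∑_{j ≥ 1} h^j α_j` of degree `k`. -/
def ClosedFormsExtend (w : Bivector A) : Prop :=
  ∀ (k : ℕ) (α : Form A k), extDerivForm α = 0 →
    ∃ αh : Laurent (Forms A), dh w αh = 0 ∧ αh ∈ laurentDegree (formDegree A) k ∧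
      αh - 1 ⊗ₜ ofForm α ∈ filtration (doubleComplex A) 1 k

end QDR
end

open scoped Manifold ContDiff
open QDR

noncomputable section
namespace QDR
open LaurentPolynomial
open scoped TensorProduct

/-! ### Forms by components, and extensionality through contractions -/

section

variable {A : Type*} [CommRing A] [Algebra ℝ A]

/-! The theorem holds because `d_h` is conjugate to `d`. Put `U = exp (-h w ⊢)` on `Ω(M)[h, h⁻¹]`.
Contraction with `w` lowers the degree by two and forms of large degree vanish, so `w ⊢` is
nilpotent and `U` is an automorphism, polynomial in `h`. Since `h` has degree two, `U` preserves the
total degree; it is the identity up to terms that raise the filtration by powers of `h`.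

By definition `[w ⊢, d] = δ`. If also `[w ⊢, δ] = 0`, the series for `U d U⁻¹` stops after its
linear term, and `U d U⁻¹ = d - h δ` (`quantization_laurentD`). The commutator `[w ⊢, [w ⊢, d]]` is
`C^∞(M)`-linear, anticommutes with contractions and lowers the degree by three, so it is determined
by its values on the forms `df ∧ dg ∧ dh`, which up to sign are twice the Jacobiator of `f, g, h`
(`schouten_eq_zero`). The symplectic case reduces to the Poisson one, because closedness of `σ` says
that Hamiltonian fields satisfy `[H_f, H_g] = H_{f,g}` (`isPoisson_of_isInverse`).

For the product, `w ⊢` is a second order operator: with `m` the exterior product, `w ⊢ m = m (w ⊢ ⊗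
1 + 1 ⊗ w ⊢ - L_w)`. The three operators on the right commute, so exponentiating shows that `U`
carries `m` to `m ∘ exp (h L_w)`, which is the quantum product (`quantization_laurentWedge`).

Everything is then transported along `U`. If `d_h x` lies `r ≥ 1` filtration steps above `x`, the
leading coefficient of `U⁻¹ x` is closed and its contribution can be dropped from `x` without
changing `d_h x`; hence `d_r = 0` (`degeneratesAtE1_of_conj`). The cohomology is `H[h, h⁻¹]`, with
every `f_j` equal to zero for this isomorphism (`exists_isLaurentDeformation_of_conj`), and a closed
`α` extends to `U α`.

The manifold enters only through a finite dual frame: functions `fᵢ` and fields `Xᵢ` with `Y = ∑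
Y(fᵢ) Xᵢ` for every field `Y` (`exists_isDualFrame`). It bounds the degrees of forms and shows that
differentials generate them. The Cartan calculus itself is algebraic, by induction on the degree
through `forms_ext`. -/

lemma leftContraction_ofForm_zero (X : VectorField A) (α : Form A 0) :
    leftContraction X (ofForm α) = 0 := by
  simp [leftContraction, ofForm]

lemma leftContraction_ofForm_succ {k : ℕ} (X : VectorField A) (α : Form A (k + 1)) :
    leftContraction X (ofForm α) = ofForm (α.curryLeft X) := by
  simp [leftContraction, ofForm]

lemma rightContraction_ofForm_zero (X : VectorField A) (α : Form A 0) :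
    rightContraction X (ofForm α) = 0 := by
  simp [rightContraction, ofForm]

lemma rightContraction_ofForm_succ {k : ℕ} (X : VectorField A) (α : Form A (k + 1)) :
    rightContraction X (ofForm α) = (-1 : A) ^ k • ofForm (α.curryLeft X) := by
  simp [rightContraction, ofForm]

lemma wedge_ofForm {k l : ℕ} (α : Form A k) (β : Form A l) :
    wedge (ofForm α) (ofForm β) = ofForm (wedgeForm (A := A) k l α β) := by
  simp [wedge, ofForm]

lemma exteriorD_ofForm {k : ℕ} (α : Form A k) : exteriorD (ofForm α) = ofForm (extDerivForm α) := by
  have h : (ofForm α : Forms A) = DirectSum.lof ℝ ℕ (fun k => Form A k) k α := rfl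
  rw [h, exteriorD, DirectSum.toModule_lof]
  rfl

/-- `ofForm` as a linear map. -/
def ofFormₗ (k : ℕ) : Form A k →ₗ[A] Forms A := DirectSum.lof A ℕ (fun k => Form A k) k

@[simp] lemma ofForm_add {k : ℕ} (α β : Form A k) : ofForm (α + β) = ofForm α + ofForm β :=
  map_add (ofFormₗ k) α β

@[simp] lemma ofForm_sub {k : ℕ} (α β : Form A k) : ofForm (α - β) = ofForm α - ofForm β :=
  map_sub (ofFormₗ k) α β

@[simp] lemma ofForm_zero {k : ℕ} : ofForm (0 : Form A k) = 0 :=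
  map_zero (ofFormₗ k)

@[simp] lemma ofForm_smul {k : ℕ} (f : A) (α : Form A k) : ofForm (f • α) = f • ofForm α :=
  map_smul (ofFormₗ k) f α

lemma forms_induction {P : Forms A → Prop} (x : Forms A) (h0 : P 0)
    (hof : ∀ (k : ℕ) (α : Form A k), P (ofForm α)) (hadd : ∀ x y, P x → P y → P (x + y)) : P x :=
  DirectSum.induction_on x h0 hof hadd

lemma ofForm_cast {k l : ℕ} (h : k = l) (α : Form A k) :
    ofForm (α.domDomCongr (finCongr h)) = ofForm α := by
  subst h; rfl

/-- The value of the degree-zero component. -/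
def constPart : Forms A →ₗ[A] A where
  toFun x := x 0 ![]
  map_add' _ _ := rfl
  map_smul' _ _ := rfl

lemma constPart_apply (x : Forms A) : constPart x = x 0 ![] := rfl

lemma constPart_ofForm_zero (α : Form A 0) : constPart (ofForm α) = α ![] := by
  rw [constPart_apply, ofForm, DirectSum.lof_eq_of, DirectSum.of_eq_same]

lemma constPart_ofForm_succ {k : ℕ} (α : Form A (k + 1)) : constPart (ofForm α) = 0 := by
  rw [constPart_apply, ofForm, DirectSum.lof_eq_of, DirectSum.of_eq_of_ne _ _ _ (by omega)]
  rfl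

lemma leftContraction_component (X : VectorField A) (x : Forms A) (k : ℕ) :
    (leftContraction X x) k = (x (k + 1)).curryLeft X := by
  induction x using forms_induction with
  | h0 => simp
  | hof l α =>
    cases l with
    | zero =>
      rw [leftContraction_ofForm_zero, ofForm, DirectSum.lof_eq_of,
        DirectSum.of_eq_of_ne _ _ _ (by omega)]
      rfl
    | succ l =>
      rw [leftContraction_ofForm_succ, ofForm, ofForm, DirectSum.lof_eq_of, DirectSum.lof_eq_of]
      by_cases h : k = l
      · subst h; simp
      · rw [DirectSum.of_eq_of_ne _ _ _ h, DirectSum.of_eq_of_ne _ _ _ (by omega)]; rfl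
  | hadd x y hx hy => rw [map_add, DirectSum.add_apply, hx, hy, DirectSum.add_apply]; rfl

/-- In positive degree a form is recovered by feeding it its first argument. Contractions do not see
degree zero, whence the separate condition on `constPart`. Most identities between operators on
forms below rest on this criterion. -/
lemma forms_ext {x y : Forms A} (h0 : constPart x = constPart y)
    (h : ∀ X, leftContraction X x = leftContraction X y) : x = y := by
  refine DFinsupp.ext fun k => ?_
  cases k with
  | zero =>
    ext v
    rw [Subsingleton.elim v ![]]
    exact h0
  | succ k =>
    ext v
    have := congrArg (fun z : Forms A => z k (Fin.tail v)) (h (v 0))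
    simp only [leftContraction_component, AlternatingMap.curryLeft_apply_apply] at this
    rw [Matrix.vecCons, Fin.cons_self_tail] at this
    exact this

end

/-! ### The shuffle product evaluated on vector fields -/

section

variable {A : Type*} [CommRing A] [Algebra ℝ A]

lemma wedgeForm_apply_domCoprod {k l : ℕ} (α : Form A k) (β : Form A l)
    (v : Fin (k + l) → VectorField A) :
    wedgeForm (A := A) k l α β v =
      LinearMap.mul' A A (α.domCoprod β (v ∘ finSumFinEquiv)) := rfl

/-- Each shuffle class consists of `k! l!` permutations with the same signed value, so clearing this
factor turns the sum over classes into one over all permutations, where reindexing is easy. The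
factor is cancelled again over the reals. -/
lemma factorial_smul_wedgeForm_apply {k l : ℕ} (α : Form A k) (β : Form A l)
    (v : Fin (k + l) → VectorField A) :
    (k.factorial * l.factorial) • wedgeForm (A := A) k l α β v =
      ∑ σ : Equiv.Perm (Fin (k + l)), Equiv.Perm.sign σ •
        (α (fun i => v (σ (Fin.castAdd l i))) * β (fun j => v (σ (Fin.natAdd k j)))) := by
  have h := congrArg (fun f => LinearMap.mul' A A (f (v ∘ finSumFinEquiv)))
    (MultilinearMap.domCoprod_alternization_eq α β)
  simp only [AlternatingMap.smul_apply, map_nsmul, Fintype.card_fin] at h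
  rw [wedgeForm_apply_domCoprod, ← h, MultilinearMap.alternatization_apply, map_sum,
    ← Equiv.sum_comp (Equiv.permCongr (finSumFinEquiv (m := k) (n := l)))]
  refine Finset.sum_congr rfl fun σ _ => ?_
  rcases Int.units_eq_one_or (Equiv.Perm.sign σ) with h | h <;>
    simp [Equiv.permCongr_apply, h, MultilinearMap.domCoprod_apply]

lemma nsmul_cancel {V : Type*} [AddCommGroup V] [Module ℝ V] {n : ℕ} (hn : n ≠ 0) {x y : V}
    (h : n • x = n • y) : x = y := by
  have : (n : ℝ) • x = (n : ℝ) • y := by simpa [Nat.cast_smul_eq_nsmul] using h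
  exact (smul_right_injective V (Nat.cast_ne_zero.2 hn : (n : ℝ) ≠ 0)) this

/-- Sums over the permutations of `Fin (n + 1)`, split by the preimage of `0`. -/
lemma sum_perm_fin_succ {n : ℕ} {N : Type*} [AddCommGroup N] {V : Type*}
    (F : (Fin (n + 1) → V) → N) (x : V) (u : Fin n → V) :
    ∑ σ : Equiv.Perm (Fin (n + 1)), Equiv.Perm.sign σ • F (fun i => Matrix.vecCons x u (σ i)) =
      ∑ p : Fin (n + 1), (-1 : ℤ) ^ (p : ℕ) • ∑ τ : Equiv.Perm (Fin n),
        Equiv.Perm.sign τ • F (p.insertNth x (fun i => u (τ i))) := by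
  -- A permutation with `σ p = 0` is the cycle that brings `p` to `0`, of sign `(-1)^p`, followed by
  -- a permutation fixing `0`.
  let e : Fin (n + 1) × Equiv.Perm (Fin n) → Equiv.Perm (Fin (n + 1)) := fun q =>
    Equiv.Perm.decomposeFin.symm (0, q.2) * q.1.cycleRange
  have hinj : Function.Injective e := by
    rintro ⟨p, τ⟩ ⟨p', τ'⟩ h
    have hz : ∀ τ : Equiv.Perm (Fin n), Equiv.Perm.decomposeFin.symm (0, τ) 0 = 0 := by
      intro τ; simp
    have hp : p = p' := by
      have h1 : e (p, τ) p = 0 := by simp [e]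
      have h2 : e (p', τ') p = 0 := by rw [← h, h1]
      have h3 : e (p', τ') p' = 0 := by simp [e]
      exact (e (p', τ')).injective (h2.trans h3.symm)
    subst hp
    have := mul_right_cancel h
    simpa using this
  have hbij : Function.Bijective e := by
    rw [Fintype.bijective_iff_injective_and_card]
    refine ⟨hinj, ?_⟩
    simp [Fintype.card_perm, Nat.factorial_succ]
  rw [← hbij.sum_comp, Fintype.sum_prod_type]
  refine Finset.sum_congr rfl fun p _ => ?_
  rw [Finset.smul_sum]
  refine Finset.sum_congr rfl fun τ _ => ?_
  have h1 : (fun i => Matrix.vecCons x u (e (p, τ) i)) = p.insertNth x (fun i => u (τ i)) := by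
    rw [← Fin.cons_comp_cycleRange]
    funext i
    simp only [e, Equiv.Perm.mul_apply, Function.comp]
    generalize p.cycleRange i = j
    refine Fin.cases ?_ (fun j => ?_) j <;> simp
  rw [h1]
  have h2 : Equiv.Perm.sign (e (p, τ)) = Equiv.Perm.sign τ * (-1) ^ (p : ℕ) := by simp [e]
  rw [h2]
  rcases Int.units_eq_one_or (Equiv.Perm.sign τ) with h | h <;>
    rcases neg_one_pow_eq_or ℤ (p : ℕ) with h' | h' <;>
    simp [h, h', Units.smul_def]

lemma wedgeForm_zero_right {k : ℕ} (α : Form A k) (β : Form A 0) :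
    wedgeForm (A := A) k 0 α β = β ![] • α := by
  ext v
  refine nsmul_cancel (n := k.factorial) k.factorial_ne_zero ?_
  have h := factorial_smul_wedgeForm_apply α β v
  rw [Nat.factorial_zero, mul_one] at h
  rw [h]
  -- The sign from permuting the arguments of `α` cancels the sign of `σ`, so all `k!` summands
  -- agree.
  have h1 : ∀ σ : Equiv.Perm (Fin (k + 0)), Equiv.Perm.sign σ •
        (α (fun i => v (σ (Fin.castAdd 0 i))) * β (fun j => v (σ (Fin.natAdd k j)))) =
      (β ![] • α) v := by
    intro σ
    have h2 : (fun j => v (σ (Fin.natAdd k j))) = ![] := Subsingleton.elim _ _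
    have h3 : α (fun i => v (σ (Fin.castAdd 0 i))) = Equiv.Perm.sign σ • α v :=
      α.map_perm v σ
    rw [h2, h3]
    rcases Int.units_eq_one_or (Equiv.Perm.sign σ) with h | h <;> simp [h, mul_comm]
  rw [Finset.sum_congr rfl fun σ _ => h1 σ]
  simp [Fintype.card_perm]

lemma wedgeForm_zero_left {l : ℕ} (α : Form A 0) (β : Form A l) (v : Fin (0 + l) → VectorField A) :
    wedgeForm (A := A) 0 l α β v = α ![] * β (fun i => v (Fin.natAdd 0 i)) := by
  refine nsmul_cancel (n := l.factorial) l.factorial_ne_zero ?_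
  have h := factorial_smul_wedgeForm_apply α β v
  rw [Nat.factorial_zero, one_mul] at h
  rw [h]
  let e := (finCongr (zero_add l)).symm
  have h1 : ∀ σ : Equiv.Perm (Fin (0 + l)), Equiv.Perm.sign σ •
        (α (fun i => v (σ (Fin.castAdd l i))) * β (fun j => v (σ (Fin.natAdd 0 j)))) =
      α ![] * β (fun i => v (Fin.natAdd 0 i)) := by
    intro σ
    have h2 : (fun j => v (σ (Fin.castAdd l j))) = ![] := Subsingleton.elim _ _
    have h3 : β (fun i => v (σ (Fin.natAdd 0 i))) =
        Equiv.Perm.sign σ • β (fun i => v (Fin.natAdd 0 i)) := by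
      have := β.map_perm (fun i => v (e i)) (e.symm.permCongr σ)
      rw [Equiv.Perm.sign_permCongr] at this
      have hn : ∀ i, Fin.natAdd 0 i = e i := fun i => by ext; simp [e]
      simp only [hn]
      rw [← this]
      congr 1
    rw [h2, h3]
    rcases Int.units_eq_one_or (Equiv.Perm.sign σ) with h | h <;> simp [h]
  rw [Finset.sum_congr rfl fun σ _ => h1 σ]
  simp [Fintype.card_perm]

/-- This and the next three lemmas treat a tuple split into blocks of lengths `k + 1` and `l + 1`,
with `x` inserted in one of them: the block containing `x` is again an insertion, the other consists
of entries of `w`. -/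
lemma insertNth_castAdd_castAdd {V : Type*} {k l : ℕ} (p : Fin (k + 1)) (x : V)
    (w : Fin (k + 1 + l) → V) (i : Fin (k + 1)) :
    Fin.insertNth (n := k + 1 + l) (α := fun _ => V) (Fin.castAdd (l + 1) p) x w
        (Fin.castAdd (l + 1) i) =
      Fin.insertNth (α := fun _ => V) p x
        (fun i => w (Fin.cast (by omega) (Fin.castAdd (l + 1) i))) i := by
  rcases Fin.eq_self_or_eq_succAbove p i with rfl | ⟨j, rfl⟩
  · exact (Fin.insertNth_apply_same (α := fun _ => V) (Fin.castAdd (l + 1) i) x w).trans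
      (Fin.insertNth_apply_same (α := fun _ => V) i x _).symm
  · rw [Fin.insertNth_apply_succAbove]
    have : Fin.castAdd (l + 1) (p.succAbove j) =
        Fin.succAbove (n := k + 1 + l) (Fin.castAdd (l + 1) p)
          (Fin.cast (by omega) (Fin.castAdd (l + 1) j)) := by
      ext; simp only [Fin.succAbove, Fin.lt_def]; split_ifs <;> simp_all <;> omega
    rw [this]
    exact Fin.insertNth_apply_succAbove (α := fun _ => V) _ x w _

lemma insertNth_castAdd_natAdd {V : Type*} {k l : ℕ} (p : Fin (k + 1)) (x : V)
    (w : Fin (k + 1 + l) → V) (i : Fin (l + 1)) :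
    Fin.insertNth (n := k + 1 + l) (α := fun _ => V) (Fin.castAdd (l + 1) p) x w
        (Fin.natAdd (m := l + 1) (k + 1) i) = w (Fin.cast (by omega) (Fin.natAdd k i)) := by
  have : Fin.natAdd (k + 1) i =
      Fin.succAbove (n := k + 1 + l) (Fin.castAdd (l + 1) p)
        (Fin.cast (by omega) (Fin.natAdd k i)) := by
    have := p.2
    ext; simp only [Fin.succAbove, Fin.lt_def]; split_ifs <;> simp_all <;> omega
  rw [this]
  exact Fin.insertNth_apply_succAbove (α := fun _ => V) _ x w _

lemma insertNth_natAdd_castAdd {V : Type*} {k l : ℕ} (p : Fin (l + 1)) (x : V)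
    (w : Fin (k + 1 + l) → V) (i : Fin (k + 1)) :
    Fin.insertNth (n := k + 1 + l) (α := fun _ => V) (Fin.natAdd (m := l + 1) (k + 1) p) x w
        (Fin.castAdd (l + 1) i) = w (Fin.castAdd l i) := by
  have : Fin.castAdd (l + 1) i =
      Fin.succAbove (n := k + 1 + l) (Fin.natAdd (k + 1) p) (Fin.castAdd l i) := by
    have := i.2
    ext; simp only [Fin.succAbove, Fin.lt_def]; split_ifs <;> simp_all <;> omega
  rw [this]
  exact Fin.insertNth_apply_succAbove (α := fun _ => V) _ x w _

lemma insertNth_natAdd_natAdd {V : Type*} {k l : ℕ} (p : Fin (l + 1)) (x : V)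
    (w : Fin (k + 1 + l) → V) (i : Fin (l + 1)) :
    Fin.insertNth (n := k + 1 + l) (α := fun _ => V) (Fin.natAdd (m := l + 1) (k + 1) p) x w
        (Fin.natAdd (m := l + 1) (k + 1) i) =
      Fin.insertNth (α := fun _ => V) p x (fun i => w (Fin.natAdd (k + 1) i)) i := by
  rcases Fin.eq_self_or_eq_succAbove p i with rfl | ⟨j, rfl⟩
  · exact (Fin.insertNth_apply_same (n := k + 1 + l) (α := fun _ => V)
      (Fin.natAdd (m := l + 1) (k + 1) i) x w).trans
      (Fin.insertNth_apply_same (α := fun _ => V) i x _).symm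
  · rw [Fin.insertNth_apply_succAbove]
    have : Fin.natAdd (k + 1) (p.succAbove j) =
        Fin.succAbove (n := k + 1 + l) (Fin.natAdd (k + 1) p) (Fin.natAdd (k + 1) j) := by
      ext; simp only [Fin.succAbove, Fin.lt_def]; split_ifs <;> simp_all <;> omega
    rw [this]
    exact Fin.insertNth_apply_succAbove (α := fun _ => V) _ x w _

/-- Permutations are split by the slot that receives `X`. In slot `p` of `α`, moving `X` to the
front costs `(-1)^p`, which cancels the sign of the insertion; the `k + 1` equal contributions turn
`k!` into `(k + 1)!`. In slot `p` of `β` the insertion has sign `(-1)^(k + 1 + p)`, and `(-1)^(k +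
1)` survives. -/
lemma wedgeForm_succ_succ_vecCons {k l : ℕ} (α : Form A (k + 1)) (β : Form A (l + 1))
    (X : VectorField A) (u : Fin (k + 1 + l) → VectorField A) :
    wedgeForm (A := A) (k + 1) (l + 1) α β (Matrix.vecCons X u) =
      wedgeForm (A := A) k (l + 1) (α.curryLeft X) β (u ∘ finCongr (by omega)) +
      (-1 : ℤ) ^ (k + 1) • wedgeForm (A := A) (k + 1) l α (β.curryLeft X) u := by
  refine nsmul_cancel (n := (k + 1).factorial * (l + 1).factorial)
    (Nat.mul_ne_zero (Nat.factorial_ne_zero _) (Nat.factorial_ne_zero _)) ?_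
  have hk : k + (l + 1) = k + 1 + l := by omega
  have hl := factorial_smul_wedgeForm_apply (α.curryLeft X) β (u ∘ finCongr hk)
  have hr := factorial_smul_wedgeForm_apply α (β.curryLeft X) u
  rw [factorial_smul_wedgeForm_apply]
  refine (sum_perm_fin_succ (n := k + 1 + l) (fun w => α (fun i => w (Fin.castAdd (l + 1) i)) *
    β (fun j => w (Fin.natAdd (k + 1) j))) X u).trans ?_
  refine (Fin.sum_univ_add (a := k + 1) (b := l + 1) _).trans ?_
  simp only [insertNth_castAdd_castAdd, insertNth_castAdd_natAdd, insertNth_natAdd_castAdd,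
    insertNth_natAdd_natAdd]
  have hα : ∀ (p : Fin (k + 1)) (w : Fin k → VectorField A),
      α (fun i => Fin.insertNth (α := fun _ => VectorField A) p X w i) =
        (-1) ^ (p : ℕ) • α.curryLeft X w := fun p w => α.map_insertNth p X w
  have hβ : ∀ (p : Fin (l + 1)) (w : Fin l → VectorField A),
      β (fun i => Fin.insertNth (α := fun _ => VectorField A) p X w i) =
        (-1) ^ (p : ℕ) • β.curryLeft X w := fun p w => β.map_insertNth p X w
  simp only [hα, hβ]
  have hsq : ∀ n : ℕ, (-1 : ℤ) ^ n * (-1) ^ n = 1 := fun n => by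
    rw [← mul_pow]; simp
  rw [smul_add]
  congr 1
  · rw [Nat.factorial_succ, mul_assoc, mul_smul, hl,
      ← Equiv.sum_comp (Equiv.permCongr (finCongr hk.symm))]
    have : ∀ p : Fin (k + 1), (-1 : ℤ) ^ (Fin.castAdd (l + 1) p : ℕ) •
        ∑ τ : Equiv.Perm (Fin (k + 1 + l)), Equiv.Perm.sign τ •
          ((-1 : ℤ) ^ (p : ℕ) • (α.curryLeft X)
              (fun i => u (τ (Fin.cast hk (Fin.castAdd (l + 1) i)))) *
            β fun i => u (τ (Fin.cast hk (Fin.natAdd k i)))) =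
        ∑ τ : Equiv.Perm (Fin (k + 1 + l)), Equiv.Perm.sign τ •
          ((α.curryLeft X) (fun i => u (τ (Fin.cast hk (Fin.castAdd (l + 1) i)))) *
            β fun i => u (τ (Fin.cast hk (Fin.natAdd k i)))) := by
      intro p
      rw [Finset.smul_sum]
      refine Finset.sum_congr rfl fun τ _ => ?_
      rw [smul_mul_assoc, smul_comm, smul_smul, Fin.val_castAdd, hsq, one_smul]
    rw [Finset.sum_congr rfl fun p _ => this p, Finset.sum_const, Finset.card_univ,
      Fintype.card_fin]
    congr 1
    refine Finset.sum_congr rfl fun τ _ => ?_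
    rw [Equiv.Perm.sign_permCongr]
    rfl
  · have hf : (k + 1).factorial * (l + 1).factorial =
        (l + 1) * ((k + 1).factorial * l.factorial) := by rw [Nat.factorial_succ l]; ring
    rw [smul_comm, hf, mul_smul, hr]
    have : ∀ p : Fin (l + 1), (-1 : ℤ) ^ (Fin.natAdd (k + 1) p : ℕ) •
        ∑ τ : Equiv.Perm (Fin (k + 1 + l)), Equiv.Perm.sign τ •
          (α (fun i => u (τ (Fin.castAdd l i))) *
            (-1 : ℤ) ^ (p : ℕ) • (β.curryLeft X) fun i => u (τ (Fin.natAdd (k + 1) i))) =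
        (-1 : ℤ) ^ (k + 1) • ∑ τ : Equiv.Perm (Fin (k + 1 + l)), Equiv.Perm.sign τ •
          (α (fun i => u (τ (Fin.castAdd l i))) *
            (β.curryLeft X) fun i => u (τ (Fin.natAdd (k + 1) i))) := by
      intro p
      rw [Finset.smul_sum, Finset.smul_sum]
      refine Finset.sum_congr rfl fun τ _ => ?_
      rw [mul_smul_comm, smul_comm, smul_smul, Fin.val_natAdd, pow_add, mul_assoc, hsq, mul_one,
        smul_comm]
    rw [Finset.sum_congr rfl fun p _ => this p, Finset.sum_const, Finset.card_univ,
      Fintype.card_fin, smul_comm]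

end

/-! ### The exterior algebra: antiderivations and associativity -/

section

variable {A : Type*} [CommRing A] [Algebra ℝ A]

/-- The grading involution, `(-1)^k` on `Ω^k(M)`. -/
def gradeInvolution : Module.End A (Forms A) :=
  DirectSum.toModule A ℕ (Forms A) fun k => (-1 : A) ^ k • ofFormₗ k

lemma gradeInvolution_ofForm {k : ℕ} (α : Form A k) :
    gradeInvolution (ofForm α) = (-1 : A) ^ k • ofForm α := by
  simp [gradeInvolution, ofForm, ofFormₗ]

@[simp] lemma gradeInvolution_gradeInvolution (a : Forms A) :
    gradeInvolution (gradeInvolution a) = a := by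
  induction a using forms_induction with
  | h0 => simp
  | hof k α =>
    rw [gradeInvolution_ofForm, map_smul, gradeInvolution_ofForm, smul_smul, ← mul_pow]
    simp
  | hadd x y hx hy => rw [map_add, map_add, hx, hy]

lemma leftContraction_gradeInvolution (X : VectorField A) (a : Forms A) :
    leftContraction X (gradeInvolution a) = -gradeInvolution (leftContraction X a) := by
  induction a using forms_induction with
  | h0 => simp
  | hof k α =>
    rw [gradeInvolution_ofForm, map_smul]
    cases k with
    | zero => simp [leftContraction_ofForm_zero]
    | succ k => rw [leftContraction_ofForm_succ, gradeInvolution_ofForm, pow_succ]; simp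
  | hadd x y hx hy => rw [map_add, map_add, hx, hy, map_add, map_add, neg_add]

lemma rightContraction_eq (X : VectorField A) (a : Forms A) :
    rightContraction X a = gradeInvolution (leftContraction X a) := by
  induction a using forms_induction with
  | h0 => simp
  | hof k α =>
    cases k with
    | zero => simp [leftContraction_ofForm_zero, rightContraction_ofForm_zero]
    | succ k => rw [leftContraction_ofForm_succ, gradeInvolution_ofForm, rightContraction_ofForm_succ]
  | hadd x y hx hy => rw [map_add, map_add, hx, hy, map_add]

lemma exteriorD_gradeInvolution (a : Forms A) :
    exteriorD (gradeInvolution a) = -gradeInvolution (exteriorD a) := by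
  induction a using forms_induction with
  | h0 => simp
  | hof k α =>
    rw [gradeInvolution_ofForm, exteriorD_ofForm, gradeInvolution_ofForm]
    rcases neg_one_pow_eq_or A k with h | h <;> simp [h, exteriorD_ofForm, pow_succ]
  | hadd x y hx hy => rw [map_add, map_add, hx, hy, map_add, map_add, neg_add]

@[simp] lemma constPart_gradeInvolution (a : Forms A) :
    constPart (gradeInvolution a) = constPart a := by
  induction a using forms_induction with
  | h0 => simp
  | hof k α =>
    rw [gradeInvolution_ofForm]
    cases k with
    | zero => simp
    | succ k => simp [constPart_ofForm_succ]
  | hadd x y hx hy => rw [map_add, map_add, hx, hy, map_add]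

@[simp] lemma constPart_exteriorD (a : Forms A) : constPart (exteriorD a) = 0 := by
  induction a using forms_induction with
  | h0 => simp
  | hof k α => rw [exteriorD_ofForm, constPart_ofForm_succ]
  | hadd x y hx hy => rw [map_add, map_add, hx, hy, add_zero]

lemma wedge_ofForm_zero_left (α : Form A 0) (b : Forms A) : wedge (ofForm α) b = α ![] • b := by
  induction b using forms_induction with
  | h0 => simp
  | hof k β =>
    rw [wedge_ofForm, ← ofForm_smul, ← ofForm_cast (zero_add k).symm (α ![] • β)]
    congr 1
    ext v
    rw [wedgeForm_zero_left]
    simp only [AlternatingMap.domDomCongr_apply, AlternatingMap.smul_apply, smul_eq_mul]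
    congr 2
    funext i
    simp only [Function.comp_apply]
    congr 1
    ext; simp
  | hadd x y hx hy => rw [map_add, hx, hy, smul_add]

lemma wedge_ofForm_zero_right (a : Forms A) (β : Form A 0) : wedge a (ofForm β) = β ![] • a := by
  induction a using forms_induction with
  | h0 => simp
  | hof k α => rw [wedge_ofForm, ← ofForm_smul, wedgeForm_zero_right]
  | hadd x y hx hy => rw [map_add, LinearMap.add_apply, hx, hy, smul_add]

/-- The contractions are antiderivations of the exterior product. -/
lemma leftContraction_wedge (X : VectorField A) (a b : Forms A) :
    leftContraction X (wedge a b) =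
      wedge (leftContraction X a) b + wedge (gradeInvolution a) (leftContraction X b) := by
  induction a using forms_induction with
  | h0 => simp
  | hadd x y hx hy => simp only [map_add, LinearMap.add_apply, hx, hy]; abel
  | hof k α =>
    induction b using forms_induction with
    | h0 => simp
    | hadd x y hx hy => simp only [map_add, hx, hy]; abel
    | hof l β =>
      cases k with
      | zero =>
        rw [wedge_ofForm_zero_left, map_smul, leftContraction_ofForm_zero, gradeInvolution_ofForm,
          pow_zero, one_smul, wedge_ofForm_zero_left]
        simp
      | succ k =>
        cases l with
        | zero => rw [wedge_ofForm_zero_right, map_smul, leftContraction_ofForm_zero,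
            wedge_ofForm_zero_right]; simp
        | succ l =>
          rw [wedge_ofForm, leftContraction_ofForm_succ, leftContraction_ofForm_succ,
            leftContraction_ofForm_succ, gradeInvolution_ofForm, map_smul, LinearMap.smul_apply,
            wedge_ofForm, wedge_ofForm, ← ofForm_cast (by omega : k + (l + 1) = k + 1 + l),
            ← ofForm_smul]
          refine Eq.trans ?_ (ofForm_add (k := k + 1 + l) _ _)
          congr 1
          ext u
          refine (wedgeForm_succ_succ_vecCons α β X u).trans ?_
          rw [AlternatingMap.add_apply, AlternatingMap.smul_apply, zsmul_eq_mul, smul_eq_mul]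
          push_cast
          rfl

lemma constPart_wedge (a b : Forms A) : constPart (wedge a b) = constPart a * constPart b := by
  induction a using forms_induction with
  | h0 => simp
  | hadd x y hx hy => simp only [map_add, LinearMap.add_apply, hx, hy, add_mul]
  | hof k α =>
    induction b using forms_induction with
    | h0 => simp
    | hadd x y hx hy => simp only [map_add, hx, hy, mul_add]
    | hof l β =>
      cases k with
      | zero => rw [wedge_ofForm_zero_left, map_smul, constPart_ofForm_zero, smul_eq_mul]
      | succ k =>
        cases l with
        | zero => rw [wedge_ofForm_zero_right, map_smul, constPart_ofForm_succ]; simp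
        | succ l =>
          rw [wedge_ofForm, constPart_ofForm_succ, constPart_ofForm_succ, zero_mul]

lemma gradeInvolution_wedge (a b : Forms A) :
    gradeInvolution (wedge a b) = wedge (gradeInvolution a) (gradeInvolution b) := by
  induction a using forms_induction with
  | h0 => simp
  | hadd x y hx hy => simp only [map_add, LinearMap.add_apply, hx, hy]
  | hof k α =>
    induction b using forms_induction with
    | h0 => simp
    | hadd x y hx hy => simp only [map_add, hx, hy]
    | hof l β =>
      simp only [wedge_ofForm, gradeInvolution_ofForm, map_smul, LinearMap.smul_apply, smul_smul,
        pow_add]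
      rw [mul_comm]

/-- Induction on the degree. The defect `E` of a Cartan identity typically commutes or anticommutes
with contractions, which makes its vanishing on `X ⊢ a` pass to `X ⊢ E a`; in degree zero the
contraction of `a` itself is zero. -/
lemma eq_zero_of_leftContraction (E : Forms A → Forms A) (hE0 : E 0 = 0)
    (hadd : ∀ a b, E (a + b) = E a + E b) (h0 : ∀ a, constPart (E a) = 0)
    (h : ∀ X a, E (leftContraction X a) = 0 → leftContraction X (E a) = 0) (a : Forms A) :
    E a = 0 := by
  induction a using forms_induction with
  | h0 => exact hE0
  | hadd x y hx hy => rw [hadd, hx, hy, add_zero]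
  | hof k α =>
    induction k with
    | zero =>
      refine forms_ext (by simp [h0]) fun X => ?_
      rw [map_zero, h]
      rw [leftContraction_ofForm_zero, hE0]
    | succ k ih =>
      refine forms_ext (by simp [h0]) fun X => ?_
      rw [map_zero, h]
      rw [leftContraction_ofForm_succ, ih]

/-- The induction is on the total degree, since contracting a product lowers one factor at a time.
The grading involution in the second case is the sign acquired by `X ⊢` on passing the first factor.
-/
lemma eq_zero_of_leftContraction₂ (E : Forms A → Forms A → Forms A)
    (hl0 : ∀ b, E 0 b = 0) (hr0 : ∀ a, E a 0 = 0)
    (hl : ∀ a a' b, E (a + a') b = E a b + E a' b) (hr : ∀ a b b', E a (b + b') = E a b + E a b')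
    (h0 : ∀ a b, constPart (E a b) = 0)
    (h : ∀ X a b, E (leftContraction X a) b = 0 → E (gradeInvolution a) (leftContraction X b) = 0 →
      leftContraction X (E a b) = 0) (a b : Forms A) : E a b = 0 := by
  have key : ∀ n k l : ℕ, k + l = n → ∀ (α : Form A k) (β : Form A l),
      E (ofForm α) (ofForm β) = 0 := by
    intro n
    induction n with
    | zero =>
      intro k l hkl α β
      obtain ⟨rfl, rfl⟩ : k = 0 ∧ l = 0 := by omega
      refine forms_ext (by simp [h0]) fun X => ?_
      rw [map_zero, h] <;> simp [leftContraction_ofForm_zero, hl0, hr0]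
    | succ n ih =>
      intro k l hkl α β
      refine forms_ext (by simp [h0]) fun X => ?_
      rw [map_zero, h]
      · cases k with
        | zero => rw [leftContraction_ofForm_zero, hl0]
        | succ k => rw [leftContraction_ofForm_succ, ih k l (by omega)]
      · cases l with
        | zero => rw [leftContraction_ofForm_zero, hr0]
        | succ l =>
          rw [leftContraction_ofForm_succ, gradeInvolution_ofForm, ← ofForm_smul,
            ih k l (by omega)]
  induction a using forms_induction with
  | h0 => exact hl0 b
  | hadd x y hx hy => rw [hl, hx, hy, add_zero]
  | hof k α =>
    induction b using forms_induction with
    | h0 => exact hr0 _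
    | hadd x y hx hy => rw [hr, hx, hy, add_zero]
    | hof l β => exact key _ k l rfl α β

/-- Contraction with `X` distributes both sides into the same three kinds of terms, one for each
contracted factor; each has total degree smaller by one. -/
theorem wedge_assoc (a b c : Forms A) : wedge (wedge a b) c = wedge a (wedge b c) := by
  have key : ∀ n k l m : ℕ, k + l + m = n → ∀ (α : Form A k) (β : Form A l) (γ : Form A m),
      wedge (wedge (ofForm α) (ofForm β)) (ofForm γ) =
        wedge (ofForm α) (wedge (ofForm β) (ofForm γ)) := by
    intro n
    induction n with
    | zero =>
      intro k l m hn α β γ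
      obtain ⟨rfl, rfl, rfl⟩ : k = 0 ∧ l = 0 ∧ m = 0 := by omega
      simp only [wedge_ofForm_zero_left, map_smul, LinearMap.smul_apply]
      exact smul_comm _ _ _
    | succ n ih =>
      intro k l m hn α β γ
      refine forms_ext (by simp [constPart_wedge, mul_assoc]) fun X => ?_
      simp only [leftContraction_wedge, gradeInvolution_wedge, map_add, LinearMap.add_apply]
      rw [add_assoc]
      congr 1
      · cases k with
        | zero => simp [leftContraction_ofForm_zero]
        | succ k => rw [leftContraction_ofForm_succ, ih k l m (by omega)]
      congr 1
      · cases l with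
        | zero => simp [leftContraction_ofForm_zero]
        | succ l =>
          rw [leftContraction_ofForm_succ, gradeInvolution_ofForm, ← ofForm_smul,
            ih k l m (by omega)]
      · cases m with
        | zero => simp [leftContraction_ofForm_zero]
        | succ m =>
          rw [leftContraction_ofForm_succ, gradeInvolution_ofForm, gradeInvolution_ofForm,
            ← ofForm_smul, ← ofForm_smul, ih k l m (by omega)]
  induction a using forms_induction with
  | h0 => simp
  | hadd x y hx hy => simp only [map_add, LinearMap.add_apply, hx, hy]
  | hof k α =>
    induction b using forms_induction with
    | h0 => simp
    | hadd x y hx hy => simp only [map_add, LinearMap.add_apply, hx, hy]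
    | hof l β =>
      induction c using forms_induction with
      | h0 => simp
      | hadd x y hx hy => simp only [map_add, hx, hy]
      | hof m γ => exact key _ k l m rfl α β γ

/-- The function `f` as a form of degree zero. -/
def ofFunction (f : A) : Forms A := ofForm (AlternatingMap.constOfIsEmpty A (VectorField A) (Fin 0) f)

@[simp] lemma wedge_ofFunction_left (f : A) (b : Forms A) : wedge (ofFunction f) b = f • b :=
  wedge_ofForm_zero_left _ b

@[simp] lemma wedge_ofFunction_right (f : A) (a : Forms A) : wedge a (ofFunction f) = f • a :=
  wedge_ofForm_zero_right a _

@[simp] lemma constPart_ofFunction (f : A) : constPart (ofFunction f) = f :=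
  constPart_ofForm_zero _

@[simp] lemma leftContraction_ofFunction (X : VectorField A) (f : A) :
    leftContraction X (ofFunction f) = 0 := leftContraction_ofForm_zero _ _

lemma ofForm_eq_ofFunction (α : Form A 0) : ofForm α = ofFunction (α ![]) := by
  refine forms_ext ?_ fun X => ?_
  · rw [constPart_ofForm_zero, constPart_ofFunction]
  · rw [leftContraction_ofForm_zero, leftContraction_ofFunction]

end

/-! ### Cartan calculus -/

section

variable {A : Type*} [CommRing A] [Algebra ℝ A]

/-- The contraction with a vector field, as a real linear map. -/
def contraction (X : VectorField A) : Module.End ℝ (Forms A) :=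
  (leftContraction X).restrictScalars ℝ

/-- The Lie derivative, by Cartan's formula. -/
def lieD (X : VectorField A) : Module.End ℝ (Forms A) :=
  exteriorD ∘ₗ contraction X + contraction X ∘ₗ exteriorD

lemma lieD_apply (X : VectorField A) (a : Forms A) :
    lieD X a = exteriorD (leftContraction X a) + leftContraction X (exteriorD a) := rfl

lemma leftContraction_exteriorD (X : VectorField A) (a : Forms A) :
    leftContraction X (exteriorD a) = lieD X a - exteriorD (leftContraction X a) := by
  rw [lieD_apply]; abel

/-- Cartan's formula for the Lie derivative. The terms in which neither the derivation nor the
bracket involves `X` cancel between the two differentials. Each `[X, vⱼ]` occurs twice in Koszul's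
formula, from `X` and from `vⱼ`, with weight `½` each time, which gives the coefficient one. -/
lemma extDerivForm_curryLeft_add {k : ℕ} (X : VectorField A) (α : Form A (k + 1))
    (v : Fin (k + 1) → VectorField A) :
    extDerivForm (α.curryLeft X) v + extDerivForm α (Matrix.vecCons X v) =
      X (α v) - ∑ j, α (Function.update v j ⁅X, v j⁆) := by
  have hr : ∀ i : Fin (k + 1), i.succ.removeNth (Matrix.vecCons X v) =
      Matrix.vecCons X (i.removeNth v) := by
    intro i; funext j; refine Fin.cases ?_ (fun j => ?_) j <;> simp [Fin.removeNth]
  have h0 : ∀ z z' : VectorField A, ∀ w : Fin k → VectorField A,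
      Function.update (Matrix.vecCons z w) 0 z' = Matrix.vecCons z' w := by
    intro z z' w; exact Fin.update_cons_zero _ _ _
  have h1 : ∀ z z' : VectorField A, ∀ w : Fin k → VectorField A, ∀ j : Fin k,
      Function.update (Matrix.vecCons z w) j.succ z' =
        Matrix.vecCons z (Function.update w j z') := by
    intro z z' w j; exact (Fin.cons_update _ _ _ _).symm
  have hmove : ∀ (j : Fin (k + 1)) (x : VectorField A), α (Function.update v j x) =
      (-1 : ℤ) ^ (j : ℕ) • α (Matrix.vecCons x (j.removeNth v)) := by
    intro j x
    rw [← Fin.insertNth_removeNth, AlternatingMap.map_insertNth]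
  have hneg : ∀ (j : Fin (k + 1)), α (Matrix.vecCons ⁅v j, X⁆ (j.removeNth v)) =
      - α (Matrix.vecCons ⁅X, v j⁆ (j.removeNth v)) := by
    intro j
    rw [← lie_skew, ← neg_one_smul A ⁅X, v j⁆, AlternatingMap.map_vecCons_smul, neg_one_smul]
  rw [extDerivForm_apply, extDerivForm_apply, Fin.sum_univ_succ (n := k + 1)]
  have ht : Fin.removeNth 0 (Matrix.vecCons X v) = v := by
    rw [Fin.removeNth_zero]; rfl
  simp only [hr, Fin.sum_univ_succ (n := k), h0, h1, Matrix.cons_val_zero,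
        Matrix.cons_val_succ, AlternatingMap.curryLeft_apply_apply, Fin.val_zero, pow_zero,
        one_smul, ht, Fin.val_succ, pow_succ, mul_neg, mul_one, neg_smul, hneg]
  simp only [← Fin.sum_univ_succ (n := k) (fun j => α (Function.update v j ⁅X, v j⁆))]
  simp only [hmove, smul_sub, smul_add, smul_neg, Finset.sum_add_distrib, Finset.sum_neg_distrib,
    Finset.sum_sub_distrib, neg_sub, Finset.smul_sum, smul_comm (2⁻¹ : ℝ) ((-1 : ℤ) ^ _)]
  have hP : ∑ x : Fin (k + 1), (-1 : ℤ) ^ (x : ℕ) • (2⁻¹ : ℝ) •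
        α (Matrix.vecCons ⁅X, v x⁆ (x.removeNth v)) =
      (2⁻¹ : ℝ) • α (Matrix.vecCons ⁅X, v 0⁆ (Fin.removeNth 0 v)) -
        ∑ x : Fin k, (-1 : ℤ) ^ (x : ℕ) • (2⁻¹ : ℝ) •
          α (Matrix.vecCons ⁅X, v x.succ⁆ (x.succ.removeNth v)) := by
    rw [Fin.sum_univ_succ]
    simp only [Fin.val_zero, pow_zero, one_smul, Fin.val_succ, pow_succ, mul_neg, mul_one, neg_smul,
      Finset.sum_neg_distrib]
    abel
  have h2 : ∑ x : Fin (k + 1), (-1 : ℤ) ^ (x : ℕ) • α (Matrix.vecCons ⁅X, v x⁆ (x.removeNth v)) =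
      ∑ x : Fin (k + 1), (-1 : ℤ) ^ (x : ℕ) • (2⁻¹ : ℝ) •
          α (Matrix.vecCons ⁅X, v x⁆ (x.removeNth v)) +
        ∑ x : Fin (k + 1), (-1 : ℤ) ^ (x : ℕ) • (2⁻¹ : ℝ) •
          α (Matrix.vecCons ⁅X, v x⁆ (x.removeNth v)) := by
    rw [← Finset.sum_add_distrib]
    refine Finset.sum_congr rfl fun x _ => ?_
    rw [← smul_add, ← add_smul]
    norm_num
  rw [h2]
  linear_combination (norm := abel) hP

lemma lieD_ofForm_zero (X : VectorField A) (α : Form A 0) :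
    lieD X (ofForm α) = ofFunction (X (α ![])) := by
  rw [lieD_apply, leftContraction_ofForm_zero, map_zero, zero_add, exteriorD_ofForm,
    leftContraction_ofForm_succ, ofForm_eq_ofFunction]
  congr 1
  rw [AlternatingMap.curryLeft_apply_apply, extDerivForm_apply]
  simp

lemma lieD_ofForm_succ {k : ℕ} (X : VectorField A) (α : Form A (k + 1)) :
    lieD X (ofForm α) =
      ofForm (extDerivForm (α.curryLeft X) + (extDerivForm α).curryLeft X) := by
  rw [lieD_apply, leftContraction_ofForm_succ, exteriorD_ofForm, exteriorD_ofForm,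
    leftContraction_ofForm_succ, ofForm_add]

lemma lieD_ofForm_add {k : ℕ} (X : VectorField A) (α : Form A k) :
    ∃ β : Form A k, lieD X (ofForm α) = ofForm β ∧
      ∀ v, β v = X (α v) - ∑ j, α (Function.update v j ⁅X, v j⁆) := by
  cases k with
  | zero =>
    refine ⟨_, lieD_ofForm_zero X α, fun v => ?_⟩
    rw [Subsingleton.elim v ![]]
    simp
  | succ k => exact ⟨_, lieD_ofForm_succ X α, fun v => extDerivForm_curryLeft_add X α v⟩

@[simp] lemma constPart_lieD (X : VectorField A) (a : Forms A) :
    constPart (lieD X a) = X (constPart a) := by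
  induction a using forms_induction with
  | h0 => simp
  | hadd x y hx hy => rw [map_add, map_add, hx, hy, map_add, map_add]
  | hof k α =>
    cases k with
    | zero => rw [lieD_ofForm_zero, constPart_ofFunction, constPart_ofForm_zero]
    | succ k => rw [lieD_ofForm_succ, constPart_ofForm_succ, constPart_ofForm_succ, map_zero]

/-- In the explicit formula for the Lie derivative evaluated at `(Y, v)`, the summand that replaces
`Y` by `[X, Y]` is the last term; the others form the Lie derivative of `Y ⊢ a`. -/
lemma leftContraction_lieD (X Y : VectorField A) (a : Forms A) :
    leftContraction Y (lieD X a) =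
      lieD X (leftContraction Y a) - leftContraction ⁅X, Y⁆ a := by
  induction a using forms_induction with
  | h0 => simp
  | hadd x y hx hy => simp only [map_add, hx, hy]; abel
  | hof k α =>
    cases k with
    | zero => rw [lieD_ofForm_zero]; simp [leftContraction_ofForm_zero]
    | succ k =>
      obtain ⟨β, hβ, hβ'⟩ := lieD_ofForm_add X α
      obtain ⟨γ, hγ, hγ'⟩ := lieD_ofForm_add X (α.curryLeft Y)
      rw [hβ, leftContraction_ofForm_succ, leftContraction_ofForm_succ, hγ,
        leftContraction_ofForm_succ, ← ofForm_sub]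
      congr 1
      ext v
      rw [AlternatingMap.curryLeft_apply_apply, hβ', AlternatingMap.sub_apply, hγ',
        Fin.sum_univ_succ]
      have h0 : ∀ z z' : VectorField A, ∀ w : Fin k → VectorField A,
          Function.update (Matrix.vecCons z w) 0 z' = Matrix.vecCons z' w := by
        intro z z' w; exact Fin.update_cons_zero _ _ _
      have h1 : ∀ z z' : VectorField A, ∀ w : Fin k → VectorField A, ∀ j : Fin k,
          Function.update (Matrix.vecCons z w) j.succ z' =
            Matrix.vecCons z (Function.update w j z') := by
        intro z z' w j; exact (Fin.cons_update _ _ _ _).symm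
      simp only [h0, h1, Matrix.cons_val_zero, Matrix.cons_val_succ,
        AlternatingMap.curryLeft_apply_apply]
      abel

lemma lieD_gradeInvolution (X : VectorField A) (a : Forms A) :
    lieD X (gradeInvolution a) = gradeInvolution (lieD X a) := by
  simp [lieD_apply, leftContraction_gradeInvolution, exteriorD_gradeInvolution]

/-- After contraction with `Z`, the extra terms cancel by the Jacobi identity for `X, Y, Z`, leaving
the same defect on `Z ⊢ a`. -/
lemma lieD_bracket (X Y : VectorField A) (a : Forms A) :
    lieD ⁅X, Y⁆ a = lieD X (lieD Y a) - lieD Y (lieD X a) := by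
  refine sub_eq_zero.1 (eq_zero_of_leftContraction
    (fun a => lieD ⁅X, Y⁆ a - (lieD X (lieD Y a) - lieD Y (lieD X a))) (by simp)
    (fun a b => by simp only [map_add]; abel) (fun a => ?_) (fun Z a h => ?_) a)
  · simp [Derivation.commutator_apply]
  · simp only [map_sub, leftContraction_lieD]
    have := leibniz_lie X Y Z
    have h2 : leftContraction ⁅⁅X, Y⁆, Z⁆ a =
        leftContraction ⁅X, ⁅Y, Z⁆⁆ a - leftContraction ⁅Y, ⁅X, Z⁆⁆ a := by
      rw [← LinearMap.sub_apply, ← map_sub, lie_lie]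
    rw [h2]
    linear_combination (norm := abel) h

/-- Since `d² = 0` is not yet available, the commutation is not read off from Cartan's formula:
contraction with `Y` produces `L_X L_Y - L_Y L_X - L_[X,Y] = 0` and minus the defect on `Y ⊢ a`. -/
lemma lieD_exteriorD (X : VectorField A) (a : Forms A) :
    lieD X (exteriorD a) = exteriorD (lieD X a) := by
  refine sub_eq_zero.1 (eq_zero_of_leftContraction
    (fun a => lieD X (exteriorD a) - exteriorD (lieD X a)) (by simp)
    (fun a b => by simp only [map_add]; abel) (fun a => by simp) (fun Y a h => ?_) a)
  simp only [map_sub, leftContraction_lieD, leftContraction_exteriorD, lieD_bracket] at h ⊢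
  linear_combination (norm := abel) -h

/-- By Cartan's formula `X ⊢ d d a = (L_X d - d L_X) a + d d (X ⊢ a)`, and the bracket vanishes, so
the induction on the degree closes. -/
theorem exteriorD_exteriorD (a : Forms A) : exteriorD (exteriorD a) = 0 := by
  refine eq_zero_of_leftContraction (fun a => exteriorD (exteriorD a)) (by simp)
    (fun a b => by simp only [map_add]) (fun a => by simp) (fun X a h => ?_) a
  simp only [map_sub, leftContraction_exteriorD, lieD_exteriorD] at h ⊢
  rw [h]; abel

lemma lieD_wedge (X : VectorField A) (a b : Forms A) :
    lieD X (wedge a b) = wedge (lieD X a) b + wedge a (lieD X b) := by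
  refine sub_eq_zero.1 (eq_zero_of_leftContraction₂
    (fun a b => lieD X (wedge a b) - (wedge (lieD X a) b + wedge a (lieD X b))) (by simp) (by simp)
    (fun a a' b => by simp only [map_add, LinearMap.add_apply]; abel)
    (fun a b b' => by simp only [map_add]; abel)
    (fun a b => ?_) (fun Y a b h h' => ?_) a b)
  · simp [constPart_wedge]; ring
  · simp only [map_sub, map_add, leftContraction_lieD, leftContraction_wedge, LinearMap.sub_apply,
      lieD_gradeInvolution] at h h' ⊢
    linear_combination (norm := abel) h + h'

/-- The graded Leibniz rule. -/
theorem exteriorD_wedge (a b : Forms A) :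
    exteriorD (wedge a b) = wedge (exteriorD a) b + wedge (gradeInvolution a) (exteriorD b) := by
  refine sub_eq_zero.1 (eq_zero_of_leftContraction₂
    (fun a b => exteriorD (wedge a b) -
      (wedge (exteriorD a) b + wedge (gradeInvolution a) (exteriorD b))) (by simp) (by simp)
    (fun a a' b => by simp only [map_add, LinearMap.add_apply]; abel)
    (fun a b b' => by simp only [map_add]; abel)
    (fun a b => ?_) (fun Y a b h h' => ?_) a b)
  · simp [constPart_wedge]
  · simp only [map_sub, map_add, leftContraction_wedge, LinearMap.sub_apply,
      leftContraction_exteriorD, lieD_wedge, leftContraction_gradeInvolution, map_neg,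
      exteriorD_gradeInvolution, LinearMap.neg_apply,
      gradeInvolution_gradeInvolution] at h h' ⊢
    linear_combination (norm := abel) -h - h'

end

/-! ### Degrees, contraction with a bivector field, Hamiltonian fields -/

section

variable {A : Type*} [CommRing A] [Algebra ℝ A]

lemma ofForm_mem_formDegree {k : ℕ} (α : Form A k) : ofForm α ∈ formDegree A k :=
  Submodule.mem_iSup_of_mem k (Submodule.mem_iSup_of_mem rfl ⟨α, rfl⟩)

lemma eq_ofForm_of_mem_formDegree {n : ℤ} {a : Forms A} (h : a ∈ formDegree A n) :
    a = 0 ∨ ∃ (k : ℕ) (α : Form A k), (k : ℤ) = n ∧ a = ofForm α := by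
  rcases lt_or_ge n 0 with hn | hn
  · left
    have : formDegree A n ≤ ⊥ := iSup₂_le fun m hm => by omega
    exact this h
  · right
    lift n to ℕ using hn
    have : formDegree A (n : ℤ) ≤ LinearMap.range (DirectSum.lof ℝ ℕ (fun k => Form A k) n) :=
      iSup₂_le fun m hm => by
        obtain rfl : m = n := by exact_mod_cast hm
        exact le_rfl
    obtain ⟨α, rfl⟩ := this h
    exact ⟨n, α, rfl, rfl⟩

lemma eq_zero_of_mem_formDegree_neg {n : ℤ} {a : Forms A} (h : a ∈ formDegree A n) (hn : n < 0) :
    a = 0 := by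
  rcases eq_ofForm_of_mem_formDegree h with h | ⟨k, α, hk, -⟩
  · exact h
  · omega

lemma constPart_eq_zero_of_mem_formDegree {n : ℤ} {a : Forms A} (h : a ∈ formDegree A n)
    (hn : n ≠ 0) : constPart a = 0 := by
  rcases eq_ofForm_of_mem_formDegree h with rfl | ⟨k, α, hk, rfl⟩
  · simp
  · cases k with
    | zero => simp at hk; omega
    | succ k => exact constPart_ofForm_succ α

lemma exteriorD_mem_formDegree {n : ℤ} {a : Forms A} (h : a ∈ formDegree A n) :
    exteriorD a ∈ formDegree A (n + 1) := by
  rcases eq_ofForm_of_mem_formDegree h with rfl | ⟨k, α, rfl, rfl⟩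
  · simp
  · rw [exteriorD_ofForm]; exact ofForm_mem_formDegree _

lemma leftContraction_mem_formDegree (X : VectorField A) {n : ℤ} {a : Forms A}
    (h : a ∈ formDegree A n) : leftContraction X a ∈ formDegree A (n - 1) := by
  rcases eq_ofForm_of_mem_formDegree h with rfl | ⟨k, α, rfl, rfl⟩
  · simp
  · cases k with
    | zero => rw [leftContraction_ofForm_zero]; exact zero_mem _
    | succ k =>
      rw [leftContraction_ofForm_succ]
      convert ofForm_mem_formDegree _ using 2
      push_cast; ring

lemma wedge_mem_formDegree {m n : ℤ} {a b : Forms A} (ha : a ∈ formDegree A m)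
    (hb : b ∈ formDegree A n) : wedge a b ∈ formDegree A (m + n) := by
  rcases eq_ofForm_of_mem_formDegree ha with rfl | ⟨k, α, rfl, rfl⟩
  · simp
  rcases eq_ofForm_of_mem_formDegree hb with rfl | ⟨l, β, rfl, rfl⟩
  · simp
  rw [wedge_ofForm]
  exact_mod_cast ofForm_mem_formDegree _

lemma ofFunction_mem_formDegree (f : A) : ofFunction f ∈ formDegree A 0 :=
  ofForm_mem_formDegree (k := 0) _

/-- The differential of a function. -/
def differential (f : A) : Forms A := exteriorD (ofFunction f)

lemma leftContraction_differential (X : VectorField A) (f : A) :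
    leftContraction X (differential f) = ofFunction (X f) := by
  rw [differential, leftContraction_exteriorD, leftContraction_ofFunction, map_zero, sub_zero,
    ofFunction, lieD_ofForm_zero]
  rfl

lemma gradeInvolution_differential (f : A) : gradeInvolution (differential f) = -differential f := by
  rw [differential, ofFunction, exteriorD_ofForm, gradeInvolution_ofForm]; simp

lemma gradeInvolution_ofFunction (f : A) : gradeInvolution (ofFunction f) = ofFunction f := by
  rw [ofFunction, gradeInvolution_ofForm]; simp

lemma exteriorD_smul (f : A) (a : Forms A) :
    exteriorD (f • a) = wedge (differential f) a + f • exteriorD a := by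
  rw [← wedge_ofFunction_left, exteriorD_wedge, gradeInvolution_ofFunction, wedge_ofFunction_left]
  rfl

lemma leftContraction_self (X : VectorField A) (a : Forms A) :
    leftContraction X (leftContraction X a) = 0 := by
  induction a using forms_induction with
  | h0 => simp
  | hadd x y hx hy => simp only [map_add, hx, hy, add_zero]
  | hof k α =>
    match k with
    | 0 => simp [leftContraction_ofForm_zero]
    | 1 => simp [leftContraction_ofForm_zero, leftContraction_ofForm_succ]
    | k + 2 =>
      rw [leftContraction_ofForm_succ, leftContraction_ofForm_succ, AlternatingMap.curryLeft_same,
        ofForm_zero]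

lemma leftContraction_anticomm (X Y : VectorField A) (a : Forms A) :
    leftContraction X (leftContraction Y a) = -leftContraction Y (leftContraction X a) := by
  have h := leftContraction_self (X + Y) a
  simp only [map_add, LinearMap.add_apply, leftContraction_self, zero_add, add_zero] at h
  rw [eq_neg_iff_add_eq_zero, add_comm]; exact h

/-- The operator `∑ i_X i_Y` for `t = ∑ X ⊗ Y`. -/
def doubleContraction : VectorField A ⊗[A] VectorField A →ₗ[A] Module.End A (Forms A) :=
  TensorProduct.lift
    ((LinearMap.mul A (Module.End A (Forms A))).compl₁₂ leftContraction leftContraction)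

lemma doubleContraction_tmul (X Y : VectorField A) (a : Forms A) :
    doubleContraction (X ⊗ₜ Y) a = leftContraction X (leftContraction Y a) := rfl

lemma contract_eq (w : Bivector A) :
    contract w = algebraMap ℝ A 2⁻¹ • doubleContraction w.1 := rfl

lemma contract_apply (w : Bivector A) (a : Forms A) :
    contract w a = (2⁻¹ : ℝ) • doubleContraction w.1 a := by
  rw [contract_eq, LinearMap.smul_apply, algebraMap_smul]

lemma doubleContraction_leftContraction (t : VectorField A ⊗[A] VectorField A)
    (X : VectorField A) (a : Forms A) :
    doubleContraction t (leftContraction X a) = leftContraction X (doubleContraction t a) := by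
  induction t using TensorProduct.induction_on with
  | zero => simp
  | add s t hs ht => simp only [map_add, LinearMap.add_apply, hs, ht]
  | tmul Y Z =>
    simp only [doubleContraction_tmul]
    rw [leftContraction_anticomm Z X, map_neg, leftContraction_anticomm Y X, neg_neg]

lemma contract_leftContraction (w : Bivector A) (X : VectorField A) (a : Forms A) :
    contract w (leftContraction X a) = leftContraction X (contract w a) := by
  rw [contract_eq, LinearMap.smul_apply, LinearMap.smul_apply, doubleContraction_leftContraction,
    map_smul]

lemma contract_real_smul (w : Bivector A) (c : ℝ) (a : Forms A) :
    contract w (c • a) = c • contract w a :=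
  LinearMap.map_smul_of_tower _ _ _

lemma contract_mem_formDegree (w : Bivector A) {n : ℤ} {a : Forms A} (h : a ∈ formDegree A n) :
    contract w a ∈ formDegree A (n - 2) := by
  rw [contract_apply]
  refine Submodule.smul_mem _ _ ?_
  induction w.1 using TensorProduct.induction_on with
  | zero => simp
  | add s t hs ht => rw [map_add]; exact add_mem hs ht
  | tmul Y Z =>
    rw [doubleContraction_tmul, show n - 2 = n - 1 - 1 by ring]
    exact leftContraction_mem_formDegree _ (leftContraction_mem_formDegree _ h)

lemma contract_pow_mem_formDegree (w : Bivector A) {n : ℤ} {a : Forms A} (h : a ∈ formDegree A n)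
    (j : ℕ) : (contract w ^ j) a ∈ formDegree A (n - 2 * j) := by
  induction j with
  | zero => simpa using h
  | succ j ih =>
    rw [pow_succ', Module.End.mul_apply]
    convert contract_mem_formDegree w ih using 2
    push_cast; ring

/-- The operator `∑ (· ⊣ X) ⊗ (Y ⊢ ·)` for `t = ∑ X ⊗ Y`. -/
def crossContraction : VectorField A ⊗[A] VectorField A →ₗ[A] Module.End A (Forms A ⊗[A] Forms A) :=
  TensorProduct.lift
    ((TensorProduct.mapBilinear (RingHom.id A) (Forms A) (Forms A) (Forms A) (Forms A)).compl₁₂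
      rightContraction leftContraction)

lemma crossContraction_tmul (X Y : VectorField A) (a b : Forms A) :
    crossContraction (X ⊗ₜ Y) (a ⊗ₜ b) =
      gradeInvolution (leftContraction X a) ⊗ₜ leftContraction Y b := by
  rw [← rightContraction_eq]; rfl

lemma contractBoth_eq (w : Bivector A) : contractBoth w = crossContraction w.1 := rfl

/-- Of the four terms of `X ⊢ Y ⊢ (a ∧ b)`, the two mixed ones contract one field into each factor.
Their signs differ because `X ⊢` anticommutes with the grading involution. For a skew tensor they
add up to twice the cross contraction, and the factor `½` in `w ⊢` leaves one copy. -/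
lemma doubleContraction_wedge (t : VectorField A ⊗[A] VectorField A) (a b : Forms A) :
    doubleContraction t (wedge a b) =
      wedge (doubleContraction t a) b + wedge a (doubleContraction t b) +
      TensorProduct.lift wedge (crossContraction (TensorProduct.comm A _ _ t) (a ⊗ₜ b)) -
      TensorProduct.lift wedge (crossContraction t (a ⊗ₜ b)) := by
  induction t using TensorProduct.induction_on with
  | zero => simp
  | add s t hs ht => simp only [map_add, LinearMap.add_apply, hs, ht]; abel
  | tmul X Y =>
    rw [TensorProduct.comm_tmul]
    simp only [doubleContraction_tmul, crossContraction_tmul, TensorProduct.lift.tmul,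
      leftContraction_wedge, map_add, leftContraction_gradeInvolution,
      map_neg, LinearMap.neg_apply, gradeInvolution_gradeInvolution]
    abel

/-- The contraction with a bivector field is a derivation of the exterior product up to the
contraction of both factors. -/
lemma contract_wedge (w : Bivector A) (a b : Forms A) :
    contract w (wedge a b) = wedge (contract w a) b + wedge a (contract w b) -
      TensorProduct.lift wedge (contractBoth w (a ⊗ₜ b)) := by
  have h2 : algebraMap ℝ A 2⁻¹ * 2 = 1 := by
    rw [← map_ofNat (algebraMap ℝ A) 2, ← map_mul]; norm_num
  have h : (1 : A) • TensorProduct.lift wedge (contractBoth w (a ⊗ₜ b)) =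
      TensorProduct.lift wedge (contractBoth w (a ⊗ₜ b)) := one_smul _ _
  rw [← h, ← h2, contract_eq, LinearMap.smul_apply, doubleContraction_wedge, w.2]
  simp only [map_neg, LinearMap.neg_apply, LinearMap.smul_apply, map_smul, contractBoth_eq, mul_smul,
    two_smul]
  simp only [smul_add, smul_sub, smul_neg]
  abel

/-- The Hamiltonian vector field of `f`, `g ↦ {f, g}`. -/
def hamiltonian (w : Bivector A) (f : A) : VectorField A :=
  TensorProduct.lift (LinearMap.lsmul A (VectorField A) ∘ₗ evalAt f) w.1

lemma hamiltonian_apply (w : Bivector A) (f g : A) :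
    hamiltonian w f g = poissonBracket w f g := by
  rw [hamiltonian, poissonBracket]
  induction w.1 using TensorProduct.induction_on with
  | zero => simp
  | add s t hs ht => rw [map_add, map_add, Derivation.add_apply, hs, ht]
  | tmul X Y => rfl

lemma poissonBracket_skew (w : Bivector A) (f g : A) :
    poissonBracket w g f = -poissonBracket w f g := by
  have : ∀ t : VectorField A ⊗[A] VectorField A,
      TensorProduct.lift ((LinearMap.mul A A).compl₁₂ (evalAt g) (evalAt f)) t =
      TensorProduct.lift ((LinearMap.mul A A).compl₁₂ (evalAt f) (evalAt g))
        (TensorProduct.comm A _ _ t) := by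
    intro t
    induction t using TensorProduct.induction_on with
    | zero => simp
    | add s t hs ht => rw [map_add, map_add, map_add, hs, ht]
    | tmul X Y => simp [evalAt, mul_comm]
  rw [poissonBracket, this, w.2, map_neg]; rfl

lemma contract_differential (w : Bivector A) (f : A) : contract w (differential f) = 0 :=
  eq_zero_of_mem_formDegree_neg (contract_mem_formDegree w
    (exteriorD_mem_formDegree (ofFunction_mem_formDegree f))) (by norm_num)

/-- `w ⊢ df` vanishes for reasons of degree, so only the mixed term remains; there the first leg of
`w` is evaluated on `f`, and the second leg becomes the Hamiltonian field. Thus `[w ⊢, df ∧] = -X_f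
⊢`. -/
lemma contract_differential_wedge (w : Bivector A) (f : A) (a : Forms A) :
    contract w (wedge (differential f) a) =
      wedge (differential f) (contract w a) - leftContraction (hamiltonian w f) a := by
  rw [contract_wedge, contract_differential, map_zero, LinearMap.zero_apply, zero_add]
  congr 1
  rw [contractBoth_eq, hamiltonian]
  induction w.1 using TensorProduct.induction_on with
  | zero => simp
  | add s t hs ht => simp only [map_add, LinearMap.add_apply, hs, ht]
  | tmul X Y =>
    rw [crossContraction_tmul, TensorProduct.lift.tmul, leftContraction_differential,
      gradeInvolution_ofFunction, wedge_ofFunction_left, TensorProduct.lift.tmul]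
    change X f • leftContraction Y a = leftContraction (X f • Y) a
    rw [map_smul, LinearMap.smul_apply]

end

/-! ### The Koszul codifferential of a Poisson bivector field, and nilpotence -/

section

variable {A : Type*} [CommRing A] [Algebra ℝ A]

/-- `X ↦ ∑ X (fᵢ) Xᵢ` is the identity: the `Xᵢ` generate the vector fields, with dual one-forms
`dfᵢ`. -/
def IsDualFrame {ι : Type*} [Fintype ι] (f : ι → A) (X : ι → VectorField A) : Prop :=
  ∀ Y : VectorField A, ∑ i, Y (f i) • X i = Y

lemma codiff_apply (w : Bivector A) (a : Forms A) :
    codiff w a = contract w (exteriorD a) - exteriorD (contract w a) := rfl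

/-- The commutator `[L_X, w ⊢]`. -/
def lieContract (w : Bivector A) (X : VectorField A) (a : Forms A) : Forms A :=
  lieD X (contract w a) - contract w (lieD X a)

lemma lieD_real_smul (X : VectorField A) (c : ℝ) (a : Forms A) : lieD X (c • a) = c • lieD X a :=
  map_smul _ _ _

lemma contract_comm_contract (w : Bivector A) (t : VectorField A ⊗[A] VectorField A) (a : Forms A) :
    contract w (doubleContraction t a) = doubleContraction t (contract w a) := by
  induction t using TensorProduct.induction_on with
  | zero => simp
  | add s t hs ht => simp only [map_add, LinearMap.add_apply, hs, ht]
  | tmul Y Z => simp only [doubleContraction_tmul, contract_leftContraction]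

/-- On a pure tensor, `s` is its Lie derivative `[X, Y] ⊗ Z + Y ⊗ [X, Z]`. Mere existence is enough:
all that is needed is that the commutator is again a double contraction and hence commutes with `w
⊢`. -/
lemma exists_lieD_doubleContraction (t : VectorField A ⊗[A] VectorField A) (X : VectorField A) :
    ∃ s : VectorField A ⊗[A] VectorField A, ∀ a,
      lieD X (doubleContraction t a) - doubleContraction t (lieD X a) = doubleContraction s a := by
  induction t using TensorProduct.induction_on with
  | zero => exact ⟨0, fun a => by simp⟩
  | add t t' ht ht' =>
    obtain ⟨s, hs⟩ := ht
    obtain ⟨s', hs'⟩ := ht'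
    refine ⟨s + s', fun a => ?_⟩
    simp only [map_add, LinearMap.add_apply, ← hs, ← hs']
    abel
  | tmul Y Z =>
    refine ⟨⁅X, Y⁆ ⊗ₜ Z + Y ⊗ₜ ⁅X, Z⁆, fun a => ?_⟩
    simp only [map_add, LinearMap.add_apply, doubleContraction_tmul, leftContraction_lieD, map_sub]
    abel

lemma contract_lieContract (w : Bivector A) (X : VectorField A) (a : Forms A) :
    contract w (lieContract w X a) = lieContract w X (contract w a) := by
  obtain ⟨s, hs⟩ := exists_lieD_doubleContraction w.1 X
  have h : ∀ a, lieContract w X a = (2⁻¹ : ℝ) • doubleContraction s a := by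
    intro a
    rw [← hs, lieContract, contract_apply, contract_apply, lieD_real_smul, smul_sub]
  rw [h, h, contract_real_smul, contract_comm_contract]

/-- The iterated commutator `[w ⊢, [w ⊢, d]]`. -/
def schouten (w : Bivector A) (a : Forms A) : Forms A :=
  contract w (codiff w a) - codiff w (contract w a)

lemma leftContraction_codiff (w : Bivector A) (X : VectorField A) (a : Forms A) :
    leftContraction X (codiff w a) =
      -lieContract w X a - codiff w (leftContraction X a) := by
  simp only [codiff_apply, map_sub, ← contract_leftContraction, leftContraction_exteriorD,
    lieContract]
  abel

/-- Each commutator with `w ⊢` passes through `X ⊢`, and `[w ⊢, [w ⊢, L_X]] = 0` by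
`contract_lieContract`. So the operator behaves like contraction with a trivector and is controlled
by its degree zero part. -/
lemma leftContraction_schouten (w : Bivector A) (X : VectorField A) (a : Forms A) :
    leftContraction X (schouten w a) = -schouten w (leftContraction X a) := by
  simp only [schouten, map_sub, ← contract_leftContraction, leftContraction_codiff, map_neg,
    contract_lieContract]
  abel

lemma schouten_eq (w : Bivector A) (a : Forms A) :
    schouten w a = contract w (contract w (exteriorD a)) -
      contract w (exteriorD (contract w a)) - contract w (exteriorD (contract w a)) +
      exteriorD (contract w (contract w a)) := by
  simp only [schouten, codiff_apply, map_sub]; abel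

lemma schouten_add (w : Bivector A) (a b : Forms A) :
    schouten w (a + b) = schouten w a + schouten w b := by
  simp only [schouten_eq, map_add]; abel

lemma schouten_zero (w : Bivector A) : schouten w 0 = 0 := by simp [schouten_eq]

/-- The commutator with multiplication by `f` is `[w ⊢, [w ⊢, df ∧]] = -[w ⊢, X_f ⊢] = 0`: two
contractions remove the derivative of `f`. -/
lemma schouten_smul (w : Bivector A) (f : A) (a : Forms A) :
    schouten w (f • a) = f • schouten w a := by
  simp only [schouten_eq, map_smul, exteriorD_smul, map_add, contract_differential_wedge, map_sub,
    contract_leftContraction, smul_add, smul_sub]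
  abel

lemma schouten_mem_formDegree (w : Bivector A) {n : ℤ} {a : Forms A} (h : a ∈ formDegree A n) :
    schouten w a ∈ formDegree A (n - 3) := by
  rw [schouten_eq]
  have h1 := contract_mem_formDegree w (contract_mem_formDegree w (exteriorD_mem_formDegree h))
  have h2 := contract_mem_formDegree w (exteriorD_mem_formDegree (contract_mem_formDegree w h))
  have h3 := exteriorD_mem_formDegree (contract_mem_formDegree w (contract_mem_formDegree w h))
  rw [show n + 1 - 2 - 2 = n - 3 by ring] at h1
  rw [show n - 2 + 1 - 2 = n - 3 by ring] at h2
  rw [show n - 2 - 2 + 1 = n - 3 by ring] at h3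
  exact add_mem (sub_mem (sub_mem h1 h2) h2) h3

lemma differential_mem_formDegree (f : A) : differential f ∈ formDegree A 1 := by
  have := exteriorD_mem_formDegree (ofFunction_mem_formDegree f)
  rwa [zero_add] at this

lemma exteriorD_differential_wedge (f : A) (a : Forms A) :
    exteriorD (wedge (differential f) a) = -wedge (differential f) (exteriorD a) := by
  rw [exteriorD_wedge, gradeInvolution_differential, differential, exteriorD_exteriorD]
  simp

lemma ofFunction_add (f g : A) : ofFunction (f + g) = ofFunction f + ofFunction g :=
  forms_ext (by simp) (by simp)

lemma ofFunction_neg (f : A) : ofFunction (-f) = -ofFunction f :=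
  forms_ext (by simp) (by simp)

lemma ofFunction_zero : ofFunction (0 : A) = 0 :=
  forms_ext (by simp) (by simp)

/-- The form is closed, and applying `w ⊢` twice to a three-form gives zero, so of the expanded
commutator only `-2 w ⊢ d (w ⊢ ·)` remains. It is a function, up to sign twice the Jacobiator. -/
lemma schouten_differentials {w : Bivector A} (hw : IsPoisson w) (f g h : A) :
    schouten w (wedge (differential f) (wedge (differential g) (differential h))) = 0 := by
  have hd : ∀ f : A, exteriorD (differential f) = 0 := fun f => exteriorD_exteriorD _
  have hBB : contract w (contract w
      (wedge (differential f) (wedge (differential g) (differential h)))) = 0 :=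
    eq_zero_of_mem_formDegree_neg (contract_mem_formDegree w (contract_mem_formDegree w
      (wedge_mem_formDegree (differential_mem_formDegree f) (wedge_mem_formDegree
        (differential_mem_formDegree g) (differential_mem_formDegree h))))) (by norm_num)
  rw [schouten_eq, hBB]
  have h2 : ∀ f g : A, contract w (wedge (differential f) (differential g)) =
      -ofFunction (poissonBracket w f g) := by
    intro f g
    rw [contract_differential_wedge, contract_differential, map_zero, zero_sub,
      leftContraction_differential, hamiltonian_apply]
  have h3 : contract w (wedge (differential f) (wedge (differential g) (differential h))) =
      -poissonBracket w g h • differential f - poissonBracket w f g • differential h +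
        poissonBracket w f h • differential g := by
    rw [contract_differential_wedge, h2, leftContraction_wedge, gradeInvolution_differential]
    simp only [leftContraction_differential, hamiltonian_apply, map_neg, LinearMap.neg_apply,
      wedge_ofFunction_left, wedge_ofFunction_right, neg_smul]
    abel
  simp only [exteriorD_differential_wedge, hd, map_zero, neg_zero, h3, map_add, map_sub,
    exteriorD_smul, smul_zero, add_zero, h2]
  have hJ := hw f g h
  have hneg : ∀ u v : A, poissonBracket w u (-v) = -poissonBracket w u v := fun u v => by
    rw [← hamiltonian_apply, map_neg, hamiltonian_apply]
  have e1 : poissonBracket w (-poissonBracket w g h) f =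
      poissonBracket w f (poissonBracket w g h) := by
    rw [poissonBracket_skew w f, hneg, neg_neg]
  have e2 : poissonBracket w (poissonBracket w f g) h =
      -poissonBracket w h (poissonBracket w f g) := poissonBracket_skew w _ _
  have e3 : poissonBracket w (poissonBracket w f h) g =
      poissonBracket w g (poissonBracket w h f) := by
    rw [poissonBracket_skew w g, poissonBracket_skew w h f, hneg, neg_neg]
  rw [e1, e2, e3, ofFunction_neg]
  have hS : ofFunction (poissonBracket w f (poissonBracket w g h)) +
      ofFunction (poissonBracket w g (poissonBracket w h f)) +
      ofFunction (poissonBracket w h (poissonBracket w f g)) = 0 := by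
    rw [← ofFunction_add, ← ofFunction_add, hJ, ofFunction_zero]
  linear_combination (norm := abel) hS + hS

/-- An Euler identity: the left side counts the degree. By induction, contraction with `Y` yields `∑
Y(fᵢ) Xᵢ ⊢ α`, which is `Y ⊢ α` by the frame property, together with the sum for `Y ⊢ α`. As `k` is
invertible for `k > 0`, forms are combinations of products of differentials. -/
lemma sum_differential_wedge_leftContraction {ι : Type*} [Fintype ι] {f : ι → A}
    {X : ι → VectorField A} (hX : IsDualFrame f X) {k : ℕ} (α : Form A k) :
    ∑ i, wedge (differential (f i)) (leftContraction (X i) (ofForm α)) = (k : A) • ofForm α := by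
  induction k with
  | zero => simp [leftContraction_ofForm_zero]
  | succ k ih =>
    refine forms_ext ?_ fun Y => ?_
    · rw [map_sum, map_smul, constPart_ofForm_succ, smul_zero]
      exact Finset.sum_eq_zero fun i _ => by simp [constPart_wedge, differential]
    · have hY : leftContraction Y (ofForm α) =
          ∑ i, Y (f i) • leftContraction (X i) (ofForm α) := by
        conv_lhs => rw [← hX Y]
        rw [map_sum, LinearMap.sum_apply]
        simp
      have hn := ih (α.curryLeft Y)
      rw [← leftContraction_ofForm_succ] at hn
      rw [map_sum, map_smul]
      push_cast
      rw [add_smul, ← hn, one_smul]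
      conv_rhs => rw [hY, add_comm, ← Finset.sum_add_distrib]
      refine Finset.sum_congr rfl fun i _ => ?_
      rw [leftContraction_wedge, leftContraction_differential, gradeInvolution_differential,
        wedge_ofFunction_left, leftContraction_anticomm Y, ← hY]
      simp

/-- For a Poisson bivector field, the Koszul codifferential commutes with the contraction. -/
theorem schouten_eq_zero {ι : Type*} [Fintype ι] {f : ι → A} {X : ι → VectorField A}
    (hX : IsDualFrame f X) {w : Bivector A} (hw : IsPoisson w) (a : Forms A) :
    schouten w a = 0 := by
  refine eq_zero_of_leftContraction (schouten w) (schouten_zero w) (schouten_add w) (fun a => ?_)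
    (fun Y a h => by rw [leftContraction_schouten, h, neg_zero]) a
  -- The degree zero part of the commutator can be nonzero only on three-forms; by linearity and
  -- three uses of the Euler identity these reduce to products of three differentials.
  let P : Forms A →ₗ[A] A :=
    { toFun := fun a => constPart (schouten w a)
      map_add' := fun a b => by rw [schouten_add, map_add]
      map_smul' := fun g a => by rw [schouten_smul, map_smul]; rfl }
  change P a = 0
  have hsum : ∀ (k : ℕ) (Q : Forms A →ₗ[A] A),
      (∀ (g : A) (β : Form A k), Q (wedge (differential g) (ofForm β)) = 0) →
      ∀ β : Form A (k + 1), Q (ofForm β) = 0 := by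
    intro k Q hQ β
    have h1 := congrArg Q (sum_differential_wedge_leftContraction hX β)
    rw [map_sum, Finset.sum_eq_zero (fun i _ => by rw [leftContraction_ofForm_succ, hQ]),
      map_smul, smul_eq_mul] at h1
    have h2 : (k + 1) • Q (ofForm β) = (k + 1) • 0 := by
      rw [smul_zero, nsmul_eq_mul, ← h1]
    exact nsmul_cancel (Nat.succ_ne_zero k) h2
  induction a using forms_induction with
  | h0 => simp
  | hadd x y hx hy => rw [map_add, hx, hy, add_zero]
  | hof k α =>
    by_cases hk : k = 3
    · subst hk
      refine hsum 2 P (fun f β => ?_) α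
      refine hsum 1 (P ∘ₗ wedge (differential f)) (fun g β => ?_) β
      refine hsum 0 (P ∘ₗ wedge (differential f) ∘ₗ wedge (differential g)) (fun h β => ?_) β
      change constPart (schouten w (wedge (differential f) (wedge (differential g)
        (wedge (differential h) (ofForm β))))) = 0
      rw [wedge_ofForm_zero_right, map_smul, map_smul, schouten_smul, schouten_differentials hw]
      simp
    · exact constPart_eq_zero_of_mem_formDegree
        (schouten_mem_formDegree w (ofForm_mem_formDegree α)) (by omega)

/-- Expanding every argument in the `Xᵢ` leaves values on tuples of frame fields, each with a
repetition by the pigeonhole principle. -/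
lemma form_eq_zero_of_card_lt {ι : Type*} [Fintype ι] {f : ι → A} {X : ι → VectorField A}
    (hX : IsDualFrame f X) {k : ℕ} (hk : Fintype.card ι < k) (α : Form A k) : α = 0 := by
  classical
  ext v
  have hv : v = fun j => ∑ i, v j (f i) • X i := by funext j; exact (hX (v j)).symm
  have h1 := (α : MultilinearMap A (fun _ : Fin k => VectorField A) A).map_sum
    (fun (j : Fin k) (i : ι) => v j (f i) • X i)
  rw [← hv] at h1
  refine h1.trans (Finset.sum_eq_zero fun r _ => ?_)
  obtain ⟨i, j, hij, hr⟩ := Fintype.exists_ne_map_eq_of_card_lt r (by simpa using hk)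
  rw [MultilinearMap.map_smul_univ]
  have : α (fun j => X (r j)) = 0 := α.map_eq_zero_of_eq _ (by simp [hr]) hij
  exact (congrArg _ this).trans (smul_zero _)

/-- This makes `exp (± h w ⊢)` a finite sum, so that it acts on Laurent polynomials rather than on
power series. -/
lemma isNilpotent_contract {ι : Type*} [Fintype ι] {f : ι → A} {X : ι → VectorField A}
    (hX : IsDualFrame f X) (w : Bivector A) : IsNilpotent (contract w) := by
  refine ⟨Fintype.card ι + 1, LinearMap.ext fun a => ?_⟩
  rw [LinearMap.zero_apply]
  induction a using forms_induction with
  | h0 => simp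
  | hadd x y hx hy => rw [map_add, hx, hy, add_zero]
  | hof k α =>
    by_cases hk : Fintype.card ι < k
    · rw [form_eq_zero_of_card_lt hX hk α]; simp
    · exact eq_zero_of_mem_formDegree_neg
        (contract_pow_mem_formDegree w (ofForm_mem_formDegree α) _) (by push_cast; omega)

lemma contractBoth_pow_tmul (w : Bivector A) {k : ℕ} (α : Form A k) (b : Forms A) (n : ℕ)
    (hn : k < n) : (contractBoth w ^ n) (ofForm α ⊗ₜ b) = 0 := by
  rw [contractBoth_eq]
  induction n generalizing k b with
  | zero => omega
  | succ n ih =>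
    rw [pow_succ, Module.End.mul_apply]
    -- The power is frozen so that the induction over tensors expands only the single factor applied
    -- first.
    generalize crossContraction w.1 ^ n = T at ih ⊢
    induction w.1 using TensorProduct.induction_on with
    | zero => simp
    | add s t hs ht => rw [map_add, LinearMap.add_apply, map_add, hs, ht, add_zero]
    | tmul Y Z =>
      rw [crossContraction_tmul]
      cases k with
      | zero => simp [leftContraction_ofForm_zero]
      | succ k =>
        rw [leftContraction_ofForm_succ, gradeInvolution_ofForm, ← ofForm_smul]
        exact ih _ _ (by omega)

lemma isNilpotent_contractBoth {ι : Type*} [Fintype ι] {f : ι → A} {X : ι → VectorField A}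
    (hX : IsDualFrame f X) (w : Bivector A) : IsNilpotent (contractBoth w) := by
  refine ⟨Fintype.card ι + 1, TensorProduct.ext' fun a b => ?_⟩
  rw [LinearMap.zero_apply]
  induction a using forms_induction with
  | h0 => simp
  | hadd x y hx hy => rw [TensorProduct.add_tmul, map_add, hx, hy, add_zero]
  | hof k α =>
    by_cases hk : Fintype.card ι < k
    · rw [form_eq_zero_of_card_lt hX hk α]; simp
    · exact contractBoth_pow_tmul w α b _ (by omega)

end

/-! ### Exponentials of nilpotent endomorphisms -/

section Exp

variable {S : Type*} [Ring S]

/-- Moving `d` to the left through the factors `b` leaves one bracket `c` each time; since `c`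
commutes with `b`, all these contributions coincide. -/
lemma pow_mul_eq_mul_pow_add {b d c : S} (hc : b * d - d * b = c) (hbc : Commute b c) (n : ℕ) :
    b ^ (n + 1) * d = d * b ^ (n + 1) + (n + 1) • (c * b ^ n) := by
  have hbd : b * d = d * b + c := by rw [← hc]; abel
  induction n with
  | zero => simp [hbd]
  | succ n ih =>
    rw [pow_succ' b (n + 1), mul_assoc, ih, mul_add, ← mul_assoc, hbd, mul_smul_comm, ← mul_assoc b c,
      hbc.eq, add_mul, mul_assoc, mul_assoc c b, ← pow_succ' b (n + 1), ← pow_succ' b n, add_assoc,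
      succ_nsmul' _ (n + 1)]

/-- If `[b, [b, d]] = 0`, then `exp b * d = (d + [b, d]) * exp b`. -/
lemma exp_mul_of_commute_bracket [Module ℚ S] {b d c : S} (hb : IsNilpotent b) (hc : b * d - d * b = c)
    (hbc : Commute b c) : IsNilpotent.exp b * d = (d + c) * IsNilpotent.exp b := by
  obtain ⟨N, hN⟩ := hb
  have hN' : b ^ (N + 1) = 0 := by rw [pow_succ, hN, zero_mul]
  have hl : ∀ (x : S) (q : ℚ) (y : S), x * (q • y) = q • (x * y) := fun x q y =>
    map_rat_smul (AddMonoidHom.mulLeft x) q y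
  have hr : ∀ (x : S) (q : ℚ) (y : S), (q • y) * x = q • (y * x) := fun x q y =>
    map_rat_smul (AddMonoidHom.mulRight x) q y
  rw [add_mul]
  -- The factor next to `c` is truncated one step earlier than the others, so that the term `c bⁿ /
  -- n!` pairs with the bracket of `bⁿ⁺¹ / (n + 1)!` and `d`.
  nth_rewrite 3 [IsNilpotent.exp_eq_sum hN]
  rw [IsNilpotent.exp_eq_sum hN', Finset.sum_mul, Finset.mul_sum, Finset.mul_sum,
    Finset.sum_range_succ', Finset.sum_range_succ' (n := N), add_right_comm,
    ← Finset.sum_add_distrib]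
  congr 1
  · refine Finset.sum_congr rfl fun n _ => ?_
    rw [hr, hl, hl, pow_mul_eq_mul_pow_add hc hbc, smul_add]
    congr 1
    rw [← Nat.cast_smul_eq_nsmul ℚ, smul_smul, Nat.factorial_succ]
    congr 1
    have := Nat.factorial_ne_zero n
    push_cast
    field_simp
  · simp

end Exp

section ExpMem

variable {R M : Type*} [CommRing R] [AddCommGroup M] [Module R M] [Module ℚ M] [Module ℝ M]

/-- Every term of `exp b - 1` contains at least one factor `b`. With consecutive filtration steps
for `S` and `S'` this is unipotence; with `S' = S` it is invariance. -/
lemma exp_apply_sub_mem {b : Module.End R M} (hb : IsNilpotent b) {S S' : Submodule ℝ M}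
    (hle : S' ≤ S) (hS : ∀ x ∈ S, b x ∈ S') {x : M} (hx : x ∈ S) :
    IsNilpotent.exp b x - x ∈ S' := by
  obtain ⟨N, hN⟩ := hb
  have hN' : b ^ (N + 1) = 0 := by rw [pow_succ, hN, zero_mul]
  rw [IsNilpotent.exp_eq_sum hN', Finset.sum_range_succ']
  simp only [Nat.factorial_zero, Nat.cast_one, inv_one, pow_zero, one_smul, LinearMap.add_apply,
    Module.End.one_apply, add_sub_cancel_right, LinearMap.sum_apply]
  have hpow : ∀ n, (b ^ n) x ∈ S := by
    intro n
    induction n with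
    | zero => exact hx
    | succ n ih => rw [pow_succ', Module.End.mul_apply]; exact hle (hS _ ih)
  refine Submodule.sum_mem _ fun n _ => ?_
  rw [LinearMap.smul_apply, ← Rat.cast_smul_eq_qsmul ℝ]
  refine Submodule.smul_mem _ _ ?_
  rw [pow_succ', Module.End.mul_apply]
  exact hS _ (hpow n)

lemma exp_apply_mem {b : Module.End R M} (hb : IsNilpotent b) {S : Submodule ℝ M}
    (hS : ∀ x ∈ S, b x ∈ S) {x : M} (hx : x ∈ S) : IsNilpotent.exp b x ∈ S := by
  have := S.add_mem (exp_apply_sub_mem hb le_rfl hS hx) hx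
  rwa [sub_add_cancel] at this

end ExpMem

/-! ### Extension of scalars to Laurent polynomials, and the operators `exp (h f)` -/

section LaurentEnd

variable {A : Type*} [CommRing A] [Algebra ℝ A] {V : Type*} [AddCommGroup V] [Module A V]
  [Module ℝ V] [IsScalarTower ℝ A V]

/-- The extension of an endomorphism to Laurent polynomials in `h`. -/
def laurentEnd : Module.End A V →+* Module.End ℝ[T;T⁻¹] (Laurent V) where
  toFun f := (f.restrictScalars ℝ).baseChange ℝ[T;T⁻¹]
  map_one' := by ext; simp
  map_mul' f g := by ext; simp
  map_zero' := by ext; simp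
  map_add' f g := by ext; simp

/-- `h f`, for an endomorphism `f`. -/
def hEnd (f : Module.End A V) : Module.End ℝ[T;T⁻¹] (Laurent V) := (T 1 : ℝ[T;T⁻¹]) • laurentEnd f

lemma hEnd_tmul (f : Module.End A V) (P : ℝ[T;T⁻¹]) (a : V) :
    hEnd f (P ⊗ₜ a) = (T 1 * P) ⊗ₜ f a := rfl

lemma isNilpotent_hEnd {f : Module.End A V} (hf : IsNilpotent f) : IsNilpotent (hEnd f) :=
  (hf.map laurentEnd).smul _

lemma hEnd_pow_tmul (f : Module.End A V) (n : ℕ) (P : ℝ[T;T⁻¹]) (a : V) :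
    (hEnd f ^ n) (P ⊗ₜ a) = (T n * P) ⊗ₜ (f ^ n) a := by
  induction n with
  | zero => simp
  | succ n ih =>
    rw [pow_succ', Module.End.mul_apply, ih, hEnd_tmul, pow_succ', Module.End.mul_apply, ← mul_assoc,
      ← T_add]
    push_cast
    rw [add_comm]

lemma commute_hEnd {f g : Module.End A V} (h : Commute f g) : Commute (hEnd f) (hEnd g) :=
  ((h.map laurentEnd).smul_left _).smul_right _

end LaurentEnd

section Bilinear

variable {V W Z : Type*} [AddCommGroup V] [Module ℝ V] [AddCommGroup W] [Module ℝ W]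
  [AddCommGroup Z] [Module ℝ Z]

/-- The `ℝ[h, h⁻¹]`-bilinear extension of a real bilinear map. -/
def laurentBilinear (ψ : V →ₗ[ℝ] W →ₗ[ℝ] Laurent Z) :
    Laurent V →ₗ[ℝ[T;T⁻¹]] Laurent W →ₗ[ℝ[T;T⁻¹]] Laurent Z :=
  LinearMap.liftBaseChange ℝ[T;T⁻¹]
    (((LinearMap.liftBaseChangeEquiv ℝ[T;T⁻¹]).toLinearMap.restrictScalars ℝ) ∘ₗ ψ)

lemma laurentBilinear_tmul (ψ : V →ₗ[ℝ] W →ₗ[ℝ] Laurent Z) (P Q : ℝ[T;T⁻¹]) (a : V) (b : W) :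
    laurentBilinear ψ (P ⊗ₜ a) (Q ⊗ₜ b) = (P * Q) • ψ a b := by
  simp [laurentBilinear, mul_smul]

lemma laurent_induction {P : Laurent V → Prop} (x : Laurent V)
    (htmul : ∀ (p : ℤ) (a : V), P (T p ⊗ₜ a)) (hadd : ∀ x y, P x → P y → P (x + y)) : P x := by
  induction x using TensorProduct.induction_on with
  | zero => simpa using htmul 0 0
  | add x y hx hy => exact hadd x y hx hy
  | tmul Q a =>
    induction Q using LaurentPolynomial.induction_on' with
    | add p q hp hq => rw [TensorProduct.add_tmul]; exact hadd _ _ hp hq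
    | C_mul_T n c =>
      rw [← LaurentPolynomial.smul_eq_C_mul, TensorProduct.smul_tmul]
      exact htmul _ _

end Bilinear

section

section EndExp

variable {R M : Type*} [CommRing R] [AddCommGroup M] [Module R M] [Module ℚ M]

lemma exp_neg_apply_exp {b : Module.End R M} (hb : IsNilpotent b) (x : M) :
    IsNilpotent.exp (-b) (IsNilpotent.exp b x) = x :=
  LinearMap.congr_fun (IsNilpotent.exp_neg_mul_exp_self hb) x

lemma exp_apply_exp_neg {b : Module.End R M} (hb : IsNilpotent b) (x : M) :
    IsNilpotent.exp b (IsNilpotent.exp (-b) x) = x :=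
  LinearMap.congr_fun (IsNilpotent.exp_mul_exp_neg_self hb) x

lemma exp_add_apply {b c : Module.End R M} (hb : IsNilpotent b) (hc : IsNilpotent c)
    (h : Commute b c) (x : M) :
    IsNilpotent.exp (b + c) x = IsNilpotent.exp b (IsNilpotent.exp c x) :=
  LinearMap.congr_fun (IsNilpotent.exp_add_of_commute h hb hc) x

lemma exp_apply_eq_sum {b : Module.End R M} (hb : IsNilpotent b) {k : ℕ} {x : M}
    (hx : (b ^ k) x = 0) :
    IsNilpotent.exp b x = ∑ n ∈ Finset.range k, (n.factorial : ℚ)⁻¹ • (b ^ n) x :=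
  IsNilpotent.exp_smul_eq_sum (M := M) hx hb

lemma exp_neg_apply_of_commute_bracket {b d c : Module.End R M} (hb : IsNilpotent b)
    (hc : ∀ x, b (d x) - d (b x) = c x) (hbc : ∀ x, b (c x) = c (b x)) (x : M) :
    IsNilpotent.exp (-b) (d x) = d (IsNilpotent.exp (-b) x) - c (IsNilpotent.exp (-b) x) := by
  have hbc' : Commute b c := LinearMap.ext hbc
  have hc' : b * d - d * b = c := LinearMap.ext hc
  have := exp_mul_of_commute_bracket (b := -b) (d := d) (c := -c) hb.neg
    (by rw [← hc', neg_mul, mul_neg]; abel) hbc'.neg_left.neg_right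
  rw [← sub_eq_add_neg] at this
  exact LinearMap.congr_fun this x

end EndExp

section HExp

variable {A : Type*} [CommRing A] [Algebra ℝ A]
  {V : Type*} [AddCommGroup V] [Module A V] [Module ℝ V] [IsScalarTower ℝ A V]
  {W : Type*} [AddCommGroup W] [Module A W] [Module ℝ W] [IsScalarTower ℝ A W]

/-- `exp (h f)`, for a nilpotent endomorphism `f`. -/
def hExp (f : Module.End A V) : Module.End ℝ[T;T⁻¹] (Laurent V) := IsNilpotent.exp (hEnd f)

lemma hEnd_neg (f : Module.End A V) : hEnd (-f) = -hEnd f := by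
  rw [hEnd, map_neg, smul_neg]; rfl

lemma hEnd_add (f g : Module.End A V) : hEnd (f + g) = hEnd f + hEnd g := by
  rw [hEnd, map_add, smul_add]; rfl

lemma hExp_neg_apply_hExp {f : Module.End A V} (hf : IsNilpotent f) (x : Laurent V) :
    hExp (-f) (hExp f x) = x := by
  rw [hExp, hEnd_neg]
  exact exp_neg_apply_exp (isNilpotent_hEnd hf) x

lemma hExp_apply_hExp_neg {f : Module.End A V} (hf : IsNilpotent f) (x : Laurent V) :
    hExp f (hExp (-f) x) = x := by
  rw [hExp, hExp, hEnd_neg]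
  exact exp_apply_exp_neg (isNilpotent_hEnd hf) x

lemma hExp_add {f g : Module.End A V} (hf : IsNilpotent f) (hg : IsNilpotent g) (h : Commute f g)
    (x : Laurent V) : hExp (f + g) x = hExp f (hExp g x) := by
  rw [hExp, hEnd_add]
  exact exp_add_apply (isNilpotent_hEnd hf) (isNilpotent_hEnd hg) (commute_hEnd h) x

lemma hExp_apply_map {f : Module.End A V} {g : Module.End A W} (hf : IsNilpotent f)
    (hg : IsNilpotent g) (φ : Laurent V →ₗ[ℝ[T;T⁻¹]] Laurent W)
    (h : ∀ x, hEnd g (φ x) = φ (hEnd f x)) (x : Laurent V) : hExp g (φ x) = φ (hExp f x) :=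
  LinearMap.congr_fun (Module.End.commute_exp_left_of_commute (isNilpotent_hEnd hf)
    (isNilpotent_hEnd hg) (LinearMap.ext h)) x

lemma hExp_one_tmul {f : Module.End A V} (hf : IsNilpotent f) {k : ℕ} {a : V}
    (ha : (f ^ k) a = 0) :
    hExp f (1 ⊗ₜ a) =
      ∑ n ∈ Finset.range k, ((n.factorial : ℝ)⁻¹) • ((T n : ℝ[T;T⁻¹]) ⊗ₜ[ℝ] (f ^ n) a) := by
  have h0 : (hEnd f ^ k) ((1 : ℝ[T;T⁻¹]) ⊗ₜ[ℝ] a) = 0 := by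
    rw [hEnd_pow_tmul, ha, TensorProduct.tmul_zero]
  refine (exp_apply_eq_sum (isNilpotent_hEnd hf) h0).trans ?_
  refine Finset.sum_congr rfl fun n _ => ?_
  rw [hEnd_pow_tmul, mul_one, ← Rat.cast_smul_eq_qsmul ℝ]
  push_cast
  rfl

/-- Here `[h f, D] = h δ` and this bracket commutes with `h f`, so conjugation by `exp (-h f)`
changes `D` by exactly `-h δ`. For `f = w ⊢` the right side involves `d_h`. -/
lemma hExp_neg_baseChange {f : Module.End A V} (hf : IsNilpotent f) (D δ : V →ₗ[ℝ] V)
    (hδ : ∀ a, f (D a) - D (f a) = δ a) (hfδ : ∀ a, f (δ a) = δ (f a)) (x : Laurent V) :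
    hExp (-f) (D.baseChange ℝ[T;T⁻¹] x) =
      (D.baseChange ℝ[T;T⁻¹] - (T 1 : ℝ[T;T⁻¹]) • δ.baseChange ℝ[T;T⁻¹]) (hExp (-f) x) := by
  let c : Module.End ℝ[T;T⁻¹] (Laurent V) := (T 1 : ℝ[T;T⁻¹]) • δ.baseChange ℝ[T;T⁻¹]
  let D' : Module.End ℝ[T;T⁻¹] (Laurent V) := D.baseChange ℝ[T;T⁻¹]
  have hc : ∀ x, hEnd f (D' x) - D' (hEnd f x) = c x := by
    intro x
    induction x using TensorProduct.induction_on with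
    | zero => simp
    | add x y hx hy => rw [map_add, map_add, map_add, map_add, map_add, ← hx, ← hy]; abel
    | tmul P a =>
      simp only [c, D', hEnd_tmul, LinearMap.smul_apply, LinearMap.baseChange_tmul, ← hδ,
        TensorProduct.tmul_sub, smul_sub, TensorProduct.smul_tmul', smul_eq_mul]
  have hbc : ∀ x, hEnd f (c x) = c (hEnd f x) := by
    intro x
    induction x using TensorProduct.induction_on with
    | zero => simp
    | add x y hx hy => rw [map_add, map_add, map_add, map_add, hx, hy]
    | tmul P a =>
      simp only [c, hEnd_tmul, LinearMap.smul_apply, LinearMap.baseChange_tmul,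
        TensorProduct.smul_tmul', smul_eq_mul, hfδ]
  rw [hExp, hEnd_neg]
  exact exp_neg_apply_of_commute_bracket (isNilpotent_hEnd hf) hc hbc x

lemma laurent_hom_ext₂ {V W Z : Type*} [AddCommGroup V] [Module ℝ V] [AddCommGroup W] [Module ℝ W]
    [AddCommGroup Z] [Module ℝ[T;T⁻¹] Z]
    {φ ψ : Laurent V →ₗ[ℝ[T;T⁻¹]] Laurent W →ₗ[ℝ[T;T⁻¹]] Z}
    (h : ∀ a b, φ (1 ⊗ₜ a) (1 ⊗ₜ b) = ψ (1 ⊗ₜ a) (1 ⊗ₜ b)) : φ = ψ := by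
  ext x y
  induction x using TensorProduct.induction_on with
  | zero => simp
  | add x x' hx hx' => simp only [map_add, LinearMap.add_apply, hx, hx']
  | tmul P a =>
    induction y using TensorProduct.induction_on with
    | zero => simp
    | add y y' hy hy' => simp only [map_add, hy, hy']
    | tmul Q b =>
      have hP : (P ⊗ₜ[ℝ] a : Laurent V) = P • (1 ⊗ₜ[ℝ] a) := by
        rw [TensorProduct.smul_tmul', smul_eq_mul, mul_one]
      have hQ : (Q ⊗ₜ[ℝ] b : Laurent W) = Q • (1 ⊗ₜ[ℝ] b) := by
        rw [TensorProduct.smul_tmul', smul_eq_mul, mul_one]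
      rw [hP, hQ]
      simp only [map_smul, LinearMap.smul_apply, h]

/-- The `ℝ[h, h⁻¹]`-bilinear extension of a real bilinear map with values in `W`. -/
def laurentBilinear₀ {V W Z : Type*} [AddCommGroup V] [Module ℝ V] [AddCommGroup W] [Module ℝ W]
    [AddCommGroup Z] [Module ℝ Z] (j : V →ₗ[ℝ] W →ₗ[ℝ] Z) :
    Laurent V →ₗ[ℝ[T;T⁻¹]] Laurent W →ₗ[ℝ[T;T⁻¹]] Laurent Z :=
  laurentBilinear (j.compr₂ (TensorProduct.mk ℝ ℝ[T;T⁻¹] Z 1))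

lemma laurentBilinear₀_tmul {V W Z : Type*} [AddCommGroup V] [Module ℝ V] [AddCommGroup W]
    [Module ℝ W] [AddCommGroup Z] [Module ℝ Z] (j : V →ₗ[ℝ] W →ₗ[ℝ] Z) (P Q : ℝ[T;T⁻¹])
    (a : V) (b : W) : laurentBilinear₀ j (P ⊗ₜ a) (Q ⊗ₜ b) = (P * Q) ⊗ₜ j a b := by
  rw [laurentBilinear₀, laurentBilinear_tmul]
  simp only [LinearMap.compr₂_apply, TensorProduct.mk_apply, TensorProduct.smul_tmul', smul_eq_mul,
    mul_one]

/-- If `f (m t) = m ((b₁ + b₂ - l) t)`, then `exp (-h f)` carries the product `m` to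
`m ∘ exp (h l)`. -/
lemma hExp_neg_bilinear {f : Module.End A V} {b₁ b₂ l : Module.End A W} (hf : IsNilpotent f)
    (h₁ : IsNilpotent b₁) (h₂ : IsNilpotent b₂) (hl : IsNilpotent l) (c₁₂ : Commute b₁ b₂)
    (c₁ : Commute b₁ l) (c₂ : Commute b₂ l) (j : V →ₗ[ℝ] V →ₗ[ℝ] W) (m : W →ₗ[ℝ] V)
    (hj₁ : ∀ a b, j (f a) b = b₁ (j a b)) (hj₂ : ∀ a b, j a (f b) = b₂ (j a b))
    (hm : ∀ t, f (m t) = m (b₁ t + b₂ t - l t)) (x y : Laurent V) :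
    hExp (-f) (m.baseChange ℝ[T;T⁻¹] (laurentBilinear₀ j x y)) =
      m.baseChange ℝ[T;T⁻¹] (hExp l (laurentBilinear₀ j (hExp (-f) x) (hExp (-f) y))) := by
  have e₁ : ∀ x y, laurentBilinear₀ j (hEnd (-f) x) y = hEnd (-b₁) (laurentBilinear₀ j x y) := by
    have : (laurentBilinear₀ j).comp (hEnd (-f)) = (laurentBilinear₀ j).compr₂ (hEnd (-b₁)) :=
      laurent_hom_ext₂ fun a b => by simp [hEnd_tmul, laurentBilinear₀_tmul, hj₁]
    exact fun x y => congrArg (fun φ => φ x y) this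
  have e₂ : ∀ x y, laurentBilinear₀ j x (hEnd (-f) y) = hEnd (-b₂) (laurentBilinear₀ j x y) := by
    have : (laurentBilinear₀ j).compl₂ (hEnd (-f)) = (laurentBilinear₀ j).compr₂ (hEnd (-b₂)) :=
      laurent_hom_ext₂ fun a b => by simp [hEnd_tmul, laurentBilinear₀_tmul, hj₂]
    exact fun x y => congrArg (fun φ => φ x y) this
  have e₁' : ∀ x y, laurentBilinear₀ j (hExp (-f) x) y = hExp (-b₁) (laurentBilinear₀ j x y) :=
    fun x y => (hExp_apply_map hf.neg h₁.neg ((laurentBilinear₀ j).flip y)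
      (fun x => (e₁ x y).symm) x).symm
  have e₂' : ∀ x y, laurentBilinear₀ j x (hExp (-f) y) = hExp (-b₂) (laurentBilinear₀ j x y) :=
    fun x y => (hExp_apply_map hf.neg h₂.neg (laurentBilinear₀ j x)
      (fun y => (e₂ x y).symm) y).symm
  have c : Commute (-b₁) (-b₂) := c₁₂.neg_left.neg_right
  have n : IsNilpotent (-b₁ + -b₂) := c.isNilpotent_add h₁.neg h₂.neg
  have c' : Commute l (-b₁ + -b₂) := c₁.symm.neg_right.add_right c₂.symm.neg_right
  -- The commuting exponentials merge into `exp (h (l - b₁ - b₂))`, and by `hm` the map `m`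
  -- intertwines `l - b₁ - b₂` with `-f`.
  rw [e₁', e₂', ← hExp_add h₁.neg h₂.neg c, ← hExp_add hl n c']
  refine hExp_apply_map (c'.isNilpotent_add hl n) hf.neg _ (fun t => ?_) _
  induction t using TensorProduct.induction_on with
  | zero => simp
  | add s t hs ht => simp only [map_add, hs, ht]
  | tmul P t =>
    simp only [LinearMap.baseChange_tmul, hEnd_tmul, LinearMap.neg_apply, hm, LinearMap.add_apply]
    rw [← map_neg]
    congr 2
    abel

end HExp

end

/-! ### Products deformed by `exp (h L)` -/

section

section DeformedProduct

variable {A : Type*} [CommRing A] [Algebra ℝ A]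
  {V : Type*} [AddCommGroup V] [Module A V] [Module ℝ V] [IsScalarTower ℝ A V]

/-- The tensor product over `A`, as a real bilinear map. -/
def mkReal : V →ₗ[ℝ] V →ₗ[ℝ] V ⊗[A] V :=
  LinearMap.mk₂ ℝ (fun a b => a ⊗ₜ b) (fun _ _ _ => TensorProduct.add_tmul _ _ _)
    (fun c a b => (TensorProduct.smul_tmul' c a b).symm)
    (fun _ _ _ => TensorProduct.tmul_add _ _ _)
    (fun c a b => TensorProduct.tmul_smul c a b)

/-- The linear map on the tensor product given by a bilinear map, over the reals. -/
def liftReal (μ : V →ₗ[A] V →ₗ[A] V) : V ⊗[A] V →ₗ[ℝ] V :=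
  (TensorProduct.lift μ).restrictScalars ℝ

/-- The bilinear map `(a, b) ↦ μ (exp (h L) (a ⊗ b))`. -/
def deformedProduct (μ : V →ₗ[A] V →ₗ[A] V) (L : Module.End A (V ⊗[A] V)) :
    V →ₗ[ℝ] V →ₗ[ℝ] Laurent V :=
  (mkReal (A := A)).compr₂ ((((liftReal μ).baseChange ℝ[T;T⁻¹] ∘ₗ hExp L).restrictScalars ℝ) ∘ₗ
    TensorProduct.mk ℝ ℝ[T;T⁻¹] (V ⊗[A] V) 1)

lemma deformedProduct_apply (μ : V →ₗ[A] V →ₗ[A] V) (L : Module.End A (V ⊗[A] V)) (a b : V) :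
    deformedProduct μ L a b =
      (liftReal μ).baseChange ℝ[T;T⁻¹] (hExp L (1 ⊗ₜ[ℝ] (a ⊗ₜ[A] b))) := rfl

lemma deformedProduct_apply_eq_sum (μ : V →ₗ[A] V →ₗ[A] V) {L : Module.End A (V ⊗[A] V)}
    (hL : IsNilpotent L) {k : ℕ} {a b : V} (hk : (L ^ k) (a ⊗ₜ b) = 0) :
    deformedProduct μ L a b = ∑ n ∈ Finset.range k, ((n.factorial : ℝ)⁻¹) •
      ((T n : ℝ[T;T⁻¹]) ⊗ₜ[ℝ] TensorProduct.lift μ ((L ^ n) (a ⊗ₜ[A] b))) := by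
  rw [deformedProduct_apply, hExp_one_tmul hL hk, map_sum]
  refine Finset.sum_congr rfl fun n _ => ?_
  rw [LinearMap.map_smul_of_tower, LinearMap.baseChange_tmul]
  rfl

lemma laurentBilinear_deformedProduct (μ : V →ₗ[A] V →ₗ[A] V) (L : Module.End A (V ⊗[A] V))
    (x y : Laurent V) :
    laurentBilinear (deformedProduct μ L) x y = (liftReal μ).baseChange ℝ[T;T⁻¹]
      (hExp L (laurentBilinear₀ mkReal x y)) := by
  have : laurentBilinear (deformedProduct μ L) = (laurentBilinear₀ mkReal).compr₂
      ((liftReal μ).baseChange ℝ[T;T⁻¹] ∘ₗ hExp L) := by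
    refine laurent_hom_ext₂ fun a b => ?_
    rw [LinearMap.compr₂_apply, LinearMap.comp_apply, laurentBilinear₀_tmul, laurentBilinear_tmul,
      mul_one, one_smul]
    rfl
  rw [this]; rfl

lemma laurentBilinear₀_eq_liftReal (μ : V →ₗ[A] V →ₗ[A] V) (μ' : V →ₗ[ℝ] V →ₗ[ℝ] V)
    (hμ : ∀ a b, μ' a b = μ a b) (x y : Laurent V) :
    laurentBilinear₀ μ' x y =
      (liftReal μ).baseChange ℝ[T;T⁻¹] (laurentBilinear₀ mkReal x y) := by
  have : laurentBilinear₀ μ' =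
      (laurentBilinear₀ mkReal).compr₂ ((liftReal μ).baseChange ℝ[T;T⁻¹]) :=
    laurent_hom_ext₂ fun a b => by
      rw [LinearMap.compr₂_apply, laurentBilinear₀_tmul, laurentBilinear₀_tmul, hμ]; rfl
  rw [this]; rfl

/-- If `f` is a derivation of `μ` up to `-L`, then `exp (-h f)` carries `μ` to `μ ∘ exp (h L)`. -/
theorem hExp_neg_deformedProduct {f : Module.End A V} {L : Module.End A (V ⊗[A] V)}
    (hf : IsNilpotent f) (hL : IsNilpotent L) (c₁ : Commute (f.rTensor V) L)
    (c₂ : Commute (f.lTensor V) L) (μ : V →ₗ[A] V →ₗ[A] V) (μ' : V →ₗ[ℝ] V →ₗ[ℝ] V)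
    (hμ : ∀ a b, μ' a b = μ a b)
    (hfμ : ∀ a b, f (μ a b) = μ (f a) b + μ a (f b) - TensorProduct.lift μ (L (a ⊗ₜ b)))
    (x y : Laurent V) :
    hExp (-f) (laurentBilinear₀ μ' x y) =
      laurentBilinear (deformedProduct μ L) (hExp (-f) x) (hExp (-f) y) := by
  rw [laurentBilinear₀_eq_liftReal μ μ' hμ, laurentBilinear_deformedProduct]
  have c₁₂ : Commute (f.rTensor V) (f.lTensor V) := TensorProduct.ext' fun a b => by simp
  -- The operators acting on one tensor factor are images of `f` under algebra homomorphisms, hence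
  -- nilpotent.
  refine hExp_neg_bilinear hf (hf.map (Module.End.rTensorAlgHom A V V))
    (hf.map (Module.End.lTensorAlgHom A V V)) hL c₁₂ c₁ c₂
    mkReal (liftReal μ) (fun a b => rfl) (fun a b => rfl) (fun t => ?_) x y
  change f (TensorProduct.lift μ t) =
    TensorProduct.lift μ (f.rTensor V t + f.lTensor V t - L t)
  induction t using TensorProduct.induction_on with
  | zero => simp
  | add s t hs ht => simp only [map_add, map_sub, hs, ht]; abel
  | tmul a b =>
    rw [map_sub, map_add]
    exact hfμ a b

end DeformedProduct

end

/-! ### The automorphism `exp (-h w ⊢)` carries `d` and `∧` to `d_h` and `∧_h` -/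

section

variable {A : Type*} [CommRing A] [Algebra ℝ A]

/-- The automorphism `exp (-h w ⊢)`. -/
def quantization (w : Bivector A) : Module.End ℝ[T;T⁻¹] (Laurent (Forms A)) :=
  hExp (-contract w)

/-- The inverse `exp (h w ⊢)` of `quantization`. -/
def dequantization (w : Bivector A) : Module.End ℝ[T;T⁻¹] (Laurent (Forms A)) :=
  hExp (contract w)

lemma dequantization_quantization {w : Bivector A} (hB : IsNilpotent (contract w))
    (x : Laurent (Forms A)) : dequantization w (quantization w x) = x :=
  hExp_apply_hExp_neg hB x

lemma quantization_dequantization {w : Bivector A} (hB : IsNilpotent (contract w))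
    (x : Laurent (Forms A)) : quantization w (dequantization w x) = x :=
  hExp_neg_apply_hExp hB x

/-- The exterior differential on `Ω(M)[h, h⁻¹]`. -/
def laurentD : Module.End ℝ[T;T⁻¹] (Laurent (Forms A)) := exteriorD.baseChange ℝ[T;T⁻¹]

/-- `exp (-h w ⊢)` carries `d` to `d_h`. -/
theorem quantization_laurentD {w : Bivector A} (hB : IsNilpotent (contract w))
    (hw : ∀ a, schouten w a = 0) (x : Laurent (Forms A)) :
    quantization w (laurentD x) = dh w (quantization w x) :=
  hExp_neg_baseChange hB exteriorD (codiff w) (fun _ => rfl) (fun a => sub_eq_zero.1 (hw a)) x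

/-- The exterior product on `Ω(M)[h, h⁻¹]`. -/
def laurentWedge :
    Laurent (Forms A) →ₗ[ℝ[T;T⁻¹]] Laurent (Forms A) →ₗ[ℝ[T;T⁻¹]] Laurent (Forms A) :=
  laurentBilinear₀ wedgeReal

lemma quantumWedgeForms_ofForm (w : Bivector A) {k : ℕ} (α : Form A k) (b : Forms A) :
    quantumWedgeForms w (ofForm α) b = ∑ n ∈ Finset.range (k + 1), ((n.factorial : ℝ)⁻¹) •
      ((T n : ℝ[T;T⁻¹]) ⊗ₜ[ℝ]
        TensorProduct.lift wedge ((contractBoth w ^ n) (ofForm α ⊗ₜ[A] b))) :=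
  LinearMap.congr_fun
    (DirectSum.toModule_lof (M := fun k => Form A k) ℝ (φ := quantumWedgeForm w) k α) b

/-- On a first factor of degree `k`, the powers of `L_w` beyond the `k`-th vanish, so the
degree-dependent truncation computes the full exponential. -/
lemma quantumWedgeForms_eq {w : Bivector A} (hL : IsNilpotent (contractBoth w)) :
    quantumWedgeForms w = deformedProduct wedge (contractBoth w) := by
  refine LinearMap.ext₂ fun a b => ?_
  induction a using forms_induction with
  | h0 => rw [map_zero, map_zero]
  | hadd a a' ha ha' =>
    rw [map_add, map_add, LinearMap.add_apply, LinearMap.add_apply, ha, ha']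
  | hof k α =>
    rw [quantumWedgeForms_ofForm, deformedProduct_apply_eq_sum wedge hL
      (contractBoth_pow_tmul w α b _ (Nat.lt_succ_self k))]

lemma contract_gradeInvolution (w : Bivector A) (a : Forms A) :
    contract w (gradeInvolution a) = gradeInvolution (contract w a) := by
  have : ∀ t, doubleContraction t (gradeInvolution a) =
      gradeInvolution (doubleContraction t a) := by
    intro t
    induction t using TensorProduct.induction_on with
    | zero => simp
    | add s t hs ht => simp only [map_add, LinearMap.add_apply, hs, ht]
    | tmul Y Z => simp only [doubleContraction_tmul, leftContraction_gradeInvolution, map_neg, neg_neg]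
  rw [contract_eq, LinearMap.smul_apply, LinearMap.smul_apply, this, map_smul]

/-- `w ⊢` has even degree, so it commutes both with contractions and with the grading involution
built into the right contraction. -/
lemma commute_rTensor_contractBoth (w : Bivector A) :
    Commute ((contract w).rTensor (Forms A)) (contractBoth w) := by
  refine TensorProduct.ext' fun a b => ?_
  rw [contractBoth_eq]
  simp only [Module.End.mul_apply, LinearMap.rTensor_tmul]
  induction w.1 using TensorProduct.induction_on with
  | zero => simp
  | add s t hs ht => simp only [map_add, LinearMap.add_apply, hs, ht]
  | tmul Y Z =>
    simp only [crossContraction_tmul, LinearMap.rTensor_tmul, contract_gradeInvolution,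
      contract_leftContraction]

lemma commute_lTensor_contractBoth (w : Bivector A) :
    Commute ((contract w).lTensor (Forms A)) (contractBoth w) := by
  refine TensorProduct.ext' fun a b => ?_
  rw [contractBoth_eq]
  simp only [Module.End.mul_apply, LinearMap.lTensor_tmul]
  induction w.1 using TensorProduct.induction_on with
  | zero => simp
  | add s t hs ht => simp only [map_add, LinearMap.add_apply, hs, ht]
  | tmul Y Z =>
    simp only [crossContraction_tmul, LinearMap.lTensor_tmul, contract_leftContraction]

/-- `exp (-h w ⊢)` carries the exterior product to the quantum exterior product. -/
theorem quantization_laurentWedge {w : Bivector A} (hB : IsNilpotent (contract w))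
    (hL : IsNilpotent (contractBoth w)) (x y : Laurent (Forms A)) :
    quantization w (laurentWedge x y) = quantumWedge w (quantization w x) (quantization w y) := by
  have h : quantumWedge w = laurentBilinear (deformedProduct wedge (contractBoth w)) := by
    rw [← quantumWedgeForms_eq hL]; rfl
  rw [h]
  exact hExp_neg_deformedProduct hB hL (commute_rTensor_contractBoth w)
    (commute_lTensor_contractBoth w) wedge wedgeReal (fun _ _ => rfl) (contract_wedge w) x y

end

/-! ### Coefficients, total degree and the filtration by powers of `h` -/

section Coefficients

variable {V W : Type*} [AddCommGroup V] [Module ℝ V] [AddCommGroup W] [Module ℝ W]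

/-- The coefficient of `h^p`. -/
def laurentCoeff (p : ℤ) : Laurent V →ₗ[ℝ] V :=
  TensorProduct.lift (LinearMap.mk₂ ℝ (fun (P : ℝ[T;T⁻¹]) (a : V) => P.coeff p • a)
    (fun _ _ _ => add_smul _ _ _) (fun _ _ _ => smul_assoc _ _ _)
    (fun _ _ _ => smul_add _ _ _) (fun _ _ _ => smul_comm _ _ _))

lemma constCoeff_eq : (constCoeff : Laurent V →ₗ[ℝ] V) = laurentCoeff 0 := rfl

lemma laurentCoeff_tmul (p : ℤ) (P : ℝ[T;T⁻¹]) (a : V) :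
    laurentCoeff p (P ⊗ₜ a) = P.coeff p • a := rfl

lemma coeff_T (p q : ℤ) : (T p : ℝ[T;T⁻¹]).coeff q = if p = q then 1 else 0 := by
  rw [LaurentPolynomial.T]
  simp

lemma laurentCoeff_T_tmul (p q : ℤ) (a : V) :
    laurentCoeff q ((T p : ℝ[T;T⁻¹]) ⊗ₜ a) = if p = q then a else 0 := by
  rw [laurentCoeff_tmul, coeff_T, ite_smul, one_smul, zero_smul]

lemma laurentCoeff_baseChange (f : V →ₗ[ℝ] W) (p : ℤ) (x : Laurent V) :
    laurentCoeff p (f.baseChange ℝ[T;T⁻¹] x) = f (laurentCoeff p x) := by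
  induction x using TensorProduct.induction_on with
  | zero => simp
  | add x y hx hy => simp only [map_add, hx, hy]
  | tmul P a => rw [LinearMap.baseChange_tmul, laurentCoeff_tmul, laurentCoeff_tmul, map_smul]

lemma exists_eq_sum_laurentCoeff (x : Laurent V) :
    ∃ s : Finset ℤ, x = ∑ p ∈ s, (T p : ℝ[T;T⁻¹]) ⊗ₜ laurentCoeff p x := by
  -- Allowing every larger index set makes the statement additive: for a sum, the union of the two
  -- index sets works.
  suffices ∃ s : Finset ℤ, ∀ t, s ⊆ t → x = ∑ p ∈ t, (T p : ℝ[T;T⁻¹]) ⊗ₜ laurentCoeff p x by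
    obtain ⟨s, hs⟩ := this
    exact ⟨s, hs s subset_rfl⟩
  induction x using laurent_induction with
  | htmul p a =>
    refine ⟨{p}, fun t ht => ?_⟩
    rw [Finset.sum_eq_single_of_mem p (Finset.singleton_subset_iff.1 ht), laurentCoeff_T_tmul,
      if_pos rfl]
    intro q _ hq
    rw [laurentCoeff_T_tmul, if_neg hq.symm, TensorProduct.tmul_zero]
  | hadd x y hx hy =>
    obtain ⟨s, hs⟩ := hx
    obtain ⟨t, ht⟩ := hy
    refine ⟨s ∪ t, fun u hu => ?_⟩
    simp only [map_add, TensorProduct.tmul_add, Finset.sum_add_distrib]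
    rw [← hs u (Finset.union_subset_left hu), ← ht u (Finset.union_subset_right hu)]

variable {G : ℤ → Submodule ℝ V}

lemma tmul_mem_laurentPiece {p k : ℤ} {a : V} (ha : a ∈ G k) :
    (T p : ℝ[T;T⁻¹]) ⊗ₜ a ∈ laurentPiece G p k := Submodule.mem_map_of_mem ha

lemma tmul_mem_laurentDegree {p k n : ℤ} {a : V} (ha : a ∈ G k) (h : k + 2 * p = n) :
    (T p : ℝ[T;T⁻¹]) ⊗ₜ a ∈ laurentDegree G n := by
  refine Submodule.mem_iSup_of_mem p (tmul_mem_laurentPiece ?_)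
  rwa [← h, add_sub_cancel_right]

lemma laurentDegree_le {n : ℤ} {S : Submodule ℝ (Laurent V)}
    (h : ∀ p, ∀ a ∈ G (n - 2 * p), (T p : ℝ[T;T⁻¹]) ⊗ₜ a ∈ S) : laurentDegree G n ≤ S :=
  iSup_le fun p => Submodule.map_le_iff_le_comap.2 (h p)

lemma laurentCoeff_mem {n : ℤ} {x : Laurent V} (hx : x ∈ laurentDegree G n) (p : ℤ) :
    laurentCoeff p x ∈ G (n - 2 * p) := by
  have : laurentDegree G n ≤ (G (n - 2 * p)).comap (laurentCoeff p) := by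
    refine laurentDegree_le fun q a ha => ?_
    rw [Submodule.mem_comap, laurentCoeff_T_tmul]
    split_ifs with h
    · subst h; exact ha
    · exact zero_mem _
  exact this hx

/-- The double complex `h^p V^{q-p}`. -/
def laurentBicomplex (G : ℤ → Submodule ℝ V) (p q : ℤ) : Submodule ℝ (Laurent V) :=
  laurentPiece G p (q - p)

lemma filtration_le {p n : ℤ} {S : Submodule ℝ (Laurent V)}
    (h : ∀ q, p ≤ q → ∀ a ∈ G (n - 2 * q), (T q : ℝ[T;T⁻¹]) ⊗ₜ a ∈ S) :
    filtration (laurentBicomplex G) p n ≤ S := by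
  refine iSup₂_le fun q hq => Submodule.map_le_iff_le_comap.2 fun a ha => h q hq a ?_
  rwa [two_mul, ← sub_sub]

lemma tmul_mem_filtration {p q k n : ℤ} (hpq : p ≤ q) {a : V} (ha : a ∈ G k) (h : k + 2 * q = n) :
    (T q : ℝ[T;T⁻¹]) ⊗ₜ a ∈ filtration (laurentBicomplex G) p n := by
  refine Submodule.mem_iSup_of_mem q (Submodule.mem_iSup_of_mem hpq (tmul_mem_laurentPiece ?_))
  rwa [show n - q - q = k by omega]

lemma filtration_anti {p p' n : ℤ} (h : p ≤ p') :
    filtration (laurentBicomplex G) p' n ≤ filtration (laurentBicomplex G) p n :=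
  filtration_le fun _ hq _ ha => tmul_mem_filtration (h.trans hq) ha (by ring)

lemma laurentCoeff_eq_zero_of_mem_filtration {p q n : ℤ} (hq : q < p) {x : Laurent V}
    (hx : x ∈ filtration (laurentBicomplex G) p n) : laurentCoeff q x = 0 := by
  have : filtration (laurentBicomplex G) p n ≤ LinearMap.ker (laurentCoeff (V := V) q) := by
    refine filtration_le fun i hi a _ => ?_
    rw [LinearMap.mem_ker, laurentCoeff_T_tmul, if_neg (by omega)]
  exact this hx

/-- Splits off the leading coefficient, which decides what happens on the pages of the spectral
sequence. -/
lemma exists_eq_add_of_mem_filtration {p n : ℤ} {x : Laurent V}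
    (hx : x ∈ filtration (laurentBicomplex G) p n) :
    ∃ a ∈ G (n - 2 * p), ∃ y ∈ filtration (laurentBicomplex G) (p + 1) n,
      x = (T p : ℝ[T;T⁻¹]) ⊗ₜ a + y := by
  have : filtration (laurentBicomplex G) p n ≤
      laurentPiece G p (n - 2 * p) ⊔ filtration (laurentBicomplex G) (p + 1) n := by
    refine filtration_le fun q hq a ha => ?_
    obtain rfl | h := hq.eq_or_lt
    · exact Submodule.mem_sup_left (tmul_mem_laurentPiece ha)
    · exact Submodule.mem_sup_right (tmul_mem_filtration h ha (by ring))
  obtain ⟨_, ⟨a, ha, rfl⟩, y, hy, rfl⟩ := Submodule.mem_sup.1 (this hx)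
  exact ⟨a, ha, y, hy, rfl⟩

lemma laurentBilinear₀_mem {j : V →ₗ[ℝ] V →ₗ[ℝ] V}
    (hj : ∀ m n a b, a ∈ G m → b ∈ G n → j a b ∈ G (m + n)) {m n : ℤ} {x y : Laurent V}
    (hx : x ∈ laurentDegree G m) (hy : y ∈ laurentDegree G n) :
    laurentBilinear₀ j x y ∈ laurentDegree G (m + n) := by
  have h1 : laurentDegree G m ≤ (laurentDegree G (m + n)).comap
      (((laurentBilinear₀ j).flip y).restrictScalars ℝ) := by
    refine laurentDegree_le fun p a ha => ?_
    have h2 : laurentDegree G n ≤ (laurentDegree G (m + n)).comap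
        ((laurentBilinear₀ j ((T p : ℝ[T;T⁻¹]) ⊗ₜ a)).restrictScalars ℝ) := by
      refine laurentDegree_le fun q b hb => ?_
      rw [Submodule.mem_comap, LinearMap.restrictScalars_apply, laurentBilinear₀_tmul, ← T_add]
      exact tmul_mem_laurentDegree (hj _ _ _ _ ha hb) (by ring)
    exact h2 hy
  exact h1 hx

end Coefficients

section HEnd

variable {A : Type*} [CommRing A] [Algebra ℝ A] {V : Type*} [AddCommGroup V] [Module A V]
  [Module ℝ V] [IsScalarTower ℝ A V] {G : ℤ → Submodule ℝ V} {f : Module.End A V}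

/-- The degree two of `h` balances the two degrees lost under `f`. -/
lemma hEnd_mem_laurentDegree (hf : ∀ n, ∀ a ∈ G n, f a ∈ G (n - 2)) {n : ℤ} {x : Laurent V}
    (hx : x ∈ laurentDegree G n) : hEnd f x ∈ laurentDegree G n := by
  have : laurentDegree G n ≤ (laurentDegree G n).comap ((hEnd f).restrictScalars ℝ) := by
    refine laurentDegree_le fun p a ha => ?_
    rw [Submodule.mem_comap, LinearMap.restrictScalars_apply, hEnd_tmul, ← T_add]
    exact tmul_mem_laurentDegree (hf _ _ ha) (by ring)
  exact this hx

lemma hEnd_mem_filtration (hf : ∀ n, ∀ a ∈ G n, f a ∈ G (n - 2)) {p n : ℤ} {x : Laurent V}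
    (hx : x ∈ filtration (laurentBicomplex G) p n) :
    hEnd f x ∈ filtration (laurentBicomplex G) (p + 1) n := by
  have : filtration (laurentBicomplex G) p n ≤
      (filtration (laurentBicomplex G) (p + 1) n).comap ((hEnd f).restrictScalars ℝ) := by
    refine filtration_le fun q hq a ha => ?_
    rw [Submodule.mem_comap, LinearMap.restrictScalars_apply, hEnd_tmul, ← T_add]
    exact tmul_mem_filtration (by omega) (hf _ _ ha) (by ring)
  exact this hx

lemma hExp_mem_laurentDegree (hn : IsNilpotent f) (hf : ∀ n, ∀ a ∈ G n, f a ∈ G (n - 2)) {n : ℤ}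
    {x : Laurent V} (hx : x ∈ laurentDegree G n) : hExp f x ∈ laurentDegree G n :=
  exp_apply_mem (isNilpotent_hEnd hn) (fun _ h => hEnd_mem_laurentDegree hf h) hx

lemma hExp_sub_mem_filtration (hn : IsNilpotent f) (hf : ∀ n, ∀ a ∈ G n, f a ∈ G (n - 2)) {p n : ℤ}
    {x : Laurent V} (hx : x ∈ filtration (laurentBicomplex G) p n) :
    hExp f x - x ∈ filtration (laurentBicomplex G) (p + 1) n :=
  exp_apply_sub_mem (isNilpotent_hEnd hn) (filtration_anti (by omega))
    (fun _ h => hEnd_mem_filtration hf h) hx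

end HEnd

/-! ### Products on cohomology -/

section InducedProduct

variable {R : Type*} [CommRing R] {V : Type*} [AddCommGroup V] [Module R V]

lemma cls_eq_cls {D : V →ₗ[R] V} {x y : V} {hx : D x = 0} {hy : D y = 0} :
    cls D x hx = cls D y hy ↔ ∃ z, D z = x - y :=
  Submodule.Quotient.eq _

lemma exists_cls_eq {D : V →ₗ[R] V} (c : Cohomology D) : ∃ x hx, cls D x hx = c := by
  obtain ⟨⟨x, hx⟩, rfl⟩ := Submodule.Quotient.mk_surjective _ c
  exact ⟨x, hx, rfl⟩

/-- A graded derivation `D` of a product `μ` induces a product on cohomology. -/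
lemma exists_isInducedProduct {D : V →ₗ[R] V} {μ : V →ₗ[R] V →ₗ[R] V} {γ : V → V}
    (hμ : ∀ a b, D (μ a b) = μ (D a) b + μ (γ a) (D b)) (hγ : ∀ a, γ (γ a) = a)
    (hDγ : ∀ a, D (γ a) = -γ (D a)) (hγ0 : γ 0 = 0) : ∃ m, IsInducedProduct D μ m := by
  have hab : ∀ a b, D a = 0 → D b = 0 → D (μ a b) = 0 := fun a b ha hb => by
    rw [hμ, ha, hb, map_zero, map_zero, LinearMap.zero_apply, add_zero]
  -- A product with an exact second factor is exact: the primitive is `γ a · b`, where the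
  -- involution absorbs the sign in the Leibniz rule.
  have hr : ∀ a b, D a = 0 → D (μ (γ a) b) = μ a (D b) := fun a b ha => by
    rw [hμ, hDγ, ha, hγ0, neg_zero, map_zero, LinearMap.zero_apply, zero_add, hγ]
  have hl : ∀ a b, D b = 0 → D (μ a b) = μ (D a) b := fun a b hb => by
    rw [hμ, hb, map_zero, add_zero]
  let K := LinearMap.ker D
  let I : Submodule R K := (LinearMap.range D).comap K.subtype
  let f : K →ₗ[R] K →ₗ[R] Cohomology D :=
    LinearMap.mk₂ R (fun a b => cls D (μ a b) (hab a b a.2 b.2))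
      (fun a a' b => cls_eq_cls.2 ⟨0, by simp⟩) (fun c a b => cls_eq_cls.2 ⟨0, by simp⟩)
      (fun a b b' => cls_eq_cls.2 ⟨0, by simp⟩) (fun c a b => cls_eq_cls.2 ⟨0, by simp⟩)
  have hfl : I ≤ LinearMap.ker f := by
    rintro ⟨_, ha⟩ ⟨y, rfl⟩
    refine LinearMap.ext fun b => cls_eq_cls.2 ⟨μ y b, ?_⟩
    exact (hl y b b.2).trans (sub_zero _).symm
  have hfr : I ≤ LinearMap.ker f.flip := by
    rintro ⟨_, hb⟩ ⟨y, rfl⟩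
    refine LinearMap.ext fun a => cls_eq_cls.2 ⟨μ (γ a) y, ?_⟩
    exact (hr a y a.2).trans (sub_zero _).symm
  let g : Cohomology D →ₗ[R] K →ₗ[R] Cohomology D := I.liftQ f hfl
  have hg : I ≤ LinearMap.ker g.flip := by
    intro b hb
    refine LinearMap.ext fun c => ?_
    obtain ⟨a, rfl⟩ := Submodule.Quotient.mk_surjective _ c
    exact LinearMap.congr_fun (hfr hb) a
  exact ⟨(I.liftQ g.flip hg).flip, fun a b ha hb => ⟨hab a b ha hb, rfl⟩⟩

end InducedProduct

/-! ### Transport of the structure along a conjugating automorphism -/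

section

section Conjugation

variable {V : Type*} [AddCommGroup V] [Module ℝ V] {D : V →ₗ[ℝ] V}
  {D' : Laurent V →ₗ[ℝ[T;T⁻¹]] Laurent V} {U : Laurent V ≃ₗ[ℝ[T;T⁻¹]] Laurent V}
  {G : ℤ → Submodule ℝ V}

lemma apply_apply_eq_zero_of_conj (hU : ∀ x, U (D.baseChange ℝ[T;T⁻¹] x) = D' (U x))
    (hD : ∀ a, D (D a) = 0) (x : Laurent V) : D' (D' x) = 0 := by
  obtain ⟨x, rfl⟩ := U.surjective x
  rw [← hU, ← hU]
  have : D.baseChange ℝ[T;T⁻¹] (D.baseChange ℝ[T;T⁻¹] x) = 0 := by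
    induction x using TensorProduct.induction_on with
    | zero => simp
    | add x y hx hy => simp only [map_add, hx, hy, add_zero]
    | tmul P a => simp [hD]
  rw [this, map_zero]

/-- The spectral sequence of a differential conjugate to `d` by a unipotent automorphism
degenerates. -/
lemma degeneratesAtE1_of_conj (hU : ∀ x, U (D.baseChange ℝ[T;T⁻¹] x) = D' (U x))
    (hF : ∀ p n x, x ∈ filtration (laurentBicomplex G) p n →
      U x ∈ filtration (laurentBicomplex G) p n)
    (hF' : ∀ p n x, x ∈ filtration (laurentBicomplex G) p n →
      U.symm x ∈ filtration (laurentBicomplex G) p n)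
    (hD : ∀ x, (D'.restrictScalars ℝ) ((D'.restrictScalars ℝ) x) = 0) :
    DegeneratesAtE1 (laurentBicomplex G) hD := by
  intro r hr p q
  refine LinearMap.ext fun c => ?_
  obtain ⟨⟨x, hx, hDx⟩, rfl⟩ := Submodule.Quotient.mk_surjective _ c
  refine (Submodule.Quotient.mk_eq_zero _).2 ?_
  change D' x ∈ pageNull (laurentBicomplex G) (D'.restrictScalars ℝ) r (p + r)
    (p + r + (q - r + 1))
  change D' x ∈ filtration (laurentBicomplex G) (p + r) (p + q + 1) at hDx
  obtain ⟨a, -, y, hy, hay⟩ := exists_eq_add_of_mem_filtration (hF' _ _ _ hx)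
  have hx' : x = U ((T p : ℝ[T;T⁻¹]) ⊗ₜ a + y) := by rw [← hay, U.apply_symm_apply]
  have hDxy : D' x = U (D.baseChange ℝ[T;T⁻¹] ((T p : ℝ[T;T⁻¹]) ⊗ₜ a + y)) := by rw [hU, ← hx']
  -- `U⁻¹` preserves the filtration, so `D (U⁻¹ x)` lies in step `p + r`; as `r ≥ 1`, its
  -- coefficient of `h^p`, namely `D a`, vanishes.
  have h0 : D a = 0 := by
    have h1 : D.baseChange ℝ[T;T⁻¹] ((T p : ℝ[T;T⁻¹]) ⊗ₜ a + y) ∈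
        filtration (laurentBicomplex G) (p + r) (p + q + 1) := by
      have := hF' _ _ _ hDx
      rwa [hDxy, U.symm_apply_apply] at this
    have h2 := laurentCoeff_eq_zero_of_mem_filtration (by omega : p < p + r) h1
    rwa [laurentCoeff_baseChange, map_add, laurentCoeff_T_tmul, if_pos rfl,
      laurentCoeff_eq_zero_of_mem_filtration (by omega) hy, add_zero] at h2
  have hDy : D' (U y) = D' x := by
    rw [hDxy, map_add, LinearMap.baseChange_tmul, h0, TensorProduct.tmul_zero, zero_add, hU]
  -- `U y` lies in filtration step `p + 1` and has the same differential as `x`; so `D' x` belongs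
  -- to the boundaries divided out at the target.
  refine Submodule.mem_sup_right ⟨U y, ⟨?_, ?_⟩, hDy⟩
  · rw [show p + r - r + 1 = p + 1 by ring, show p + r + (q - r + 1) - 1 = p + q by ring]
    exact hF _ _ _ hy
  · change D' (U y) ∈ filtration _ _ _
    rw [hDy, show p + r - r + 1 + (r - 1) = p + r by ring,
      show p + r + (q - r + 1) - 1 + 1 = p + q + 1 by ring]
    exact hDx

/-- The cohomology of a differential conjugate to `d` on `V[h, h⁻¹]` is `H(V)[h, h⁻¹]`. -/
lemma exists_cohomology_equiv (hU : ∀ x, U (D.baseChange ℝ[T;T⁻¹] x) = D' (U x)) :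
    ∃ Φ : Laurent (Cohomology D) ≃ₗ[ℝ[T;T⁻¹]] Cohomology D',
      ∀ (p : ℤ) (a : V) (ha : D a = 0), ∃ h : D' (U ((T p : ℝ[T;T⁻¹]) ⊗ₜ a)) = 0,
        Φ ((T p : ℝ[T;T⁻¹]) ⊗ₜ cls D a ha) = cls D' _ h := by
  -- Over a field, representatives of classes can be chosen linearly, so the choice extends to
  -- Laurent polynomials.
  obtain ⟨s, hs⟩ := LinearMap.exists_rightInverse_of_surjective
    ((LinearMap.range D).comap (LinearMap.ker D).subtype).mkQ (Submodule.range_mkQ _)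
  let σ : Cohomology D →ₗ[ℝ] V := (LinearMap.ker D).subtype ∘ₗ s
  have hσ : ∀ c, D (σ c) = 0 := fun c => (s c).2
  have hcls : ∀ c, cls D (σ c) (hσ c) = c := fun c => LinearMap.congr_fun hs c
  have hσ' : ∀ x, D.baseChange ℝ[T;T⁻¹] (σ.baseChange ℝ[T;T⁻¹] x) = 0 := by
    intro x
    induction x using TensorProduct.induction_on with
    | zero => simp
    | add x y hx hy => simp only [map_add, hx, hy, add_zero]
    | tmul P a => simp [hσ]
  let f : Laurent (Cohomology D) →ₗ[ℝ[T;T⁻¹]] LinearMap.ker D' :=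
    LinearMap.codRestrict _ (U.toLinearMap ∘ₗ σ.baseChange ℝ[T;T⁻¹]) fun x => by
      change D' (U _) = 0
      rw [← hU, hσ', map_zero]
  let Φ : Laurent (Cohomology D) →ₗ[ℝ[T;T⁻¹]] Cohomology D' := Submodule.mkQ _ ∘ₗ f
  have hbc : ∀ p a, D a = 0 → D' (U ((T p : ℝ[T;T⁻¹]) ⊗ₜ a)) = 0 := fun p a ha => by
    rw [← hU, LinearMap.baseChange_tmul, ha, TensorProduct.tmul_zero, map_zero]
  have hΦ : ∀ (p : ℤ) (a : V) (ha : D a = 0),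
      Φ ((T p : ℝ[T;T⁻¹]) ⊗ₜ cls D a ha) = cls D' (U ((T p : ℝ[T;T⁻¹]) ⊗ₜ a)) (hbc p a ha) := by
    intro p a ha
    obtain ⟨z, hz⟩ := cls_eq_cls.1 (hcls (cls D a ha))
    refine cls_eq_cls.2 ⟨U ((T p : ℝ[T;T⁻¹]) ⊗ₜ z), ?_⟩
    rw [← hU, LinearMap.baseChange_tmul, hz, TensorProduct.tmul_sub, map_sub]
    rfl
  -- After undoing `U`, a primitive in `V[h, h⁻¹]` gives a primitive of each coefficient separately.
  have hinj : Function.Injective Φ := by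
    refine (injective_iff_map_eq_zero Φ).2 fun x hx => ?_
    obtain ⟨⟨z, hz⟩⟩ : Nonempty {z // D' z = U (σ.baseChange ℝ[T;T⁻¹] x)} := by
      obtain ⟨z, hz⟩ := (Submodule.Quotient.mk_eq_zero _).1 hx
      exact ⟨⟨z, hz⟩⟩
    obtain ⟨y, rfl⟩ := U.surjective z
    rw [← hU] at hz
    have hy : ∀ p, laurentCoeff p x = 0 := fun p => by
      have := congrArg (laurentCoeff p) (U.injective hz)
      rw [laurentCoeff_baseChange, laurentCoeff_baseChange] at this
      rw [← hcls (laurentCoeff p x)]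
      exact (Submodule.Quotient.mk_eq_zero _).2 ⟨_, this⟩
    obtain ⟨t, ht⟩ := exists_eq_sum_laurentCoeff x
    rw [ht]
    exact Finset.sum_eq_zero fun p _ => by rw [hy, TensorProduct.tmul_zero]
  -- A cocycle of `D'` is `U y` with `D` killing every coefficient of `y`; the classes of these
  -- finitely many coefficients give the preimage.
  have hsurj : Function.Surjective Φ := by
    intro c
    obtain ⟨x, hx, rfl⟩ := exists_cls_eq c
    obtain ⟨y, rfl⟩ := U.surjective x
    have hy : ∀ p, D (laurentCoeff p y) = 0 := fun p => by
      rw [← laurentCoeff_baseChange]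
      have : U (D.baseChange ℝ[T;T⁻¹] y) = 0 := by rw [hU]; exact hx
      rw [(map_eq_zero_iff _ U.injective).1 this, map_zero]
    obtain ⟨t, ht⟩ := exists_eq_sum_laurentCoeff y
    refine ⟨∑ p ∈ t, (T p : ℝ[T;T⁻¹]) ⊗ₜ cls D _ (hy p), ?_⟩
    rw [map_sum]
    simp only [hΦ]
    change ∑ p ∈ t, Submodule.mkQ _ (_ : LinearMap.ker D') = Submodule.mkQ _ (_ : LinearMap.ker D')
    rw [← map_sum]
    congr 1
    ext1
    rw [AddSubmonoidClass.coe_finsetSum, ← map_sum]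
    change U _ = U y
    rw [← ht]
  exact ⟨LinearEquiv.ofBijective Φ ⟨hinj, hsurj⟩, fun p a ha => ⟨hbc p a ha, hΦ p a ha⟩⟩

end Conjugation

section Deformation

variable {V : Type*} [AddCommGroup V] [Module ℝ V] {D : V →ₗ[ℝ] V} {μ : V →ₗ[ℝ] V →ₗ[ℝ] V}
  {γ : V →ₗ[ℝ] V} {e : V} {D' : Laurent V →ₗ[ℝ[T;T⁻¹]] Laurent V}
  {μ' : Laurent V →ₗ[ℝ[T;T⁻¹]] Laurent V →ₗ[ℝ[T;T⁻¹]] Laurent V}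
  {U : Laurent V ≃ₗ[ℝ[T;T⁻¹]] Laurent V} {G : ℤ → Submodule ℝ V}

lemma laurentBilinear₀_assoc (hassoc : ∀ a b c, μ (μ a b) c = μ a (μ b c)) (x y z : Laurent V) :
    laurentBilinear₀ μ (laurentBilinear₀ μ x y) z =
      laurentBilinear₀ μ x (laurentBilinear₀ μ y z) := by
  induction x using TensorProduct.induction_on with
  | zero => simp
  | add x x' hx hx' => simp only [map_add, LinearMap.add_apply, hx, hx']
  | tmul P a =>
    induction y using TensorProduct.induction_on with
    | zero => simp
    | add y y' hy hy' => simp only [map_add, LinearMap.add_apply, hy, hy']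
    | tmul Q b =>
      induction z using TensorProduct.induction_on with
      | zero => simp
      | add z z' hz hz' => simp only [map_add, hz, hz']
      | tmul S c => simp only [laurentBilinear₀_tmul, hassoc, mul_assoc]

lemma laurentBilinear₀_leibniz (hμ : ∀ a b, D (μ a b) = μ (D a) b + μ (γ a) (D b))
    (x y : Laurent V) :
    D.baseChange ℝ[T;T⁻¹] (laurentBilinear₀ μ x y) =
      laurentBilinear₀ μ (D.baseChange ℝ[T;T⁻¹] x) y +
        laurentBilinear₀ μ (γ.baseChange ℝ[T;T⁻¹] x) (D.baseChange ℝ[T;T⁻¹] y) := by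
  induction x using TensorProduct.induction_on with
  | zero => simp
  | add x x' hx hx' => simp only [map_add, LinearMap.add_apply, hx, hx']; abel
  | tmul P a =>
    induction y using TensorProduct.induction_on with
    | zero => simp
    | add y y' hy hy' => simp only [map_add, hy, hy']; abel
    | tmul Q b =>
      simp only [laurentBilinear₀_tmul, LinearMap.baseChange_tmul, hμ, TensorProduct.tmul_add]

/-- If an automorphism `U` of `V[h, h⁻¹]` carries a differential graded algebra structure `(d, μ)` to
`(D', μ')`, then the cohomology of `(D', μ')` is a Laurent deformation of that of `(d, μ)`. -/
theorem exists_isLaurentDeformation_of_conj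
    (hU : ∀ x, U (D.baseChange ℝ[T;T⁻¹] x) = D' (U x))
    (hUμ : ∀ x y, U (laurentBilinear₀ μ x y) = μ' (U x) (U y))
    (hG : ∀ n x, x ∈ laurentDegree G n → U x ∈ laurentDegree G n)
    (hG' : ∀ n x, x ∈ laurentDegree G n → U.symm x ∈ laurentDegree G n)
    (hμ : ∀ a b, D (μ a b) = μ (D a) b + μ (γ a) (D b)) (hγ : ∀ a, γ (γ a) = a)
    (hDγ : ∀ a, D (γ a) = -γ (D a)) (hassoc : ∀ a b c, μ (μ a b) c = μ a (μ b c))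
    (hμG : ∀ m n a b, a ∈ G m → b ∈ G n → μ a b ∈ G (m + n))
    (heG : e ∈ G 0) (hDe : D e = 0) (hle : ∀ a, μ e a = a) (hre : ∀ a, μ a e = a) :
    ∃ mH mQ, IsInducedProduct D μ mH ∧ IsInducedProduct D' μ' mQ ∧
      IsLaurentDeformation (cohomologyPiece D G) mH (cohomologyPiece D' (laurentDegree G)) mQ := by
  obtain ⟨mH, hmH⟩ := exists_isInducedProduct (γ := γ) hμ hγ hDγ (map_zero γ)
  -- The involution must be conjugated as well for `D'` to be a graded derivation of `μ'`.
  let γ' : Laurent V → Laurent V := fun x => U (γ.baseChange ℝ[T;T⁻¹] (U.symm x))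
  have hU' : ∀ x, D' x = U (D.baseChange ℝ[T;T⁻¹] (U.symm x)) := fun x => by
    rw [hU, U.apply_symm_apply]
  have hμ' : ∀ x y, μ' x y = U (laurentBilinear₀ μ (U.symm x) (U.symm y)) := fun x y => by
    rw [hUμ, U.apply_symm_apply, U.apply_symm_apply]
  obtain ⟨mQ, hmQ⟩ : ∃ m, IsInducedProduct D' μ' m := by
    refine exists_isInducedProduct (γ := γ') (fun x y => ?_) (fun x => ?_) (fun x => ?_) ?_
    · simp only [hU', hμ', γ', U.symm_apply_apply, laurentBilinear₀_leibniz hμ, map_add]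
    · simp only [γ', U.symm_apply_apply]
      have : ∀ x, γ.baseChange ℝ[T;T⁻¹] (γ.baseChange ℝ[T;T⁻¹] x) = x := by
        intro x
        induction x using TensorProduct.induction_on with
        | zero => simp
        | add x y hx hy => simp only [map_add, hx, hy]
        | tmul P a => simp [hγ]
      rw [this, U.apply_symm_apply]
    · simp only [hU', γ', U.symm_apply_apply]
      have : ∀ x, D.baseChange ℝ[T;T⁻¹] (γ.baseChange ℝ[T;T⁻¹] x) =
          -γ.baseChange ℝ[T;T⁻¹] (D.baseChange ℝ[T;T⁻¹] x) := by
        intro x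
        induction x using TensorProduct.induction_on with
        | zero => simp
        | add x y hx hy => simp only [map_add, hx, hy]; abel
        | tmul P a => simp [hDγ, TensorProduct.tmul_neg]
      rw [this, map_neg]
    · simp [γ']
  have hμ'assoc : ∀ x y z, μ' (μ' x y) z = μ' x (μ' y z) := fun x y z => by
    simp only [hμ', U.symm_apply_apply, laurentBilinear₀_assoc hassoc]
  have he0 : D' (U (1 ⊗ₜ e)) = 0 := by
    rw [← hU, LinearMap.baseChange_tmul, hDe, TensorProduct.tmul_zero, map_zero]
  have hle' : ∀ x, μ' (U (1 ⊗ₜ e)) x = x := fun x => by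
    have : ∀ x, laurentBilinear₀ μ (1 ⊗ₜ e) x = x := by
      intro x
      induction x using TensorProduct.induction_on with
      | zero => simp
      | add x y hx hy => simp only [map_add, hx, hy]
      | tmul P a => rw [laurentBilinear₀_tmul, hle, one_mul]
    rw [hμ', U.symm_apply_apply, this, U.apply_symm_apply]
  have hre' : ∀ x, μ' x (U (1 ⊗ₜ e)) = x := fun x => by
    have : ∀ x, laurentBilinear₀ μ x (1 ⊗ₜ e) = x := by
      intro x
      induction x using TensorProduct.induction_on with
      | zero => simp
      | add x y hx hy => simp only [map_add, LinearMap.add_apply, hx, hy]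
      | tmul P a => rw [laurentBilinear₀_tmul, hre, mul_one]
    rw [hμ', U.symm_apply_apply, this, U.apply_symm_apply]
  have hcongr : ∀ {x y : Laurent V} (hx : D' x = 0) (hy : D' y = 0), x = y →
      cls D' x hx = cls D' y hy := fun _ _ h => by subst h; rfl
  obtain ⟨Φ, hΦ⟩ := exists_cohomology_equiv hU
  refine ⟨mH, mQ, hmH, hmQ, ⟨?_, ?_, ?_, Φ, ?_, ?_⟩⟩
  · intro x y z
    obtain ⟨x, hx, rfl⟩ := exists_cls_eq x
    obtain ⟨y, hy, rfl⟩ := exists_cls_eq y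
    obtain ⟨z, hz, rfl⟩ := exists_cls_eq z
    obtain ⟨hxy, e₁⟩ := hmQ x y hx hy
    obtain ⟨hyz, e₂⟩ := hmQ y z hy hz
    obtain ⟨h₃, e₃⟩ := hmQ _ z hxy hz
    obtain ⟨h₄, e₄⟩ := hmQ x _ hx hyz
    rw [e₁, e₂, e₃, e₄]
    exact hcongr _ _ (hμ'assoc x y z)
  · refine ⟨cls D' _ he0, ⟨_, he0, hG _ _ ?_, rfl⟩, fun x => ?_⟩
    · rw [← T_zero]
      exact tmul_mem_laurentDegree heG (by ring)
    · obtain ⟨x, hx, rfl⟩ := exists_cls_eq x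
      obtain ⟨h₁, e₁⟩ := hmQ _ x he0 hx
      obtain ⟨h₂, e₂⟩ := hmQ x _ hx he0
      rw [e₁, e₂]
      exact ⟨hcongr _ _ (hle' x), hcongr _ _ (hre' x)⟩
  · rintro m n _ _ ⟨x, hx, hxG, rfl⟩ ⟨y, hy, hyG, rfl⟩
    obtain ⟨h₁, e₁⟩ := hmQ x y hx hy
    rw [e₁]
    refine ⟨_, h₁, ?_, rfl⟩
    rw [hμ']
    exact hG _ _ (laurentBilinear₀_mem hμG (hG' _ _ hxG) (hG' _ _ hyG))
  · intro n
    have h₁ : laurentDegree (cohomologyPiece D G) n ≤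
        (cohomologyPiece D' (laurentDegree G) n).comap (Φ.toLinearMap.restrictScalars ℝ) := by
      refine laurentDegree_le fun p c hc => ?_
      obtain ⟨a, ha, haG, rfl⟩ := hc
      obtain ⟨h, e₁⟩ := hΦ p a ha
      exact ⟨_, h, hG _ _ (tmul_mem_laurentDegree haG (by ring)), e₁.symm⟩
    refine Set.Subset.antisymm (Set.image_subset_iff.2 h₁) ?_
    rintro _ ⟨x, hx, hxG, rfl⟩
    obtain ⟨y, rfl⟩ := U.surjective x
    have hyG : y ∈ laurentDegree G n := by simpa using hG' _ _ hxG
    have hy : ∀ p, D (laurentCoeff p y) = 0 := fun p => by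
      rw [← laurentCoeff_baseChange]
      have : U (D.baseChange ℝ[T;T⁻¹] y) = 0 := by rw [hU]; exact hx
      rw [(map_eq_zero_iff _ U.injective).1 this, map_zero]
    obtain ⟨t, ht⟩ := exists_eq_sum_laurentCoeff y
    refine ⟨∑ p ∈ t, (T p : ℝ[T;T⁻¹]) ⊗ₜ cls D _ (hy p), ?_, ?_⟩
    · exact Submodule.sum_mem _ fun p _ => tmul_mem_laurentDegree
        ⟨_, hy p, laurentCoeff_mem hyG p, rfl⟩ (by ring)
    · rw [map_sum]
      have : ∀ p, ∃ h, Φ ((T p : ℝ[T;T⁻¹]) ⊗ₜ cls D _ (hy p)) =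
        cls D' (U ((T p : ℝ[T;T⁻¹]) ⊗ₜ laurentCoeff p y)) h := fun p => hΦ p _ _
      choose hp ep using this
      simp only [ep]
      change ∑ p ∈ t, Submodule.mkQ _ (_ : LinearMap.ker D') =
        Submodule.mkQ _ (_ : LinearMap.ker D')
      rw [← map_sum]
      congr 1
      ext1
      rw [AddSubmonoidClass.coe_finsetSum, ← map_sum]
      change U _ = U y
      rw [← ht]
  · intro a b
    obtain ⟨a, ha, rfl⟩ := exists_cls_eq a
    obtain ⟨b, hb, rfl⟩ := exists_cls_eq b
    obtain ⟨hab, e₀⟩ := hmH a b ha hb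
    obtain ⟨h₁, e₁⟩ := hΦ 0 a ha
    obtain ⟨h₂, e₂⟩ := hΦ 0 b hb
    obtain ⟨h₃, e₃⟩ := hΦ 0 _ hab
    obtain ⟨h₄, e₄⟩ := hmQ _ _ h₁ h₂
    -- Products of representatives correspond under `U` exactly, so the transported product of `a`
    -- and `b` is the undeformed one, placed at `h^0`.
    rw [e₀, ← T_zero, e₁, e₂, e₄, hcongr h₄ h₃ ?_, ← e₃, Φ.symm_apply_apply, constCoeff_eq,
      laurentCoeff_T_tmul, if_pos rfl]
    rw [hμ', U.symm_apply_apply, U.symm_apply_apply, laurentBilinear₀_tmul, ← T_add, add_zero]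

end Deformation

/-! ### The conclusions over an algebra with a finite dual frame -/

variable {A : Type*} [CommRing A] [Algebra ℝ A]

/-- `quantization w` as an equivalence. -/
def quantizationEquiv (w : Bivector A) (hB : IsNilpotent (contract w)) :
    Laurent (Forms A) ≃ₗ[ℝ[T;T⁻¹]] Laurent (Forms A) :=
  LinearEquiv.ofLinearMap (quantization w) (dequantization w)
    (LinearMap.ext (quantization_dequantization hB)) (LinearMap.ext (dequantization_quantization hB))

/-- The Leibniz rule for `1 ∧ 1 = 1` reads `d1 = d1 + d1`. -/
lemma exteriorD_ofFunction_one : exteriorD (ofFunction (1 : A)) = 0 := by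
  have h := exteriorD_wedge (ofFunction (1 : A)) (ofFunction 1)
  rw [gradeInvolution_ofFunction, wedge_ofFunction_left, wedge_ofFunction_left,
    wedge_ofFunction_right, one_smul, one_smul] at h
  exact left_eq_add.1 h

/-- The conclusions hold over any algebra with a finite dual frame, for a Poisson bivector field. -/
theorem conclusions_of_isPoisson {ι : Type*} [Fintype ι] {f : ι → A} {X : ι → VectorField A}
    (hX : IsDualFrame f X) {w : Bivector A} (hw : IsPoisson w) :
    SpectralSequenceDegenerates w ∧ IsDeformation w ∧ ClosedFormsExtend w := by
  have hB := isNilpotent_contract hX w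
  have hL := isNilpotent_contractBoth hX w
  have hc : ∀ n, ∀ a ∈ formDegree A n, contract w a ∈ formDegree A (n - 2) :=
    fun n a ha => contract_mem_formDegree w ha
  have hc' : ∀ n, ∀ a ∈ formDegree A n, (-contract w) a ∈ formDegree A (n - 2) :=
    fun n a ha => neg_mem (hc n a ha)
  let U := quantizationEquiv w hB
  have hU : ∀ x, U (exteriorD.baseChange ℝ[T;T⁻¹] x) = dh w (U x) :=
    quantization_laurentD hB (schouten_eq_zero hX hw)
  have hD := apply_apply_eq_zero_of_conj hU exteriorD_exteriorD
  -- `U - 1` raises the filtration by one. This gives invariance of the filtration and, for closed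
  -- `α`, that `U α - α` has only positive powers of `h`.
  have hF0 : ∀ p n x, x ∈ filtration (doubleComplex A) p n →
      U x - x ∈ filtration (doubleComplex A) (p + 1) n :=
    fun p n x hx => hExp_sub_mem_filtration hB.neg hc' hx
  have hF : ∀ p n x, x ∈ filtration (doubleComplex A) p n →
      U x ∈ filtration (doubleComplex A) p n := fun p n x hx => by
    have := add_mem (filtration_anti (by omega) (hF0 p n x hx)) hx
    rwa [sub_add_cancel] at this
  have hF' : ∀ p n x, x ∈ filtration (doubleComplex A) p n →
      U.symm x ∈ filtration (doubleComplex A) p n := fun p n x hx => by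
    have := add_mem (filtration_anti (by omega) (hExp_sub_mem_filtration hB hc hx)) hx
    rwa [sub_add_cancel] at this
  refine ⟨⟨hD, degeneratesAtE1_of_conj hU hF hF' hD⟩, ?_, fun k α hα => ?_⟩
  · exact exists_isLaurentDeformation_of_conj (γ := gradeInvolution.restrictScalars ℝ)
      (e := ofFunction 1) hU
      (quantization_laurentWedge hB hL) (fun n x hx => hExp_mem_laurentDegree hB.neg hc' hx)
      (fun n x hx => hExp_mem_laurentDegree hB hc hx) exteriorD_wedge
      gradeInvolution_gradeInvolution exteriorD_gradeInvolution wedge_assoc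
      (fun m n a b => wedge_mem_formDegree) (ofFunction_mem_formDegree 1) exteriorD_ofFunction_one
      (fun a => (wedge_ofFunction_left 1 a).trans (one_smul _ _))
      (fun a => (wedge_ofFunction_right 1 a).trans (one_smul _ _))
  · have hk := ofForm_mem_formDegree α
    refine ⟨U (1 ⊗ₜ ofForm α), ?_, ?_, ?_⟩
    · rw [← hU, LinearMap.baseChange_tmul, exteriorD_ofForm, hα, ofForm_zero,
        TensorProduct.tmul_zero, map_zero]
    · rw [← T_zero]
      exact hExp_mem_laurentDegree hB.neg hc' (tmul_mem_laurentDegree hk (by ring))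
    · rw [← T_zero]
      exact hF0 0 k _ (tmul_mem_filtration le_rfl hk (by ring))

end

/-! ### Symplectic forms and their inverses -/

section

variable {A : Type*} [CommRing A] [Algebra ℝ A]

/-- The one-form `df`. -/
def differentialForm (f : A) : Form A 1 := AlternatingMap.ofSubsingleton A (VectorField A) A 0 (evalAt f)

lemma differentialForm_apply (f : A) (v : Fin 1 → VectorField A) :
    differentialForm f v = v 0 f := rfl

lemma differential_eq (f : A) : differential f = ofForm (differentialForm f) := by
  rw [differential, ofFunction, exteriorD_ofForm]
  congr 1
  ext v
  simp [extDerivForm_apply, differentialForm_apply]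

lemma two_form_skew (σ : Form A 2) (X Y : VectorField A) : σ ![X, Y] = -σ ![Y, X] := by
  have := σ.map_swap ![Y, X] (i := 0) (j := 1) (by decide)
  rw [← this]
  congr 1
  funext i
  fin_cases i <;> rfl

lemma exists_hamiltonian {σ : Form A 2} (hσ : IsSymplectic σ) (f : A) :
    ∃ Y : VectorField A, ∀ Z, σ ![Y, Z] = Z f := by
  obtain ⟨Y, hY⟩ := hσ.2.2 (differentialForm f)
  refine ⟨Y, fun Z => ?_⟩
  have := congrArg (fun α : Form A 1 => α ![Z]) hY
  simpa [differentialForm_apply] using this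

lemma leftContraction_eq_differential {σ : Form A 2} {Y : VectorField A} {f : A}
    (hY : ∀ Z, σ ![Y, Z] = Z f) : leftContraction Y (ofForm σ) = differential f := by
  rw [leftContraction_ofForm_succ, differential_eq]
  congr 1
  ext v
  rw [differentialForm_apply, ← hY, AlternatingMap.curryLeft_apply_apply]
  congr 1
  funext i
  fin_cases i <;> rfl

lemma lieD_differential (X : VectorField A) (f : A) :
    lieD X (differential f) = differential (X f) := by
  have h := leftContraction_exteriorD X (differential f)
  rw [leftContraction_differential, differential, exteriorD_exteriorD, map_zero] at h
  exact sub_eq_zero.1 h.symm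

lemma eq_of_leftContraction_eq {σ : Form A 2} (hσ : IsSymplectic σ) {X Y : VectorField A}
    (h : leftContraction X (ofForm σ) = leftContraction Y (ofForm σ)) : X = Y := by
  rw [leftContraction_ofForm_succ, leftContraction_ofForm_succ] at h
  exact hσ.2.1 (DirectSum.of_injective (β := fun k => Form A k) 1 h)

/-- The Hamiltonian vector fields of a symplectic form are closed under the Lie bracket. -/
lemma bracket_hamiltonian {σ : Form A 2} (hσ : IsSymplectic σ) {H : A → VectorField A}
    (hH : ∀ f Z, σ ![H f, Z] = Z f) (f g : A) : ⁅H f, H g⁆ = H (H f g) := by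
  have hd : exteriorD (ofForm σ) = 0 := by rw [exteriorD_ofForm, hσ.1, ofForm_zero]
  -- Cartan's formula: `σ` is closed and `H f ⊢ σ = df` is exact.
  have hL : lieD (H f) (ofForm σ) = 0 := by
    have h := leftContraction_exteriorD (H f) (ofForm σ)
    rw [hd, map_zero, leftContraction_eq_differential (hH f), differential, exteriorD_exteriorD,
      sub_zero] at h
    exact h.symm
  refine eq_of_leftContraction_eq hσ ?_
  -- Invariance of `σ` gives `[H f, H g] ⊢ σ = L_{H f} dg = d (H f g)`, and nondegeneracy identifies
  -- the field.
  have h := leftContraction_lieD (H f) (H g) (ofForm σ)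
  rw [hL, map_zero, leftContraction_eq_differential (hH _), lieD_differential] at h
  rw [leftContraction_eq_differential (hH _)]
  exact (sub_eq_zero.1 h.symm).symm

/-- The inverse of a symplectic form is a Poisson bivector field. -/
theorem isPoisson_of_isInverse {σ : Form A 2} (hσ : IsSymplectic σ) {w : Bivector A}
    (hw : IsInverse σ w) : IsPoisson w := by
  choose H hH using exists_hamiltonian hσ
  have hb : ∀ f g, H f g = poissonBracket w f g := by
    intro f g
    -- The inverse relation at `Z = H f`, evaluated on `g`, reads `H f g = w^{ij} σ(e_j, H f) e_i
    -- g`; since `σ(e_j, H f) = -e_j f`, the right side is `-{g, f}`.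
    have h : ∀ t : VectorField A ⊗[A] VectorField A, raise σ (H f) t g =
        -TensorProduct.lift ((LinearMap.mul A A).compl₁₂ (evalAt g) (evalAt f)) t := by
      intro t
      induction t using TensorProduct.induction_on with
      | zero => simp
      | add s t hs ht => simp only [map_add, Derivation.add_apply, hs, ht, neg_add]
      | tmul X Y =>
        change σ ![Y, H f] * X g = -(X g * Y f)
        rw [two_form_skew, hH]; ring
    have := h w.1
    rw [hw] at this
    rw [this, poissonBracket_skew w g f]
    simp [poissonBracket]
  intro f g h
  -- The bracket relation between Hamiltonian fields, evaluated on `h`, is the Jacobi identity.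
  have hJ := congrArg (fun X : VectorField A => X h) (bracket_hamiltonian hσ hH f g)
  simp only [Derivation.commutator_apply, hb] at hJ
  have hn : poissonBracket w g (poissonBracket w h f) =
      -poissonBracket w g (poissonBracket w f h) := by
    rw [poissonBracket_skew w f h, ← hb, map_neg, hb]
  rw [hn, poissonBracket_skew w (poissonBracket w f g) h, ← hJ]
  ring

/-- Over an algebra with a finite dual frame, every symplectic form has an inverse. -/
theorem exists_isInverse {ι : Type*} [Fintype ι] {f : ι → A} {X : ι → VectorField A}
    (hX : IsDualFrame f X) {σ : Form A 2} (hσ : IsSymplectic σ) : ∃ w, IsInverse σ w := by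
  choose H hH using exists_hamiltonian hσ
  -- The frame property applied to `H (f i)`, whose coefficient `H (f i) (f j)` is a value of `σ`.
  have hHX : ∀ i, H (f i) = ∑ j, σ ![H (f j), H (f i)] • X j := fun i => by
    simp only [hH]; exact (hX _).symm
  -- Skewness follows from that of the matrix `σ(H fⱼ, H fᵢ)`. For the inverse relation, `∑ σ(H fᵢ,
  -- Z) Xᵢ = ∑ Z(fᵢ) Xᵢ = Z`.
  refine ⟨⟨∑ i, X i ⊗ₜ H (f i), ?_⟩, fun Z => ?_⟩
  · have h1 : ∑ i, X i ⊗ₜ[A] H (f i) = ∑ i, ∑ j, σ ![H (f j), H (f i)] • (X i ⊗ₜ[A] X j) := by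
      refine Finset.sum_congr rfl fun i _ => ?_
      conv_lhs => rw [hHX]
      rw [TensorProduct.tmul_sum]
      simp only [TensorProduct.tmul_smul]
    rw [h1]
    simp only [map_sum, map_smul, TensorProduct.comm_tmul, ← Finset.sum_neg_distrib]
    rw [Finset.sum_comm]
    refine Finset.sum_congr rfl fun i _ => Finset.sum_congr rfl fun j _ => ?_
    rw [two_form_skew, ← TensorProduct.tmul_smul, ← TensorProduct.tmul_smul, neg_smul,
      TensorProduct.tmul_neg]
  · rw [map_sum]
    refine Eq.trans (Finset.sum_congr rfl fun i _ => ?_) (hX Z)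
    change σ ![H (f i), Z] • X i = _
    rw [hH]

end

/-! ### Hadamard's lemma -/

section

open scoped ContDiff

section Hadamard

variable {E : Type*} [NormedAddCommGroup E] [NormedSpace ℝ E] [FiniteDimensional ℝ E]

lemma hasFDerivAt_integral_of_contDiff {F : E × ℝ → ℝ} (hF : ContDiff ℝ ∞ F) (x₀ : E) :
    HasFDerivAt (fun x => ∫ t in (0 : ℝ)..1, F (x, t))
      (∫ t in (0 : ℝ)..1, (fderiv ℝ F (x₀, t)).comp (ContinuousLinearMap.inl ℝ E ℝ)) x₀ := by
  have hc : Continuous fun p : E × ℝ => (fderiv ℝ F p).comp (ContinuousLinearMap.inl ℝ E ℝ) :=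
    (hF.continuous_fderiv (by simp)).clm_comp continuous_const
  -- A compact ball times the interval supplies the uniform bound for differentiation under the
  -- integral.
  obtain ⟨C, hC⟩ := (((isCompact_closedBall x₀ 1).prod
    (isCompact_Icc (a := (0 : ℝ)) (b := 1))).image hc.norm).bddAbove
  refine intervalIntegral.hasFDerivAt_integral_of_dominated_of_fderiv_le
    (F := fun x t => F (x, t))
    (F' := fun x t => (fderiv ℝ F (x, t)).comp (ContinuousLinearMap.inl ℝ E ℝ))
    (bound := fun _ => C) (Metric.closedBall_mem_nhds x₀ one_pos) ?_ ?_ ?_ ?_ ?_ ?_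
  · exact .of_forall fun x =>
      (hF.continuous.comp (Continuous.prodMk_right x)).aestronglyMeasurable
  · exact (hF.continuous.comp (Continuous.prodMk_right x₀)).intervalIntegrable _ _
  · exact (hc.comp (Continuous.prodMk_right x₀)).aestronglyMeasurable
  · refine .of_forall fun t ht x hx => hC ⟨(x, t), ⟨hx, ?_⟩, rfl⟩
    rw [Set.uIoc_of_le zero_le_one] at ht
    exact Set.Ioc_subset_Icc_self ht
  · simp
  · refine .of_forall fun t _ x _ => ?_
    exact (hF.differentiable (by simp) (x, t)).hasFDerivAt.comp x (hasFDerivAt_prodMk_left x t)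

/-- A directional derivative of a parameter integral is the parameter integral of another smooth
function, so the induction on the order of differentiability runs over all `F` at once. -/
lemma contDiff_integral {F : E × ℝ → ℝ} (hF : ContDiff ℝ ∞ F) :
    ContDiff ℝ ∞ fun x => ∫ t in (0 : ℝ)..1, F (x, t) := by
  rw [contDiff_infty]
  intro n
  induction n generalizing F with
  | zero =>
    refine contDiff_zero.2 (continuous_iff_continuousAt.2 fun x => ?_)
    exact (hasFDerivAt_integral_of_contDiff hF x).continuousAt
  | succ n ih =>
    push_cast
    rw [contDiff_succ_iff_fderiv_apply]
    refine ⟨fun x => (hasFDerivAt_integral_of_contDiff hF x).differentiableAt, by simp,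
      fun y => ?_⟩
    have hy : ContDiff ℝ ∞ fun p : E × ℝ => fderiv ℝ F p (y, 0) :=
      (hF.fderiv_right (m := ∞) (by simp)).clm_apply contDiff_const
    refine (congrArg (ContDiff ℝ n) (funext fun x => ?_)).mpr (ih hy)
    rw [(hasFDerivAt_integral_of_contDiff hF x).fderiv, ContinuousLinearMap.intervalIntegral_apply]
    · rfl
    · refine Continuous.intervalIntegrable ?_ _ _
      exact ((hF.continuous_fderiv (by simp)).comp (Continuous.prodMk_right x)).clm_comp
        continuous_const

/-- Hadamard's lemma. -/
lemma exists_hadamard {ι : Type*} [Fintype ι] (b : Module.Basis ι ℝ E) {G : E → ℝ}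
    (hG : ContDiff ℝ ∞ G) (c : E) :
    ∃ g : ι → E → ℝ, (∀ j, ContDiff ℝ ∞ (g j)) ∧ (∀ j, g j c = fderiv ℝ G c (b j)) ∧
      ∀ y, G y = G c + ∑ j, (b.coord j y - b.coord j c) * g j y := by
  have hline : ContDiff ℝ ∞ fun p : E × ℝ => c + p.2 • (p.1 - c) := by fun_prop
  have hF : ∀ v, ContDiff ℝ ∞ fun p : E × ℝ => fderiv ℝ G (c + p.2 • (p.1 - c)) v := fun v =>
    ((hG.fderiv_right (m := ∞) (by simp)).comp hline).clm_apply contDiff_const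
  refine ⟨fun j x => ∫ t in (0 : ℝ)..1, fderiv ℝ G (c + t • (x - c)) (b j),
    fun j => contDiff_integral (hF (b j)), fun j => by simp, fun y => ?_⟩
  -- The fundamental theorem of calculus along the segment from `c` to `y`.
  have hint : ∫ t in (0 : ℝ)..1, fderiv ℝ G (c + t • (y - c)) (y - c) = G y - G c := by
    have := intervalIntegral.integral_eq_sub_of_hasDerivAt (a := 0) (b := 1)
      (f := fun t : ℝ => G (c + t • (y - c)))
      (f' := fun t => fderiv ℝ G (c + t • (y - c)) (y - c)) (fun t _ => ?_) ?_
    · simpa using this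
    · have h1 : HasDerivAt (fun t : ℝ => c + t • (y - c)) (y - c) t := by
        simpa using ((hasDerivAt_id t).smul_const (y - c)).const_add c
      exact (hG.differentiable (by simp) _).hasFDerivAt.comp_hasDerivAt t h1
    · exact ((hF (y - c)).continuous.comp (Continuous.prodMk_right y)).intervalIntegrable _ _
  have hsum : ∀ t : ℝ, fderiv ℝ G (c + t • (y - c)) (y - c) =
      ∑ j, (b.coord j y - b.coord j c) * fderiv ℝ G (c + t • (y - c)) (b j) := by
    intro t
    generalize fderiv ℝ G (c + t • (y - c)) = L
    conv_lhs => rw [← b.sum_repr (y - c)]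
    simp only [map_sum, map_smul, smul_eq_mul, Module.Basis.coord_apply, map_sub,
      Finsupp.sub_apply]
  rw [← sub_eq_iff_eq_add', ← hint]
  simp only [hsum]
  rw [intervalIntegral.integral_finsetSum]
  · simp only [intervalIntegral.integral_const_mul]
  · exact fun j _ => (continuous_const.mul
      ((hF (b j)).continuous.comp (Continuous.prodMk_right y))).intervalIntegrable _ _

end Hadamard

end

/-! ### A finite dual frame on a closed manifold -/

section

open scoped Manifold ContDiff

section DualFrame

variable {E : Type*} [NormedAddCommGroup E] [NormedSpace ℝ E]
  {M : Type*} [TopologicalSpace M] [ChartedSpace E M] [IsManifold 𝓘(ℝ, E) ∞ M]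

lemma contDiffOn_chart (g : C^∞⟮𝓘(ℝ, E), M; 𝓘(ℝ, ℝ), ℝ⟯) (c : M) :
    ContDiffOn ℝ ∞ (g ∘ (extChartAt 𝓘(ℝ, E) c).symm) (extChartAt 𝓘(ℝ, E) c).target :=
  contMDiffOn_iff_contDiffOn.1 (g.contMDiff.comp_contMDiffOn (contMDiffOn_extChartAt_symm c))

/-- The partial derivative of `g` at `x` in the direction `e`, in the chart at `c`. -/
def chartDeriv (c : M) (e : E) (g : M → ℝ) (x : M) : ℝ :=
  fderiv ℝ (g ∘ (extChartAt 𝓘(ℝ, E) c).symm) (extChartAt 𝓘(ℝ, E) c x) e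

lemma contMDiffAt_chartDeriv (g : C^∞⟮𝓘(ℝ, E), M; 𝓘(ℝ, ℝ), ℝ⟯) {c x : M} (e : E)
    (hx : x ∈ (extChartAt 𝓘(ℝ, E) c).source) :
    ContMDiffAt 𝓘(ℝ, E) 𝓘(ℝ, ℝ) ∞ (chartDeriv c e g) x := by
  have ht : (extChartAt 𝓘(ℝ, E) c).target ∈ nhds (extChartAt 𝓘(ℝ, E) c x) :=
    (isOpen_extChartAt_target c).mem_nhds ((extChartAt 𝓘(ℝ, E) c).map_source hx)
  have h1 : ContDiffAt ℝ ∞ (fun y => fderiv ℝ (g ∘ (extChartAt 𝓘(ℝ, E) c).symm) y e)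
      (extChartAt 𝓘(ℝ, E) c x) :=
    (((contDiffOn_chart g c).contDiffAt ht).fderiv_right (m := ∞) (by simp)).clm_apply
      contDiffAt_const
  exact h1.contMDiffAt.comp x (contMDiffAt_extChartAt' (by simpa using hx))

lemma differentiableAt_chart (g : C^∞⟮𝓘(ℝ, E), M; 𝓘(ℝ, ℝ), ℝ⟯) {c x : M}
    (hx : x ∈ (extChartAt 𝓘(ℝ, E) c).source) :
    DifferentiableAt ℝ (g ∘ (extChartAt 𝓘(ℝ, E) c).symm) (extChartAt 𝓘(ℝ, E) c x) :=
  ((contDiffOn_chart g c).contDiffAt ((isOpen_extChartAt_target c).mem_nhds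
    ((extChartAt 𝓘(ℝ, E) c).map_source hx))).differentiableAt (by simp)

variable [FiniteDimensional ℝ E] [T2Space M]

/-- Derivations of `C^∞(M)` are local. -/
lemma derivation_apply_eq_zero {x : M} (Y : VectorField C^∞⟮𝓘(ℝ, E), M; 𝓘(ℝ, ℝ), ℝ⟯)
    {u : C^∞⟮𝓘(ℝ, E), M; 𝓘(ℝ, ℝ), ℝ⟯} (hu : ∀ᶠ y in nhds x, u y = 0) : Y u x = 0 := by
  -- With `χ` equal to one at `x` and supported where `u` vanishes, `χ u = 0`; the Leibniz rule at
  -- `x` isolates `Y u x`.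
  obtain ⟨χ, -, hχ⟩ := (SmoothBumpFunction.nhds_basis_support (I := 𝓘(ℝ, E)) hu).mem_iff.1 hu
  let χ' : C^∞⟮𝓘(ℝ, E), M; 𝓘(ℝ, ℝ), ℝ⟯ := ⟨χ, χ.contMDiff⟩
  have h0 : χ' * u = 0 := by
    ext y
    change χ y * u y = 0
    by_cases hy : χ y = 0
    · rw [hy, zero_mul]
    · rw [show u y = 0 from hχ hy, mul_zero]
  have h1 := congrArg (fun v : C^∞⟮𝓘(ℝ, E), M; 𝓘(ℝ, ℝ), ℝ⟯ => v x) (Y.leibniz χ' u)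
  rw [h0, map_zero] at h1
  have h2 : (0 : ℝ) = χ x * Y u x + u x * Y χ' x := h1
  rw [χ.eq_one, hu.self_of_nhds, one_mul, zero_mul, add_zero] at h2
  exact h2.symm

lemma derivation_congr {x : M} (Y : VectorField C^∞⟮𝓘(ℝ, E), M; 𝓘(ℝ, ℝ), ℝ⟯)
    {u v : C^∞⟮𝓘(ℝ, E), M; 𝓘(ℝ, ℝ), ℝ⟯} (h : ∀ᶠ y in nhds x, u y = v y) : Y u x = Y v x := by
  have := derivation_apply_eq_zero Y (u := u - v) (h.mono fun y hy => by
    change u y - v y = 0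
    rw [hy, sub_self])
  rw [map_sub] at this
  exact sub_eq_zero.1 this

/-- A coordinate vector field, cut off by a member of a partition of unity. -/
def cutoffField {ι : Type*} (ρ : SmoothPartitionOfUnity ι 𝓘(ℝ, E) M) (i : ι) (c : M)
    (hc : tsupport (ρ i) ⊆ (extChartAt 𝓘(ℝ, E) c).source) (e : E) :
    VectorField C^∞⟮𝓘(ℝ, E), M; 𝓘(ℝ, ℝ), ℝ⟯ :=
  Derivation.mk'
    { toFun := fun g => ⟨fun x => ρ i x • chartDeriv c e g x,
        ρ.contMDiff_smul fun x hx => contMDiffAt_chartDeriv g e (hc hx)⟩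
      map_add' := fun g g' => by
        ext x
        change ρ i x * _ = ρ i x * _ + ρ i x * _
        -- On the support of `ρ i` the point lies in the chart, so the differentiation rules apply;
        -- elsewhere the factor `ρ i x` is zero.
        by_cases hx : x ∈ tsupport (ρ i)
        · rw [← mul_add]
          congr 1
          exact congrArg (fun L : E →L[ℝ] ℝ => L e)
            (fderiv_add (differentiableAt_chart g (hc hx)) (differentiableAt_chart g' (hc hx)))
        · rw [image_eq_zero_of_notMem_tsupport hx]; simp
      map_smul' := fun r g => by
        ext x
        change ρ i x * _ = r * (ρ i x * _)
        by_cases hx : x ∈ tsupport (ρ i)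
        · rw [mul_left_comm]
          congr 1
          exact congrArg (fun L : E →L[ℝ] ℝ => L e)
            (fderiv_const_smul (differentiableAt_chart g (hc hx)) r)
        · rw [image_eq_zero_of_notMem_tsupport hx]; simp }
    (fun g g' => by
      ext x
      change ρ i x * _ = g x * (ρ i x * _) + g' x * (ρ i x * _)
      by_cases hx : x ∈ tsupport (ρ i)
      · have h := congrArg (fun L : E →L[ℝ] ℝ => L e)
          (fderiv_mul (differentiableAt_chart g (hc hx)) (differentiableAt_chart g' (hc hx)))
        have hs := (extChartAt 𝓘(ℝ, E) c).left_inv (hc hx)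
        simp only [_root_.add_apply, _root_.smul_apply,
          Function.comp_apply, hs, smul_eq_mul] at h
        rw [mul_left_comm, mul_left_comm (g' x), ← mul_add]
        congr 1
      · rw [image_eq_zero_of_notMem_tsupport hx]; simp)

/-- A derivation is determined by its values on the coordinates of a chart. -/
lemma derivation_apply_eq_sum {ι : Type*} [Fintype ι] (b : Module.Basis ι ℝ E) {c x : M}
    (fs : SmoothBumpFunction 𝓘(ℝ, E) c) (hfs : ∀ᶠ y in nhds x, fs y = 1)
    (φ : ι → C^∞⟮𝓘(ℝ, E), M; 𝓘(ℝ, ℝ), ℝ⟯)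
    (hφ : ∀ j y, φ j y = fs y • b.coord j (extChartAt 𝓘(ℝ, E) c y))
    (Y : VectorField C^∞⟮𝓘(ℝ, E), M; 𝓘(ℝ, ℝ), ℝ⟯) (g : C^∞⟮𝓘(ℝ, E), M; 𝓘(ℝ, ℝ), ℝ⟯) :
    Y g x = ∑ j, Y (φ j) x * chartDeriv c (b j) g x := by
  have hx : x ∈ (extChartAt 𝓘(ℝ, E) c).source := by
    rw [extChartAt_source]
    refine fs.support_subset_source ?_
    rw [Function.mem_support, hfs.self_of_nhds]
    exact one_ne_zero
  have ht : (extChartAt 𝓘(ℝ, E) c).target ∈ nhds (extChartAt 𝓘(ℝ, E) c x) :=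
    (isOpen_extChartAt_target c).mem_nhds ((extChartAt 𝓘(ℝ, E) c).map_source hx)
  -- Hadamard's lemma needs a function on all of `E`; locality permits replacing the chart
  -- expression of `g` away from the point.
  obtain ⟨G, hG, hGg⟩ : ∃ G : E → ℝ, ContDiff ℝ ∞ G ∧
      G =ᶠ[nhds (extChartAt 𝓘(ℝ, E) c x)] g ∘ (extChartAt 𝓘(ℝ, E) c).symm := by
    obtain ⟨r, hr, hrt⟩ := Metric.nhds_basis_closedBall.mem_iff.1 ht
    let χ : ContDiffBump (extChartAt 𝓘(ℝ, E) c x) := ⟨r / 2, r, half_pos hr, half_lt_self hr⟩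
    have hχ : tsupport χ ⊆ (extChartAt 𝓘(ℝ, E) c).target := χ.tsupport_eq.trans_subset hrt
    refine ⟨fun y => χ y * (g ∘ (extChartAt 𝓘(ℝ, E) c).symm) y, ?_, ?_⟩
    · refine contMDiff_iff_contDiff.1 (contMDiff_of_tsupport fun y hy => ContDiffAt.contMDiffAt ?_)
      have hy' := hχ (closure_mono (Function.support_mul_subset_left _ _) hy)
      exact χ.contDiff.contDiffAt.mul
        ((contDiffOn_chart g c).contDiffAt ((isOpen_extChartAt_target c).mem_nhds hy'))
    · filter_upwards [χ.eventuallyEq_one] with y hy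
      rw [hy, Pi.one_apply, one_mul]
  obtain ⟨h, hh, hh', hGh⟩ := exists_hadamard b hG (extChartAt 𝓘(ℝ, E) c x)
  let k : ι → C^∞⟮𝓘(ℝ, E), M; 𝓘(ℝ, ℝ), ℝ⟯ := fun j =>
    ⟨fun y => fs y • h j (extChartAt 𝓘(ℝ, E) c y), fs.contMDiff_smul
      ((hh j).contMDiff.comp_contMDiffOn contMDiffOn_extChartAt)⟩
  let a : ι → ℝ := fun j => b.coord j (extChartAt 𝓘(ℝ, E) c x)
  let A := C^∞⟮𝓘(ℝ, E), M; 𝓘(ℝ, ℝ), ℝ⟯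
  have hcoe : ∀ (s : Finset ι) (u : ι → A) (y : M), (∑ j ∈ s, u j : A) y = ∑ j ∈ s, u j y :=
    fun s u y => map_sum (⟨⟨fun v : A => v y, rfl⟩, fun _ _ => rfl⟩ : A →+ ℝ) u s
  -- The Hadamard expansion, with cut-off coordinates and coefficients, is an identity of global
  -- functions near `x`.
  have hloc : Y g x = Y (algebraMap ℝ A (g x) + ∑ j, (φ j - algebraMap ℝ A (a j)) * k j) x := by
    refine derivation_congr Y ?_
    have hcont := (continuousAt_extChartAt' (I := 𝓘(ℝ, E)) hx).eventually hGg
    filter_upwards [hfs, hcont, (isOpen_extChartAt_source c).mem_nhds hx] with y hy hy' hys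
    have e1 : g y = G (extChartAt 𝓘(ℝ, E) c y) := by
      rw [hy', Function.comp_apply, (extChartAt 𝓘(ℝ, E) c).left_inv hys]
    have e2 : g x = G (extChartAt 𝓘(ℝ, E) c x) := by
      rw [hGg.self_of_nhds, Function.comp_apply, (extChartAt 𝓘(ℝ, E) c).left_inv hx]
    change g y = g x + (∑ j, (φ j - algebraMap ℝ A (a j)) * k j : A) y
    rw [hcoe, e1, e2, hGh]
    congr 1
    refine Finset.sum_congr rfl fun j _ => ?_
    change _ = (φ j y - a j) * (fs y • h j _)
    rw [hφ, hy, one_smul, one_smul]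
  rw [hloc, map_add, Derivation.map_algebraMap, zero_add, map_sum, hcoe]
  refine Finset.sum_congr rfl fun j _ => ?_
  -- At `x` the factor `φ j - a j` vanishes, so only its derivative contributes, multiplied by the
  -- partial derivative of `g`.
  rw [Y.leibniz, map_sub, Derivation.map_algebraMap, sub_zero]
  change (φ j x - a j) * _ + (fs x • h j _) * Y (φ j) x = _
  rw [hφ, hfs.self_of_nhds, one_smul, one_smul, sub_self, zero_mul, zero_add, hh', mul_comm,
    hGg.fderiv_eq]
  rfl

end DualFrame

/-- The algebra of smooth functions on a closed manifold has a finite dual frame. -/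
theorem exists_isDualFrame.{u, v} (E : Type u) [NormedAddCommGroup E] [NormedSpace ℝ E]
    [FiniteDimensional ℝ E] (M : Type v) [TopologicalSpace M] [ChartedSpace E M]
    [IsManifold 𝓘(ℝ, E) ∞ M] [T2Space M] [CompactSpace M] : ∃ (ι : Type v) (_ : Fintype ι)
    (f : ι → C^∞⟮𝓘(ℝ, E), M; 𝓘(ℝ, ℝ), ℝ⟯)
    (X : ι → VectorField C^∞⟮𝓘(ℝ, E), M; 𝓘(ℝ, ℝ), ℝ⟯), IsDualFrame f X := by
  obtain ⟨ι, fs, -⟩ := SmoothBumpCovering.exists_isSubordinate 𝓘(ℝ, E) (s := (Set.univ : Set M))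
    (U := fun _ => Set.univ) isClosed_univ (fun _ _ => Filter.univ_mem)
  let _ : Fintype ι := fs.fintype
  -- Subordination to the interiors of `{fs i = 1}` makes the cut-off coordinates genuine ones near
  -- the support of `ρ i`. Compactness makes the index set finite.
  obtain ⟨ρ, hρ⟩ := SmoothPartitionOfUnity.exists_isSubordinate 𝓘(ℝ, E)
    (s := (Set.univ : Set M)) isClosed_univ (fun i => interior {x | fs i x = 1})
    (fun _ => isOpen_interior) (fun x _ => Set.mem_iUnion.2 ⟨fs.ind x trivial,
      mem_interior_iff_mem_nhds.2 (fs.eventuallyEq_one x trivial)⟩)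
  have hc : ∀ i, tsupport (ρ i) ⊆ (extChartAt 𝓘(ℝ, E) (fs.c i)).source := fun i x hx =>
    fs.mem_extChartAt_source_of_eq_one (interior_subset (s := {x | fs i x = 1}) (hρ i hx))
  let b := Module.finBasis ℝ E
  let f : ι × Fin (Module.finrank ℝ E) → C^∞⟮𝓘(ℝ, E), M; 𝓘(ℝ, ℝ), ℝ⟯ := fun p =>
    ⟨fun y => fs p.1 y • b.coord p.2 (extChartAt 𝓘(ℝ, E) (fs.c p.1) y), (fs p.1).contMDiff_smul
      ((b.coord p.2).toContinuousLinearMap.contMDiff.comp_contMDiffOn contMDiffOn_extChartAt)⟩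
  refine ⟨_, inferInstance, f, fun p => cutoffField ρ p.1 (fs.c p.1) (hc p.1) (b p.2),
    fun Y => ?_⟩
  ext g x
  let A := C^∞⟮𝓘(ℝ, E), M; 𝓘(ℝ, ℝ), ℝ⟯
  let ev : VectorField A →+ ℝ := ⟨⟨fun Z => Z g x, rfl⟩, fun _ _ => rfl⟩
  change ev _ = ev _
  rw [map_sum, Fintype.sum_prod_type]
  change ∑ i, ∑ j, Y (f (i, j)) x * (ρ i x * chartDeriv (fs.c i) (b j) g x) = Y g x
  -- On each chart the coordinate expansion of `Y` gives `ρ i · Y g`; summing the partition of unity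
  -- gives `Y g`.
  have h : ∀ i, ∑ j, Y (f (i, j)) x * (ρ i x * chartDeriv (fs.c i) (b j) g x) =
      ρ i x * Y g x := by
    intro i
    by_cases hx : x ∈ tsupport (ρ i)
    · rw [derivation_apply_eq_sum b (fs i) (mem_interior_iff_mem_nhds.1 (hρ i hx))
        (fun j => f (i, j)) (fun _ _ => rfl) Y g, Finset.mul_sum]
      exact Finset.sum_congr rfl fun j _ => mul_left_comm _ _ _
    · rw [image_eq_zero_of_notMem_tsupport hx]; simp
  rw [Finset.sum_congr rfl fun i _ => h i, ← Finset.sum_mul, ← finsum_eq_sum_of_fintype,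
    ρ.sum_eq_one trivial, one_mul]

end

end QDR
end

theorem theorem3p5 {E : Type*} [NormedAddCommGroup E] [NormedSpace ℝ E] [FiniteDimensional ℝ E]
    {M : Type*} [TopologicalSpace M] [ChartedSpace E M] [IsManifold 𝓘(ℝ, E) ∞ M]
    [T2Space M] [CompactSpace M] :
    (∀ σ : Form C^∞⟮𝓘(ℝ, E), M; 𝓘(ℝ, ℝ), ℝ⟯ 2, IsSymplectic σ → ∃ w, IsInverse σ w) ∧
    ∀ w : Bivector C^∞⟮𝓘(ℝ, E), M; 𝓘(ℝ, ℝ), ℝ⟯,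
      (IsPoisson w ∨ ∃ σ, IsSymplectic σ ∧ IsInverse σ w) →
      SpectralSequenceDegenerates w ∧ IsDeformation w ∧ ClosedFormsExtend w := by
  obtain ⟨ι, _, f, X, hX⟩ := exists_isDualFrame E M
  refine ⟨fun σ hσ => exists_isInverse hX hσ, fun w hw => conclusions_of_isPoisson hX ?_⟩
  obtain hw | ⟨σ, hσ, hw⟩ := hw
  · exact hw
  · exact isPoisson_of_isInverse hσ hw
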